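/- **Theorem.** Let $n\ge 1$, $\rho\in[0,1]$ and $0<p_0\le p_1\le 1$ with $p_0<1$. In the planted dense subgraph model, $\theta=(\theta_1,\dots,\theta_n)\in\{0,1\}^n$ has i.i.d. $\mathrm{Bernoulli}(\rho)$ entries and, conditionally on $\theta$, the observations $Y_{ij}\in\{0,1\}$, $1\le i<j\le n$, are independent with $Y_{ij}\sim\mathrm{Bernoulli}(p_0+(p_1-p_0)\theta_i\theta_j)$. The goal is to estimate $x:=\theta_1$. For $D\in\{0,1,2,\dots\}$ let $$\mathrm{Corr}_{\le D}:=\sup_f\frac{\mathbb E[f(Y)\,x]}{\sqrt{\mathbb E[f(Y)^2]\cdot\mathbb E[x^2]}},$$ where $f$ ranges over the real polynomials of total degree at most $D$ in the variables $(Y_{ij})_{i<j}$ with $\mathbb E[f(Y)^2]\neq0$; for a real number $t\ge 0$ put $\mathrm{Corr}_{\le t}:=\mathrm{Corr}_{\le\lfloor t\rfloor}$. Define $$\lambda:=\frac{p_1-p_0}{\sqrt{p_0(1-p_0)}}.$$ For every constant $\varepsilon>0$ there is a constant $C=C(\varepsilon)>0$, depending only on $\varepsilon$, such that the following holds. (a)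 (Lower bound.) For all $n\ge1$, all $D\in\{0,1,2,\dots\}$, all $0<\rho<1$ and all $p_0,p_1$ as above: if $$\lambda\le(1-\varepsilon)\,(\rho\sqrt{en})^{-1}\sqrt{1-\rho}\qquad\text{and}\qquad D\le\lambda^{-2}/C$$ (where $\lambda^{-2}=+\infty$ if $\lambda=0$), then $$\mathrm{Corr}_{\le D}\le C\sqrt{\frac{\rho}{1-\rho}}.$$ (b) (Upper bound.) For all sequences of parameters $\rho=\rho_n$, $p_0=p_{0,n}$, $p_1=p_{1,n}$ as above: if, as $n\to\infty$, $$\lambda\ge(1+\varepsilon)(\rho\sqrt{en})^{-1}\ \text{ for all sufficiently large } n,\qquad \rho=\omega(n^{-1}\log^{12}n),\qquad \rho=o(\log^{-12}n),\qquad p_0=\omega(n^{-1}\log^{24}n),$$ then $$\mathrm{Corr}_{\le C\log n}=1-o(1)\qquad\text{as } n\to\infty.$$ -/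

import Mathlib

open Filter Topology Asymptotics

noncomputable section

namespace PDS

/-- The vertex pairs `(i, j)` with `i < j`; the vertex set `{1, …, n}` is `Fin n`. -/
abbrev Edge (n : ℕ) : Type := {e : Fin n × Fin n // e.1 < e.2}

/-- The real number `0` or `1` attached to a bit. -/
def bit (b : Bool) : ℝ := if b then 1 else 0

/-- Probability that a `Bernoulli(p)` variable takes the value `b`. -/
def bern (p : ℝ) (b : Bool) : ℝ := if b then p else 1 - p

/-- Joint probability mass function of `(θ, Y)` in the planted dense subgraph model: the `θ i` are
i.i.d. `Bernoulli(ρ)` and, given `θ`, the `Y_{ij}` with `i < j` are independent with law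
`Bernoulli(p₀ + (p₁ - p₀) θ_i θ_j)`. -/
def pmf (n : ℕ) (ρ p₀ p₁ : ℝ) (θ : Fin n → Bool) (Y : Edge n → Bool) : ℝ :=
  (∏ i, bern ρ (θ i)) *
    ∏ e : Edge n, bern (p₀ + (p₁ - p₀) * bit (θ e.1.1) * bit (θ e.1.2)) (Y e)

/-- Expectation of a function of `(θ, Y)` in the planted dense subgraph model. -/
def expect (n : ℕ) (ρ p₀ p₁ : ℝ) (F : (Fin n → Bool) → (Edge n → Bool) → ℝ) : ℝ :=
  ∑ θ : Fin n → Bool, ∑ Y : Edge n → Bool, pmf n ρ p₀ p₁ θ Y * F θ Y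

/-- The quantity to be estimated: the membership indicator of the first vertex
(with the value `0` if there are no vertices). -/
def target (n : ℕ) (θ : Fin n → Bool) : ℝ :=
  if h : 0 < n then bit (θ ⟨0, h⟩) else 0

/-- The value of the polynomial `f` in the variables `Y_{ij}`, `i < j`, at the observed graph. -/
def evalAt {n : ℕ} (f : MvPolynomial (Edge n) ℝ) (Y : Edge n → Bool) : ℝ :=
  MvPolynomial.eval (fun e => bit (Y e)) f

/-- The set of normalized correlations `E[f(Y) x] / √(E[f(Y)²] E[x²])` over polynomials `f` of
total degree at most `D` with `E[f(Y)²] ≠ 0`. -/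
def corrSet (n D : ℕ) (ρ p₀ p₁ : ℝ) : Set ℝ :=
  {r | ∃ f : MvPolynomial (Edge n) ℝ, f.totalDegree ≤ D ∧
    0 < expect n ρ p₀ p₁ (fun _ Y => evalAt f Y ^ 2) ∧
    r = expect n ρ p₀ p₁ (fun θ Y => evalAt f Y * target n θ) /
      Real.sqrt (expect n ρ p₀ p₁ (fun _ Y => evalAt f Y ^ 2) *
        expect n ρ p₀ p₁ (fun θ _ => target n θ ^ 2))}

/-- The degree-`D` maximum correlation. -/
def corr (n D : ℕ) (ρ p₀ p₁ : ℝ) : ℝ := sSup (corrSet n D ρ p₀ p₁)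

/-- The signal-to-noise parameter `λ = (p₁ - p₀) / √(p₀ (1 - p₀))`. -/
def snr (p₀ p₁ : ℝ) : ℝ := (p₁ - p₀) / Real.sqrt (p₀ * (1 - p₀))

theorem bern_nonneg {p : ℝ} (h0 : 0 ≤ p) (h1 : p ≤ 1) (b : Bool) : 0 ≤ bern p b := by
  unfold bern; split_ifs <;> linarith

theorem pmf_nonneg {n : ℕ} {ρ p₀ p₁ : ℝ} (hρ0 : 0 ≤ ρ) (hρ1 : ρ ≤ 1) (h0 : 0 ≤ p₀)
    (h01 : p₀ ≤ p₁) (h1 : p₁ ≤ 1) (θ : Fin n → Bool) (Y : Edge n → Bool) :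
    0 ≤ pmf n ρ p₀ p₁ θ Y := by
  refine mul_nonneg (Finset.prod_nonneg fun i _ => bern_nonneg hρ0 hρ1 _)
    (Finset.prod_nonneg fun e _ => bern_nonneg ?_ ?_ _)
  · unfold bit; split_ifs <;> nlinarith
  · unfold bit; split_ifs <;> nlinarith

theorem sum_prod_bern {ι : Type*} [Fintype ι] [DecidableEq ι] (p : ι → ℝ) :
    ∑ b : ι → Bool, ∏ i, bern (p i) (b i) = 1 := by
  rw [← Fintype.prod_sum (fun i b => bern (p i) b)]
  simp [bern]

/-- The masses add up to one. -/
theorem expect_one (n : ℕ) (ρ p₀ p₁ : ℝ) : expect n ρ p₀ p₁ (fun _ _ => 1) = 1 := by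
  simp only [expect, pmf, mul_one, ← Finset.mul_sum, sum_prod_bern]

theorem expect_mul_sq_le {n : ℕ} {ρ p₀ p₁ : ℝ} (hρ0 : 0 ≤ ρ) (hρ1 : ρ ≤ 1) (h0 : 0 ≤ p₀)
    (h01 : p₀ ≤ p₁) (h1 : p₁ ≤ 1) (F G : (Fin n → Bool) → (Edge n → Bool) → ℝ) :
    expect n ρ p₀ p₁ (fun θ Y => F θ Y * G θ Y) ^ 2 ≤
      expect n ρ p₀ p₁ (fun θ Y => F θ Y ^ 2) * expect n ρ p₀ p₁ (fun θ Y => G θ Y ^ 2) := by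
  simp only [expect, ← Fintype.sum_prod_type']
  refine Finset.sum_sq_le_sum_mul_sum_of_sq_le_mul _ (fun x _ => ?_) (fun x _ => ?_)
    (fun x _ => ?_)
  · exact mul_nonneg (pmf_nonneg hρ0 hρ1 h0 h01 h1 _ _) (sq_nonneg _)
  · exact mul_nonneg (pmf_nonneg hρ0 hρ1 h0 h01 h1 _ _) (sq_nonneg _)
  · exact le_of_eq (by ring)

/-- The supremum that defines `corr` is a least upper bound. -/
theorem isLUB_corr {n D : ℕ} {ρ p₀ p₁ : ℝ} (hρ0 : 0 ≤ ρ) (hρ1 : ρ ≤ 1) (h0 : 0 ≤ p₀)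
    (h01 : p₀ ≤ p₁) (h1 : p₁ ≤ 1) : IsLUB (corrSet n D ρ p₀ p₁) (corr n D ρ p₀ p₁) := by
  refine isLUB_csSup ⟨_, 1, by simp, ?_, rfl⟩ ⟨1, ?_⟩
  · simp [evalAt, expect_one]
  · rintro r ⟨f, -, -, rfl⟩
    refine div_le_one_of_le₀ (Real.le_sqrt_of_sq_le ?_) (Real.sqrt_nonneg _)
    exact expect_mul_sq_le hρ0 hρ1 h0 h01 h1 (fun _ Y => evalAt f Y) (fun θ _ => target n θ)

end PDS

end

/-!
Standardizing the edge variables turns `Y` into variables with mean zero and variance one outside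
the community and mean `λ = snr p₀ p₁` on pairs inside it. The products `chi S` of these variables
over edge sets `S` span all polynomials, and `E[chi S * chi T]` factorizes given the labels `θ`
(`expect_mul_chi_mul_chi`).

Lower bound. By duality it is enough to find a function `U` of *both* the labels and the
observations with `E[U * chi S] = E[θ₁ * chi S]` for all `|S| ≤ D`: by Cauchy–Schwarz the
correlation is then at most `√(E[U²] / E[θ₁²])`. Such a `U` is explicit (`certificate`): it is a
combination, over edge sets `F` connected to the root vertex, of `chi F` times the indicator that
no vertex of `F` (nor the root) lies in the community. On this event the edges of `F` are pure
noise, so that the term of `F` is seen by `chi S` only if `F` is the connected component of the root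
in `S`, and the terms are orthogonal to each other (`expect_outside_mul_chi`,
`expect_outside_mul_outside`). Hence `E[U²]` is the generating function of connected edge sets at
the root with weight `λ²` per edge and `ρ² / (1 - ρ)` per vertex. Encoding a connected set by its
vertices, a spanning tree and the remaining edges (`sum_rootedSets_le_codes`), and using
`(v + 1) ^ v / v! ≤ e ^ (v + 1)`, this is a geometric series with ratio `e n λ² ρ² / (1 - ρ)` up to
a factor near one, where `D ≤ λ⁻² / C` controls the remaining edges (`sum_rootedSets_le`).

Upper bound. Above the threshold, `ν = 1 / (n ρ² λ²)` is at most `e / (1 + ε)² < e`. The polynomial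
is `treePoly`, the sum of `chi` over all injective placements of a family of trees at the root. A
tree has two branches at the root, each a chain of `m ≈ log n` blocks; a block is a spine vertex
with `t + 1` levels of `s` vertices, each of which chooses its parent freely among the `s` vertices
of the level below. So there are `s ^ s` shapes per level, while a subgraph that is to be recognized
as the levels of such a tree can be labelled in at most `s!` ways per level (`card_zeroConfigs_le`).
By Stirling's formula the quotient `ν ^ s * s! / s ^ s` decays with `s`, since `ν < e`; this is
where the threshold appears (`exists_zeroBlockBound_le`). The spine vertex and the lowest level cost a
constant factor, which is absorbed by taking many levels.

In the second moment, one tree is fixed and the sum runs over the labelled vertices of the other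
(`expect_chi_mul_chi_le`). It is a sum over tree-indexed chains of states with a kernel `weight`, so
it can be computed block by block (`chainSum_succ`). A vertex that is not shared between the trees
carries the weight one of the first moment squared; a shared vertex inside the community costs a
factor that tends to zero (`KernelBound`); and at a vertex outside the community all edges of the
fixed tree must be shared, so that if a whole block lies outside it is one of the few
subgraphs counted above. The recursion `chainSum_le` shows that the main contribution comes from
trees that share only the root, which gives the ratio one of second moment and squared first
moment (`corr_ge`). The root outside the community has a weight `1 / ρ` relative to the root inside.
It is compensated because then each of the two branches either stays outside, which costs
`q ^ m ≤ 1 / n`, or returns to the community at a cost of order `ρ`; two branches yield a total of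
order `ρ² / ρ`.
-/

noncomputable section

namespace PDS

/-! ### Moments of the standardized edge variables -/

/-- The standardized edge variable `(Y_e - p₀) / √(p₀ (1 - p₀))`. -/
def stdBit (p₀ : ℝ) (b : Bool) : ℝ := (bit b - p₀) / Real.sqrt (p₀ * (1 - p₀))

/-- The product of the standardized edge variables over the edge set `S`. -/
def chi {n : ℕ} (p₀ : ℝ) (S : Finset (Edge n)) (Y : Edge n → Bool) : ℝ :=
  ∏ e ∈ S, stdBit p₀ (Y e)

/-- The excess variance of a standardized edge variable inside the community. -/
def excess (p₀ p₁ : ℝ) : ℝ := (p₁ - p₀) * (1 - 2 * p₀) / (p₀ * (1 - p₀))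

/-- The indicator that both ends of an edge lie in the community. -/
def both {n : ℕ} (θ : Fin n → Bool) (e : Edge n) : ℝ := bit (θ e.1.1) * bit (θ e.1.2)

/-- Expectation over the community labels alone. -/
def labelExpect (n : ℕ) (ρ : ℝ) (h : (Fin n → Bool) → ℝ) : ℝ :=
  ∑ θ : Fin n → Bool, (∏ i, bern ρ (θ i)) * h θ

lemma bit_nonneg (b : Bool) : 0 ≤ bit b := by unfold bit; split_ifs <;> norm_num

lemma bit_le_one (b : Bool) : bit b ≤ 1 := by unfold bit; split_ifs <;> norm_num

@[simp] lemma bit_true : bit true = 1 := by simp [bit]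

@[simp] lemma bit_false : bit false = 0 := by simp [bit]

lemma bit_mul_self (b : Bool) : bit b * bit b = bit b := by cases b <;> simp

lemma both_nonneg {n : ℕ} (θ : Fin n → Bool) (e : Edge n) : 0 ≤ both θ e :=
  mul_nonneg (bit_nonneg _) (bit_nonneg _)

lemma stdBit_mean {p₀ p₁ : ℝ} (t : ℝ) :
    ∑ b : Bool, bern (p₀ + (p₁ - p₀) * t) b * stdBit p₀ b = snr p₀ p₁ * t := by
  simp only [Fintype.sum_bool, bern, stdBit, snr, bit_true, bit_false, if_true]
  simp only [Bool.false_eq_true, if_false]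
  ring

lemma stdBit_sq {p₀ p₁ : ℝ} (h0 : 0 < p₀) (h1 : p₀ < 1) (t : ℝ) :
    ∑ b : Bool, bern (p₀ + (p₁ - p₀) * t) b * (stdBit p₀ b * stdBit p₀ b) =
      1 + excess p₀ p₁ * t := by
  have hs : Real.sqrt (p₀ * (1 - p₀)) ^ 2 = p₀ * (1 - p₀) :=
    Real.sq_sqrt (mul_nonneg h0.le (by linarith))
  have hq : (1 - p₀) ≠ 0 := by linarith
  have h0' := h0.ne'
  have h2 : ∀ b, stdBit p₀ b * stdBit p₀ b = (bit b - p₀) ^ 2 / (p₀ * (1 - p₀)) := fun b => by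
    rw [stdBit, div_mul_div_comm, ← pow_two, ← pow_two, hs]
  simp only [h2, Fintype.sum_bool, bern, excess, bit_true, bit_false, if_true,
    Bool.false_eq_true, if_false]
  field_simp
  ring

/-- Conditionally on the labels the edge variables are independent. -/
lemma expect_mul_prod {n : ℕ} (ρ p₀ p₁ : ℝ) (h : (Fin n → Bool) → ℝ)
    (g : Edge n → Bool → ℝ) :
    expect n ρ p₀ p₁ (fun θ Y => h θ * ∏ e, g e (Y e)) =
      labelExpect n ρ (fun θ => h θ *
        ∏ e, ∑ b : Bool, bern (p₀ + (p₁ - p₀) * both θ e) b * g e b) := by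
  unfold expect labelExpect
  refine Finset.sum_congr rfl fun θ _ => ?_
  beta_reduce
  rw [Fintype.prod_sum (fun e b => bern (p₀ + (p₁ - p₀) * both θ e) b * g e b),
    Finset.mul_sum, Finset.mul_sum]
  refine Finset.sum_congr rfl fun Y _ => ?_
  rw [Finset.prod_mul_distrib]
  simp only [pmf, both, mul_assoc]
  ring

lemma chi_eq_prod {n : ℕ} (p₀ : ℝ) (S : Finset (Edge n)) (Y : Edge n → Bool) :
    chi p₀ S Y = ∏ e, if e ∈ S then stdBit p₀ (Y e) else 1 := by
  rw [chi, Finset.prod_ite_mem, Finset.univ_inter]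

/-- The conditional mean of `chi S * chi T` given the labels. -/
lemma expect_mul_chi_mul_chi {n : ℕ} {ρ p₀ p₁ : ℝ} (h0 : 0 < p₀) (h1 : p₀ < 1)
    (h : (Fin n → Bool) → ℝ) (S T : Finset (Edge n)) :
    expect n ρ p₀ p₁ (fun θ Y => h θ * (chi p₀ S Y * chi p₀ T Y)) =
      labelExpect n ρ (fun θ => h θ * ((∏ e ∈ S \ T, snr p₀ p₁ * both θ e) *
        ∏ e ∈ T, if e ∈ S then 1 + excess p₀ p₁ * both θ e else snr p₀ p₁ * both θ e)) := by
  have h2 : ∀ Y : Edge n → Bool, chi p₀ S Y * chi p₀ T Y = ∏ e, (fun e b =>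
      (if e ∈ S then stdBit p₀ b else 1) * (if e ∈ T then stdBit p₀ b else 1)) e (Y e) := by
    intro Y
    rw [chi_eq_prod, chi_eq_prod, ← Finset.prod_mul_distrib]
  refine (congrArg _ (funext fun θ => funext fun Y => by rw [h2])).trans
    ((expect_mul_prod ρ p₀ p₁ h (fun e b => (if e ∈ S then stdBit p₀ b else 1) *
      (if e ∈ T then stdBit p₀ b else 1))).trans ?_)
  congr 1; funext θ; congr 1
  have h3 : (∏ e ∈ S \ T, snr p₀ p₁ * both θ e) =
      ∏ e, if e ∈ S \ T then snr p₀ p₁ * both θ e else 1 := by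
    rw [Finset.prod_ite_mem, Finset.univ_inter]
  have h4 : (∏ e ∈ T, if e ∈ S then 1 + excess p₀ p₁ * both θ e else snr p₀ p₁ * both θ e) =
      ∏ e, if e ∈ T then (if e ∈ S then 1 + excess p₀ p₁ * both θ e
        else snr p₀ p₁ * both θ e) else 1 := by
    rw [Finset.prod_ite_mem, Finset.univ_inter]
  rw [h3, h4, ← Finset.prod_mul_distrib]
  refine Finset.prod_congr rfl fun e _ => ?_
  by_cases hS : e ∈ S <;> by_cases hT : e ∈ T
  · simp only [hS, hT, if_true, Finset.mem_sdiff, not_true, and_false, if_false, one_mul]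
    exact stdBit_sq h0 h1 _
  · simp only [hS, hT, if_true, Finset.mem_sdiff, not_false_eq_true, and_true, if_false, mul_one]
    exact stdBit_mean _
  · simp only [hS, hT, if_true, Finset.mem_sdiff, false_and, if_false, one_mul]
    exact stdBit_mean _
  · simp [hS, hT, bern]

lemma expect_mul_chi {n : ℕ} {ρ p₀ p₁ : ℝ} (h0 : 0 < p₀) (h1 : p₀ < 1)
    (h : (Fin n → Bool) → ℝ) (S : Finset (Edge n)) :
    expect n ρ p₀ p₁ (fun θ Y => h θ * chi p₀ S Y) =
      labelExpect n ρ (fun θ => h θ * ∏ e ∈ S, snr p₀ p₁ * both θ e) := by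
  have := expect_mul_chi_mul_chi (ρ := ρ) (p₁ := p₁) h0 h1 h S ∅
  simpa [chi] using this

lemma labelExpect_prod {n : ℕ} (ρ : ℝ) (g : Fin n → Bool → ℝ) :
    labelExpect n ρ (fun θ => ∏ v, g v (θ v)) = ∏ v, ∑ b : Bool, bern ρ b * g v b := by
  rw [Fintype.prod_sum (fun v b => bern ρ b * g v b)]
  simp only [labelExpect, Finset.prod_mul_distrib]

lemma labelExpect_const_mul {n : ℕ} (ρ c : ℝ) (h : (Fin n → Bool) → ℝ) :
    labelExpect n ρ (fun θ => c * h θ) = c * labelExpect n ρ h := by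
  simp only [labelExpect, Finset.mul_sum]
  exact Finset.sum_congr rfl fun _ _ => by ring

lemma labelExpect_sum {n : ℕ} {ι : Type*} (s : Finset ι) (ρ : ℝ)
    (h : ι → (Fin n → Bool) → ℝ) :
    labelExpect n ρ (fun θ => ∑ i ∈ s, h i θ) = ∑ i ∈ s, labelExpect n ρ (h i) := by
  simp only [labelExpect, Finset.mul_sum]
  exact Finset.sum_comm

lemma labelExpect_mono {n : ℕ} {ρ : ℝ} (hρ0 : 0 ≤ ρ) (hρ1 : ρ ≤ 1)
    {g h : (Fin n → Bool) → ℝ} (hgh : ∀ θ, g θ ≤ h θ) :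
    labelExpect n ρ g ≤ labelExpect n ρ h :=
  Finset.sum_le_sum fun _ _ => mul_le_mul_of_nonneg_left (hgh _)
    (Finset.prod_nonneg fun _ _ => bern_nonneg hρ0 hρ1 _)

lemma expect_sum {n : ℕ} {ι : Type*} (s : Finset ι) (ρ p₀ p₁ : ℝ)
    (F : ι → (Fin n → Bool) → (Edge n → Bool) → ℝ) :
    expect n ρ p₀ p₁ (fun θ Y => ∑ i ∈ s, F i θ Y) = ∑ i ∈ s, expect n ρ p₀ p₁ (F i) := by
  simp only [expect, Finset.mul_sum]
  rw [Finset.sum_comm]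
  simp only [Finset.sum_comm (s := s)]
  rw [Finset.sum_comm]

lemma expect_const_mul {n : ℕ} (ρ p₀ p₁ c : ℝ) (F : (Fin n → Bool) → (Edge n → Bool) → ℝ) :
    expect n ρ p₀ p₁ (fun θ Y => c * F θ Y) = c * expect n ρ p₀ p₁ F := by
  simp only [expect, Finset.mul_sum]
  exact Finset.sum_congr rfl fun _ _ => Finset.sum_congr rfl fun _ _ => by ring

/-- The labels on disjoint vertex sets `A`, `B` are independent. -/
lemma labelExpect_disjoint {n : ℕ} (ρ : ℝ) {A B : Finset (Fin n)} (hAB : Disjoint A B) :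
    labelExpect n ρ (fun θ => (∏ v ∈ A, (1 - bit (θ v))) * ∏ v ∈ B, bit (θ v)) =
      (1 - ρ) ^ A.card * ρ ^ B.card := by
  have h1 : ∀ θ : Fin n → Bool, (∏ v ∈ A, (1 - bit (θ v))) * ∏ v ∈ B, bit (θ v) =
      ∏ v, (fun v b => (if v ∈ A then 1 - bit b else 1) * if v ∈ B then bit b else 1) v (θ v) := by
    intro θ
    rw [Finset.prod_mul_distrib, Finset.prod_ite_mem, Finset.prod_ite_mem, Finset.univ_inter,
      Finset.univ_inter]
  refine (congrArg (labelExpect n ρ) (funext h1)).trans ((labelExpect_prod ρ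
    (fun v b => (if v ∈ A then 1 - bit b else 1) * if v ∈ B then bit b else 1)).trans ?_)
  have h2 : (1 - ρ) ^ A.card * ρ ^ B.card =
      ∏ v, (if v ∈ A then 1 - ρ else 1) * if v ∈ B then ρ else 1 := by
    rw [Finset.prod_mul_distrib, Finset.prod_ite_mem, Finset.prod_ite_mem, Finset.univ_inter,
      Finset.univ_inter, Finset.prod_const, Finset.prod_const]
  rw [h2]
  refine Finset.prod_congr rfl fun v _ => ?_
  by_cases hA : v ∈ A
  · have hB : v ∉ B := Finset.disjoint_left.mp hAB hA
    simp [hA, hB, bern]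
  · by_cases hB : v ∈ B <;> simp [hA, hB, bern]

/-- The set of ends of the edges in `S`. -/
def ends {n : ℕ} (S : Finset (Edge n)) : Finset (Fin n) :=
  S.biUnion fun e => {e.1.1, e.1.2}

lemma mem_ends {n : ℕ} {S : Finset (Edge n)} {v : Fin n} :
    v ∈ ends S ↔ ∃ e ∈ S, v = e.1.1 ∨ v = e.1.2 := by
  simp [ends]

lemma prod_bit_eq {n : ℕ} (θ : Fin n → Bool) (A : Finset (Fin n)) :
    ∏ v ∈ A, bit (θ v) = if ∀ v ∈ A, θ v = true then 1 else 0 := by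
  split_ifs with h
  · exact Finset.prod_eq_one fun v hv => by simp [h v hv]
  · push Not at h
    obtain ⟨v, hv, h⟩ := h
    exact Finset.prod_eq_zero hv (by simp [h])

lemma prod_both_eq {n : ℕ} (θ : Fin n → Bool) (S : Finset (Edge n)) :
    ∏ e ∈ S, both θ e = ∏ v ∈ ends S, bit (θ v) := by
  rw [prod_bit_eq]
  split_ifs with h
  · refine Finset.prod_eq_one fun e he => ?_
    rw [both, h _ (mem_ends.2 ⟨e, he, Or.inl rfl⟩), h _ (mem_ends.2 ⟨e, he, Or.inr rfl⟩)]
    simp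
  · push Not at h
    obtain ⟨v, hv, h⟩ := h
    obtain ⟨e, he, hv⟩ := mem_ends.1 hv
    refine Finset.prod_eq_zero he ?_
    rcases hv with rfl | rfl <;> simp [both, h]

/-! ### A dual certificate for upper bounds on the correlation -/

/-- The graph on the vertex set with edge set `S`. -/
def graph {n : ℕ} (S : Finset (Edge n)) : SimpleGraph (Fin n) where
  Adj u v := ∃ e ∈ S, e.1 = (u, v) ∨ e.1 = (v, u)
  symm := ⟨fun _ _ ⟨e, he, h⟩ => ⟨e, he, h.symm⟩⟩
  loopless := ⟨fun u ⟨e, _, h⟩ => by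
    have h2 := e.2
    rcases h with h | h <;> simp [h] at h2⟩

lemma graph_adj_of_mem {n : ℕ} {S : Finset (Edge n)} {e : Edge n} (he : e ∈ S) :
    (graph S).Adj e.1.1 e.1.2 := ⟨e, he, Or.inl rfl⟩

lemma graph_mono {n : ℕ} {S T : Finset (Edge n)} (h : S ⊆ T) : graph S ≤ graph T :=
  fun _ _ ⟨e, he, h2⟩ => ⟨e, h he, h2⟩

open Classical in
/-- The edges of `S` in the connected component of the vertex `r`. -/
def component {n : ℕ} (r : Fin n) (S : Finset (Edge n)) : Finset (Edge n) :=
  S.filter fun e => (graph S).Reachable r e.1.1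

lemma mem_component {n : ℕ} {r : Fin n} {S : Finset (Edge n)} {e : Edge n} :
    e ∈ component r S ↔ e ∈ S ∧ (graph S).Reachable r e.1.1 := by
  simp [component]

lemma component_subset {n : ℕ} (r : Fin n) (S : Finset (Edge n)) : component r S ⊆ S :=
  fun _ h => (mem_component.1 h).1

/-- The vertex `r` together with the ends of the edges in `S`. -/
def verts {n : ℕ} (r : Fin n) (S : Finset (Edge n)) : Finset (Fin n) := insert r (ends S)

lemma reachable_snd_iff {n : ℕ} {r : Fin n} {S : Finset (Edge n)} {e : Edge n} (he : e ∈ S) :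
    (graph S).Reachable r e.1.2 ↔ (graph S).Reachable r e.1.1 :=
  ⟨fun h => h.trans (graph_adj_of_mem he).symm.reachable,
    fun h => h.trans (graph_adj_of_mem he).reachable⟩

lemma reachable_induction {n : ℕ} {r : Fin n} {S : Finset (Edge n)} {P : Fin n → Prop}
    (h0 : P r) (h1 : ∀ u v, (graph S).Reachable r u → P u → (graph S).Adj u v → P v) {v : Fin n}
    (hv : (graph S).Reachable r v) : P v := by
  rw [SimpleGraph.reachable_iff_reflTransGen] at hv
  induction hv with
  | refl => exact h0
  | tail h2 h3 ih =>
    exact h1 _ _ ((SimpleGraph.reachable_iff_reflTransGen _ _).2 h2) ih h3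

lemma reachable_component {n : ℕ} {r v : Fin n} {S : Finset (Edge n)}
    (hv : (graph S).Reachable r v) : (graph (component r S)).Reachable r v := by
  refine reachable_induction (P := fun v => (graph (component r S)).Reachable r v)
    (SimpleGraph.Reachable.refl _) (fun u v hu ih huv => ?_) hv
  obtain ⟨e, he, h⟩ := huv
  refine ih.trans (SimpleGraph.Adj.reachable ⟨e, mem_component.2 ⟨he, ?_⟩, h⟩)
  rcases h with h | h
  · simpa [h] using hu
  · rw [← reachable_snd_iff he]; simpa [h] using hu

lemma component_component {n : ℕ} (r : Fin n) (S : Finset (Edge n)) :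
    component r (component r S) = component r S := by
  refine (component_subset _ _).antisymm fun e he => ?_
  exact mem_component.2 ⟨he, reachable_component (mem_component.1 he).2⟩

lemma reachable_of_mem_verts_component {n : ℕ} {r v : Fin n} {S : Finset (Edge n)}
    (hv : v ∈ verts r (component r S)) : (graph S).Reachable r v := by
  rcases Finset.mem_insert.1 hv with rfl | hv
  · exact SimpleGraph.Reachable.refl _
  obtain ⟨e, he, h⟩ := mem_ends.1 hv
  obtain ⟨he, h2⟩ := mem_component.1 he
  rcases h with rfl | rfl
  · exact h2
  · exact (reachable_snd_iff he).2 h2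

lemma disjoint_verts_component {n : ℕ} (r : Fin n) (S : Finset (Edge n)) :
    Disjoint (verts r (component r S)) (ends (S \ component r S)) := by
  refine Finset.disjoint_left.2 fun v hv hv2 => ?_
  have h := reachable_of_mem_verts_component hv
  obtain ⟨e, he, h2⟩ := mem_ends.1 hv2
  obtain ⟨he, he2⟩ := Finset.mem_sdiff.1 he
  refine he2 (mem_component.2 ⟨he, ?_⟩)
  rcases h2 with rfl | rfl
  · exact h
  · exact (reachable_snd_iff he).1 h

/-- Among the edge sets that are connected to `r`, the component of `r` in `S` is the only one
contained in `S` that no further edge of `S` touches. -/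
lemma eq_component_iff {n : ℕ} {r : Fin n} {S F : Finset (Edge n)} (hF : component r F = F) :
    F = component r S ↔ F ⊆ S ∧ Disjoint (verts r F) (ends (S \ F)) := by
  constructor
  · rintro rfl
    exact ⟨component_subset _ _, disjoint_verts_component _ _⟩
  rintro ⟨hFS, hd⟩
  have hmem : ∀ e ∈ S, (e.1.1 ∈ verts r F ∨ e.1.2 ∈ verts r F) → e ∈ F := by
    intro e he h
    by_contra h2
    have h3 := Finset.mem_sdiff.2 ⟨he, h2⟩
    rcases h with h | h
    · exact Finset.disjoint_left.1 hd h (mem_ends.2 ⟨e, h3, Or.inl rfl⟩)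
    · exact Finset.disjoint_left.1 hd h (mem_ends.2 ⟨e, h3, Or.inr rfl⟩)
  have hreach : ∀ v, (graph S).Reachable r v → v ∈ verts r F := by
    intro v hv
    refine reachable_induction (P := fun v => v ∈ verts r F) (Finset.mem_insert_self _ _)
      (fun u v _ ih huv => ?_) hv
    obtain ⟨e, he, h⟩ := huv
    refine Finset.mem_insert_of_mem (mem_ends.2 ⟨e, hmem e he ?_, ?_⟩)
    · rcases h with h | h <;> simp [h, ih]
    · rcases h with h | h <;> simp [h]
  ext e
  rw [mem_component]
  constructor
  · intro he
    refine ⟨hFS he, ?_⟩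
    rw [← hF] at he
    exact (mem_component.1 he).2.mono (graph_mono hFS)
  · rintro ⟨he, h⟩
    exact hmem e he (Or.inl (hreach _ h))

/-- The label factor of the certificate: no vertex of `F`, nor `r`, lies in the community. -/
def outside {n : ℕ} (r : Fin n) (F : Finset (Edge n)) (θ : Fin n → Bool) : ℝ :=
  ∏ v ∈ verts r F, (1 - bit (θ v))

lemma outside_eq {n : ℕ} (r : Fin n) (F : Finset (Edge n)) (θ : Fin n → Bool) :
    outside r F θ = if ∀ v ∈ verts r F, θ v = false then 1 else 0 := by
  unfold outside
  split_ifs with h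
  · exact Finset.prod_eq_one fun v hv => by simp [h v hv]
  · push Not at h
    obtain ⟨v, hv, h⟩ := h
    exact Finset.prod_eq_zero hv (by simp [h])

lemma both_eq_zero_of_outside {n : ℕ} {r : Fin n} {F : Finset (Edge n)} {θ : Fin n → Bool}
    (h : ∀ v ∈ verts r F, θ v = false) {e : Edge n} (he : e ∈ F) : both θ e = 0 := by
  rw [both, h _ (Finset.mem_insert_of_mem (mem_ends.2 ⟨e, he, Or.inl rfl⟩))]
  simp

/-- Outside the community the edges of `F` are pure noise, so `chi F` correlates with `chi S` only
if `F` is the component of the root in `S`. -/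
lemma expect_outside_mul_chi {n : ℕ} {ρ p₀ p₁ : ℝ} (h0 : 0 < p₀) (h1 : p₀ < 1) {r : Fin n}
    {F S : Finset (Edge n)} (hF : component r F = F) :
    expect n ρ p₀ p₁ (fun θ Y => outside r F θ * (chi p₀ S Y * chi p₀ F Y)) =
      if F = component r S then snr p₀ p₁ ^ (S \ F).card *
        ((1 - ρ) ^ (verts r F).card * ρ ^ (ends (S \ F)).card) else 0 := by
  rw [expect_mul_chi_mul_chi h0 h1]
  have key : ∀ θ : Fin n → Bool, outside r F θ * ((∏ e ∈ S \ F, snr p₀ p₁ * both θ e) *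
        ∏ e ∈ F, if e ∈ S then 1 + excess p₀ p₁ * both θ e else snr p₀ p₁ * both θ e) =
      (if F ⊆ S then snr p₀ p₁ ^ (S \ F).card else 0) *
        (outside r F θ * ∏ v ∈ ends (S \ F), bit (θ v)) := by
    intro θ
    rw [outside_eq]
    split_ifs with h h2 h2
    · rw [Finset.prod_mul_distrib, Finset.prod_const, prod_both_eq]
      rw [Finset.prod_eq_one (s := F)]
      · ring
      · intro e he
        rw [if_pos (h2 he), both_eq_zero_of_outside h he]; ring
    · obtain ⟨e, he, he2⟩ := Finset.not_subset.1 h2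
      rw [Finset.prod_eq_zero (i := e) (s := F) he]
      · ring
      · rw [if_neg he2, both_eq_zero_of_outside h he]; ring
    · ring
    · ring
  rw [funext key, labelExpect_const_mul]
  by_cases hFS : F ⊆ S
  · by_cases hd : Disjoint (verts r F) (ends (S \ F))
    · rw [if_pos hFS, if_pos ((eq_component_iff hF).2 ⟨hFS, hd⟩)]
      unfold outside
      rw [labelExpect_disjoint ρ hd]
    · rw [if_neg fun h => hd ((eq_component_iff hF).1 h).2]
      have hz : ∀ θ : Fin n → Bool, outside r F θ * ∏ v ∈ ends (S \ F), bit (θ v) = 0 := by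
        intro θ
        obtain ⟨v, hv, hv2⟩ := Finset.not_disjoint_iff.1 hd
        cases h : θ v
        · rw [Finset.prod_eq_zero hv2 (by simp [h]), mul_zero]
        · rw [outside, Finset.prod_eq_zero hv (by simp [h]), zero_mul]
      rw [funext hz]
      simp [labelExpect]
  · rw [if_neg hFS, if_neg fun h => hFS ((eq_component_iff hF).1 h).1, zero_mul]

lemma labelExpect_outside {n : ℕ} (ρ : ℝ) (r : Fin n) (F : Finset (Edge n)) :
    labelExpect n ρ (outside r F) = (1 - ρ) ^ (verts r F).card := by
  have := labelExpect_disjoint ρ (A := verts r F) (B := ∅) (Finset.disjoint_empty_right _)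
  change labelExpect n ρ (fun θ => ∏ v ∈ verts r F, (1 - bit (θ v))) = _
  simpa using this

/-- The terms of the certificate are orthogonal. -/
lemma expect_outside_mul_outside {n : ℕ} {ρ p₀ p₁ : ℝ} (h0 : 0 < p₀) (h1 : p₀ < 1) (r : Fin n)
    (F G : Finset (Edge n)) :
    expect n ρ p₀ p₁ (fun θ Y => (outside r F θ * outside r G θ) * (chi p₀ F Y * chi p₀ G Y)) =
      if F = G then (1 - ρ) ^ (verts r F).card else 0 := by
  rw [expect_mul_chi_mul_chi h0 h1, ← labelExpect_outside]
  have key : ∀ θ : Fin n → Bool, (outside r F θ * outside r G θ) *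
      ((∏ e ∈ F \ G, snr p₀ p₁ * both θ e) *
        ∏ e ∈ G, if e ∈ F then 1 + excess p₀ p₁ * both θ e else snr p₀ p₁ * both θ e) =
      if F = G then outside r F θ else 0 := by
    intro θ
    by_cases hF : ∀ v ∈ verts r F, θ v = false
    · by_cases hG : ∀ v ∈ verts r G, θ v = false
      · split_ifs with h
        · subst h
          rw [Finset.sdiff_self, Finset.prod_empty, Finset.prod_eq_one, outside_eq, if_pos hF]
          · norm_num
          · intro e he
            rw [if_pos he, both_eq_zero_of_outside hF he]; ring
        · by_cases hs : F \ G = ∅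
          · have : ¬ G ⊆ F := fun h2 =>
              h (Finset.Subset.antisymm (Finset.sdiff_eq_empty_iff_subset.1 hs) h2)
            obtain ⟨e, he, he2⟩ := Finset.not_subset.1 this
            rw [Finset.prod_eq_zero (i := e) (s := G) he]
            · ring
            · rw [if_neg he2, both_eq_zero_of_outside hG he]; ring
          · obtain ⟨e, he⟩ := Finset.nonempty_iff_ne_empty.2 hs
            rw [Finset.prod_eq_zero he]
            · ring
            · rw [both_eq_zero_of_outside hF (Finset.mem_sdiff.1 he).1]; ring
      · rw [outside_eq r G, if_neg hG]
        split_ifs with h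
        · subst h; exact absurd hF hG
        · ring
    · rw [outside_eq r F, if_neg hF]
      simp
  rw [funext key]
  split_ifs <;> simp [labelExpect]

open Classical in
/-- The edge sets of at most `D` edges that are connected to `r`. -/
def rootedSets {n : ℕ} (r : Fin n) (D : ℕ) : Finset (Finset (Edge n)) :=
  Finset.univ.filter fun F => component r F = F ∧ F.card ≤ D

lemma mem_rootedSets {n : ℕ} {r : Fin n} {D : ℕ} {F : Finset (Edge n)} :
    F ∈ rootedSets r D ↔ component r F = F ∧ F.card ≤ D := by
  simp [rootedSets]

/-- The dual certificate: a function of labels and observations that has the same correlations as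
the target with all polynomials of degree at most `D`. -/
def certificate {n : ℕ} (ρ p₀ p₁ : ℝ) (r : Fin n) (D : ℕ) (θ : Fin n → Bool)
    (Y : Edge n → Bool) : ℝ :=
  ∑ F ∈ rootedSets r D, snr p₀ p₁ ^ F.card * (ρ / (1 - ρ)) ^ (verts r F).card *
    (outside r F θ * chi p₀ F Y)

lemma ends_union {n : ℕ} (S T : Finset (Edge n)) : ends (S ∪ T) = ends S ∪ ends T := by
  ext v; simp only [ends, Finset.mem_biUnion, Finset.mem_union]
  constructor
  · rintro ⟨e, he | he, h⟩
    · exact Or.inl ⟨e, he, h⟩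
    · exact Or.inr ⟨e, he, h⟩
  · rintro (⟨e, he, h⟩ | ⟨e, he, h⟩)
    · exact ⟨e, Or.inl he, h⟩
    · exact ⟨e, Or.inr he, h⟩

lemma expect_target_mul_chi {n : ℕ} {ρ p₀ p₁ : ℝ} (h0 : 0 < p₀) (h1 : p₀ < 1) (r : Fin n)
    (S : Finset (Edge n)) :
    expect n ρ p₀ p₁ (fun θ Y => bit (θ r) * chi p₀ S Y) =
      snr p₀ p₁ ^ S.card * ρ ^ (verts r S).card := by
  rw [expect_mul_chi h0 h1]
  have key : ∀ θ : Fin n → Bool, bit (θ r) * ∏ e ∈ S, snr p₀ p₁ * both θ e =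
      snr p₀ p₁ ^ S.card * ((∏ v ∈ (∅ : Finset (Fin n)), (1 - bit (θ v))) *
        ∏ v ∈ verts r S, bit (θ v)) := by
    intro θ
    rw [Finset.prod_mul_distrib, Finset.prod_const, prod_both_eq, verts, Finset.prod_empty]
    by_cases h : r ∈ ends S
    · rw [Finset.insert_eq_of_mem h, ← Finset.mul_prod_erase _ _ h]
      linear_combination (snr p₀ p₁ ^ S.card * ∏ x ∈ (ends S).erase r, bit (θ x)) *
        bit_mul_self (θ r)
    · rw [Finset.prod_insert h]; ring
  rw [funext key, labelExpect_const_mul, labelExpect_disjoint _ (Finset.disjoint_empty_left _)]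
  simp

/-- Only the component of `r` in `S` contributes, and the coefficients are chosen such that it gives
the correlation of `chi S` with the target. -/
lemma expect_certificate_mul_chi {n : ℕ} {ρ p₀ p₁ : ℝ} (hρ : ρ < 1) (h0 : 0 < p₀) (h1 : p₀ < 1)
    (r : Fin n) {D : ℕ} {S : Finset (Edge n)} (hS : S.card ≤ D) :
    expect n ρ p₀ p₁ (fun θ Y => certificate ρ p₀ p₁ r D θ Y * chi p₀ S Y) =
      expect n ρ p₀ p₁ (fun θ Y => bit (θ r) * chi p₀ S Y) := by
  rw [expect_target_mul_chi h0 h1]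
  have h2 : ∀ (θ : Fin n → Bool) (Y : Edge n → Bool),
      certificate ρ p₀ p₁ r D θ Y * chi p₀ S Y =
      ∑ F ∈ rootedSets r D, snr p₀ p₁ ^ F.card * (ρ / (1 - ρ)) ^ (verts r F).card *
        (outside r F θ * (chi p₀ S Y * chi p₀ F Y)) := by
    intro θ Y
    rw [certificate, Finset.sum_mul]
    exact Finset.sum_congr rfl fun F _ => by ring
  rw [funext fun θ => funext fun Y => h2 θ Y, expect_sum]
  simp only [expect_const_mul]
  have hq : (1 - ρ) ≠ 0 := by linarith
  rw [Finset.sum_eq_single (component r S)]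
  · rw [expect_outside_mul_chi h0 h1 (component_component r S), if_pos rfl]
    have hv : verts r S = verts r (component r S) ∪ ends (S \ component r S) := by
      rw [verts, verts, Finset.insert_union, ← ends_union,
        Finset.union_sdiff_of_subset (component_subset r S)]
    rw [hv, Finset.card_union_of_disjoint (disjoint_verts_component r S), pow_add,
      ← Finset.card_sdiff_add_card_eq_card (component_subset r S), pow_add, div_pow]
    field_simp
  · intro F hF hne
    rw [expect_outside_mul_chi h0 h1 (mem_rootedSets.1 hF).1, if_neg hne, mul_zero]
  · intro h
    exact absurd (mem_rootedSets.2 ⟨component_component r S,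
      (Finset.card_le_card (component_subset r S)).trans hS⟩) h

lemma expect_certificate_sq {n : ℕ} {ρ p₀ p₁ : ℝ} (hρ : ρ < 1) (h0 : 0 < p₀) (h1 : p₀ < 1)
    (r : Fin n) (D : ℕ) :
    expect n ρ p₀ p₁ (fun θ Y => certificate ρ p₀ p₁ r D θ Y ^ 2) =
      ∑ F ∈ rootedSets r D,
        (snr p₀ p₁ ^ 2) ^ F.card * (ρ ^ 2 / (1 - ρ)) ^ (verts r F).card := by
  have hq : (1 - ρ) ≠ 0 := by linarith
  have h2 : ∀ (θ : Fin n → Bool) (Y : Edge n → Bool),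
      certificate ρ p₀ p₁ r D θ Y ^ 2 =
      ∑ F ∈ rootedSets r D, ∑ G ∈ rootedSets r D,
        (snr p₀ p₁ ^ F.card * (ρ / (1 - ρ)) ^ (verts r F).card *
          (snr p₀ p₁ ^ G.card * (ρ / (1 - ρ)) ^ (verts r G).card)) *
        ((outside r F θ * outside r G θ) * (chi p₀ F Y * chi p₀ G Y)) := by
    intro θ Y
    rw [pow_two, certificate, Finset.sum_mul_sum]
    exact Finset.sum_congr rfl fun F _ => Finset.sum_congr rfl fun G _ => by ring
  rw [funext fun θ => funext fun Y => h2 θ Y, expect_sum]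
  refine Finset.sum_congr rfl fun F hF => ?_
  rw [expect_sum]
  simp only [expect_const_mul, expect_outside_mul_outside h0 h1, mul_ite, mul_zero]
  rw [Finset.sum_ite_eq, if_pos hF, div_pow, div_pow]
  field_simp
  ring

/-- A function of labels and observations that is orthogonal to all `chi S` with `|S| ≤ D` is
orthogonal to all polynomials of degree at most `D` in the observations. -/
lemma expect_mul_evalAt_eq_zero {n D : ℕ} {ρ p₀ p₁ : ℝ} (h0 : 0 < p₀) (h1 : p₀ < 1)
    {G : (Fin n → Bool) → (Edge n → Bool) → ℝ}
    (hG : ∀ S : Finset (Edge n), S.card ≤ D →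
      expect n ρ p₀ p₁ (fun θ Y => G θ Y * chi p₀ S Y) = 0)
    {f : MvPolynomial (Edge n) ℝ} (hf : f.totalDegree ≤ D) :
    expect n ρ p₀ p₁ (fun θ Y => G θ Y * evalAt f Y) = 0 := by
  set σ := Real.sqrt (p₀ * (1 - p₀)) with hσ
  have hσ0 : σ ≠ 0 := (Real.sqrt_pos.2 (mul_pos h0 (by linarith))).ne'
  have hbit : ∀ b, bit b = σ * stdBit p₀ b + p₀ := fun b => by
    rw [stdBit, ← hσ]; field_simp; ring
  -- square-free monomials expand into the `chi B` with `B ⊆ A`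
  have hmon : ∀ A : Finset (Edge n), A.card ≤ D →
      expect n ρ p₀ p₁ (fun θ Y => G θ Y * ∏ e ∈ A, bit (Y e)) = 0 := by
    intro A hA
    have h2 : ∀ (θ : Fin n → Bool) (Y : Edge n → Bool), G θ Y * ∏ e ∈ A, bit (Y e) =
        ∑ B ∈ A.powerset, (σ ^ B.card * p₀ ^ (A \ B).card) * (G θ Y * chi p₀ B Y) := by
      intro θ Y
      simp only [hbit]
      rw [Finset.prod_add, Finset.mul_sum]
      refine Finset.sum_congr rfl fun B _ => ?_
      rw [Finset.prod_mul_distrib, Finset.prod_const, Finset.prod_const, chi]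
      ring
    rw [funext fun θ => funext fun Y => h2 θ Y, expect_sum]
    refine Finset.sum_eq_zero fun B hB => ?_
    rw [expect_const_mul, hG B ((Finset.card_le_card (Finset.mem_powerset.1 hB)).trans hA),
      mul_zero]
  have h3 : ∀ (θ : Fin n → Bool) (Y : Edge n → Bool), G θ Y * evalAt f Y =
      ∑ d ∈ f.support, f.coeff d * (G θ Y * ∏ e ∈ d.support, bit (Y e)) := by
    intro θ Y
    rw [evalAt, MvPolynomial.eval_eq, Finset.mul_sum]
    refine Finset.sum_congr rfl fun d _ => ?_
    -- bits are idempotent, so exponents do not matter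
    have : ∏ e ∈ d.support, bit (Y e) ^ d e = ∏ e ∈ d.support, bit (Y e) := by
      refine Finset.prod_congr rfl fun e he => ?_
      have := Finsupp.mem_support_iff.1 he
      cases Y e <;> simp [this]
    rw [this]; ring
  rw [funext fun θ => funext fun Y => h3 θ Y, expect_sum]
  refine Finset.sum_eq_zero fun d hd => ?_
  rw [expect_const_mul, hmon, mul_zero]
  refine le_trans ?_ ((MvPolynomial.le_totalDegree hd).trans hf)
  rw [Finsupp.sum, Finset.card_eq_sum_ones]
  exact Finset.sum_le_sum fun e he => Nat.one_le_iff_ne_zero.2 (Finsupp.mem_support_iff.1 he)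

lemma expect_add {n : ℕ} (ρ p₀ p₁ : ℝ) (F G : (Fin n → Bool) → (Edge n → Bool) → ℝ) :
    expect n ρ p₀ p₁ (fun θ Y => F θ Y + G θ Y) =
      expect n ρ p₀ p₁ F + expect n ρ p₀ p₁ G := by
  simp only [expect, mul_add, Finset.sum_add_distrib]

lemma expect_target_sq {n : ℕ} {ρ p₀ p₁ : ℝ} (h0 : 0 < p₀) (h1 : p₀ < 1) (hn : 0 < n) :
    expect n ρ p₀ p₁ (fun θ _ => target n θ ^ 2) = ρ := by
  have h := expect_target_mul_chi (ρ := ρ) (p₁ := p₁) h0 h1 (⟨0, hn⟩ : Fin n) ∅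
  simp only [chi, Finset.prod_empty, mul_one, verts, ends, Finset.biUnion_empty, Finset.card_empty,
    pow_zero, one_mul, insert_empty_eq, Finset.card_singleton, pow_one] at h
  rw [← h]
  congr 1
  funext θ Y
  rw [target, dif_pos hn, pow_two, bit_mul_self]

/-- The low-degree correlation is controlled by the second moment of the certificate. -/
lemma corr_sq_le {n D : ℕ} {ρ p₀ p₁ : ℝ} (hn : 0 < n) (hρ0 : 0 < ρ) (hρ1 : ρ < 1) (h0 : 0 < p₀)
    (h1 : p₀ < 1) (h01 : p₀ ≤ p₁) (hp1 : p₁ ≤ 1) :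
    corr n D ρ p₀ p₁ ≤ Real.sqrt ((∑ F ∈ rootedSets (⟨0, hn⟩ : Fin n) D,
        (snr p₀ p₁ ^ 2) ^ F.card * (ρ ^ 2 / (1 - ρ)) ^ (verts ⟨0, hn⟩ F).card) / ρ) := by
  refine (isLUB_corr hρ0.le hρ1.le h0.le h01 hp1).2 ?_
  rintro x ⟨f, hf, hpos, rfl⟩
  set r : Fin n := ⟨0, hn⟩
  have ht : ∀ θ, target n θ = bit (θ r) := fun θ => dif_pos hn
  -- the certificate minus the target is orthogonal to `f`
  have hz : expect n ρ p₀ p₁ (fun θ Y =>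
      (certificate ρ p₀ p₁ r D θ Y + -1 * bit (θ r)) * evalAt f Y) = 0 := by
    refine expect_mul_evalAt_eq_zero h0 h1 (fun S hS => ?_) hf
    have : ∀ (θ : Fin n → Bool) (Y : Edge n → Bool),
        (certificate ρ p₀ p₁ r D θ Y + -1 * bit (θ r)) * chi p₀ S Y =
          certificate ρ p₀ p₁ r D θ Y * chi p₀ S Y + -1 * (bit (θ r) * chi p₀ S Y) :=
      fun _ _ => by ring
    rw [funext fun θ => funext fun Y => this θ Y, expect_add, expect_const_mul,
      expect_certificate_mul_chi hρ1 h0 h1 r hS]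
    ring
  have heq : expect n ρ p₀ p₁ (fun θ Y => evalAt f Y * target n θ) =
      expect n ρ p₀ p₁ (fun θ Y => evalAt f Y * certificate ρ p₀ p₁ r D θ Y) := by
    have : ∀ (θ : Fin n → Bool) (Y : Edge n → Bool),
        (certificate ρ p₀ p₁ r D θ Y + -1 * bit (θ r)) * evalAt f Y =
          evalAt f Y * certificate ρ p₀ p₁ r D θ Y + -1 * (evalAt f Y * target n θ) :=
      fun θ _ => by rw [ht]; ring
    rw [funext fun θ => funext fun Y => this θ Y, expect_add, expect_const_mul] at hz
    linarith
  rw [expect_target_sq h0 h1 hn, heq, ← expect_certificate_sq hρ1 h0 h1]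
  have hcs := expect_mul_sq_le hρ0.le hρ1.le h0.le h01 hp1 (fun _ Y => evalAt f Y)
    (fun θ Y => certificate ρ p₀ p₁ r D θ Y)
  refine Real.le_sqrt_of_sq_le ?_
  rw [div_pow, Real.sq_sqrt (mul_pos hpos hρ0).le]
  rw [div_le_div_iff₀ (mul_pos hpos hρ0) hρ0]
  nlinarith

/-! ### Counting connected edge sets -/

lemma exists_adj_dist_lt {V : Type*} {G : SimpleGraph V} {r v : V} (h : G.Reachable r v)
    (hv : v ≠ r) : ∃ w, G.Adj v w ∧ G.Reachable r w ∧ G.dist r w < G.dist r v := by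
  obtain ⟨p, hp⟩ := h.symm.exists_walk_length_eq_dist
  cases p with
  | nil => exact absurd rfl hv
  | cons hadj q =>
    rename_i w
    refine ⟨w, hadj, q.reverse.reachable, ?_⟩
    rw [SimpleGraph.dist_comm (u := r) (v := v), ← hp, SimpleGraph.Walk.length_cons]
    have := SimpleGraph.dist_le q.reverse
    rw [SimpleGraph.Walk.length_reverse] at this
    omega

open Classical in
/-- A parent of `v` in a breadth-first spanning tree, rooted at `r`, of the component of `r`;
the value is `r` at the vertices that have no parent. -/
def parent {n : ℕ} (r : Fin n) (F : Finset (Edge n)) (v : Fin n) : Fin n :=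
  if h : (graph F).Reachable r v ∧ v ≠ r then (exists_adj_dist_lt h.1 h.2).choose else r

lemma parent_spec {n : ℕ} {r v : Fin n} {F : Finset (Edge n)} (h : (graph F).Reachable r v)
    (hv : v ≠ r) : (graph F).Adj v (parent r F v) ∧
      (graph F).dist r (parent r F v) < (graph F).dist r v := by
  rw [parent, dif_pos ⟨h, hv⟩]
  have := (exists_adj_dist_lt h hv).choose_spec
  exact ⟨this.1, this.2.2⟩

/-- The edges that join a vertex of `V` to its image under `p`. -/
def parentEdges {n : ℕ} (V : Finset (Fin n)) (p : Fin n → Fin n) : Finset (Edge n) :=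
  Finset.univ.filter fun e =>
    (e.1.1 ∈ V ∧ p e.1.1 = e.1.2) ∨ (e.1.2 ∈ V ∧ p e.1.2 = e.1.1)

/-- The edges with both ends in `V`. -/
def edgesWithin {n : ℕ} (V : Finset (Fin n)) : Finset (Edge n) :=
  Finset.univ.filter fun e => e.1.1 ∈ V ∧ e.1.2 ∈ V

lemma card_edgesWithin_le {n : ℕ} {r : Fin n} {V : Finset (Fin n)} (hr : r ∉ V) :
    (edgesWithin (insert r V)).card ≤ V.card * (V.card + 1) := by
  have h1 : (edgesWithin (insert r V)).card ≤ (insert r V).offDiag.card := by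
    refine Finset.card_le_card_of_injOn (fun e => e.1) (fun e he => ?_)
      (Subtype.val_injective.injOn)
    have he := (Finset.mem_filter.1 (Finset.mem_coe.1 he)).2
    exact Finset.mem_coe.2 (Finset.mem_offDiag.2 ⟨he.1, he.2, e.2.ne⟩)
  rw [Finset.offDiag_card, Finset.card_insert_of_notMem hr] at h1
  refine h1.trans (le_of_eq ?_)
  rw [Nat.sub_eq_iff_eq_add (Nat.le_mul_self _)]
  ring

lemma reachable_of_mem_verts {n : ℕ} {r : Fin n} {F : Finset (Edge n)} (hF : component r F = F)
    {v : Fin n} (hv : v ∈ verts r F) : (graph F).Reachable r v := by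
  rw [← hF] at hv; exact reachable_of_mem_verts_component hv

lemma parentEdges_subset {n : ℕ} {r : Fin n} {F : Finset (Edge n)} (hF : component r F = F) :
    parentEdges ((verts r F).erase r) (parent r F) ⊆ F := by
  intro e he
  have key : ∀ {u v : Fin n}, u ∈ (verts r F).erase r → parent r F u = v →
      (graph F).Adj u v := by
    rintro u v hu rfl
    obtain ⟨hu1, hu2⟩ := Finset.mem_erase.1 hu
    exact (parent_spec (reachable_of_mem_verts hF hu2) hu1).1
  have h2 : (graph F).Adj e.1.1 e.1.2 := by
    rcases (Finset.mem_filter.1 he).2 with h | h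
    · exact key h.1 h.2
    · exact (key h.1 h.2).symm
  obtain ⟨e', he', h⟩ := h2
  have hlt := e'.2
  have hlt2 := e.2
  rcases h with h | h
  · rwa [show e = e' from Subtype.ext h.symm]
  · rw [h] at hlt
    exact absurd hlt (not_lt.2 hlt2.le)

lemma card_parentEdges {n : ℕ} {r : Fin n} {F : Finset (Edge n)} (hF : component r F = F) :
    (parentEdges ((verts r F).erase r) (parent r F)).card = ((verts r F).erase r).card := by
  classical
  have hsp : ∀ v ∈ (verts r F).erase r, (graph F).Adj v (parent r F v) ∧
      (graph F).dist r (parent r F v) < (graph F).dist r v := fun v hv =>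
    parent_spec (reachable_of_mem_verts hF (Finset.mem_erase.1 hv).2) (Finset.mem_erase.1 hv).1
  symm
  -- two vertices cannot be parents of each other, as the distance to `r` drops
  refine Finset.card_bij (fun v hv =>
    if h : v < parent r F v then ⟨(v, parent r F v), h⟩
    else ⟨(parent r F v, v), lt_of_le_of_ne (not_lt.1 h) (hsp v hv).1.ne'⟩) ?_ ?_ ?_
  · intro v hv
    split_ifs with h
    · exact Finset.mem_filter.2 ⟨Finset.mem_univ _, Or.inl ⟨hv, rfl⟩⟩
    · exact Finset.mem_filter.2 ⟨Finset.mem_univ _, Or.inr ⟨hv, rfl⟩⟩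
  · intro v hv w hw h
    have h1 := (hsp v hv).2
    have h2 := (hsp w hw).2
    by_contra hne
    have : parent r F v = w ∧ parent r F w = v := by
      split_ifs at h <;> simp only [Subtype.mk.injEq, Prod.mk.injEq] at h
      · exact absurd h.1 hne
      · exact ⟨h.2, h.1.symm⟩
      · exact ⟨h.1, h.2.symm⟩
      · exact absurd h.2 hne
    rw [this.1] at h1
    rw [this.2] at h2
    omega
  · intro e he
    rcases (Finset.mem_filter.1 he).2 with h | h
    · refine ⟨e.1.1, h.1, ?_⟩
      have h3 : e.1.1 < parent r F e.1.1 := by rw [h.2]; exact e.2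
      rw [dif_pos h3]
      exact Subtype.ext (Prod.ext rfl h.2)
    · refine ⟨e.1.2, h.1, ?_⟩
      have h3 : ¬ e.1.2 < parent r F e.1.2 := by rw [h.2]; exact not_lt.2 e.2.le
      rw [dif_neg h3]
      exact Subtype.ext (Prod.ext h.2 rfl)

lemma parent_mem {n : ℕ} {r : Fin n} {F : Finset (Edge n)} (hF : component r F = F)
    {v : Fin n} (hv : v ∈ verts r F) : parent r F v ∈ verts r F := by
  by_cases hvr : v = r
  · rw [parent, dif_neg (by simp [hvr])]; exact Finset.mem_insert_self _ _
  obtain ⟨e, he, h⟩ := (parent_spec (reachable_of_mem_verts hF hv) hvr).1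
  refine Finset.mem_insert_of_mem (mem_ends.2 ⟨e, he, ?_⟩)
  rcases h with h | h <;> simp [h]

lemma parent_of_notMem {n : ℕ} {r : Fin n} {F : Finset (Edge n)} {v : Fin n}
    (hv : v ∉ (verts r F).erase r) : parent r F v = r := by
  rw [parent, dif_neg]
  rintro ⟨h1, h2⟩
  refine hv (Finset.mem_erase.2 ⟨h2, ?_⟩)
  obtain ⟨e, he, h⟩ := (parent_spec h1 h2).1
  refine Finset.mem_insert_of_mem (mem_ends.2 ⟨e, he, ?_⟩)
  rcases h with h | h <;> simp [h]

lemma insert_erase_verts {n : ℕ} (r : Fin n) (F : Finset (Edge n)) :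
    insert r ((verts r F).erase r) = verts r F :=
  Finset.insert_erase (Finset.mem_insert_self _ _)

lemma card_verts {n : ℕ} (r : Fin n) (F : Finset (Edge n)) :
    (verts r F).card = ((verts r F).erase r).card + 1 :=
  (Finset.card_erase_add_one (Finset.mem_insert_self _ _)).symm

/-- Connected edge sets are encoded by their vertex set, the parent function of a spanning tree
and the set of the remaining edges. -/
lemma sum_rootedSets_le_codes {n D : ℕ} (r : Fin n) {β γ : ℝ} (hβ : 0 ≤ β) (hγ : 0 ≤ γ) :
    ∑ F ∈ rootedSets r D, β ^ F.card * γ ^ (verts r F).card ≤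
      ∑ V ∈ (Finset.univ.erase r).powerset, if V.card ≤ D then
        β ^ V.card * γ ^ (V.card + 1) *
          (((V.card : ℝ) + 1) ^ V.card * (1 + β) ^ (edgesWithin (insert r V)).card) else 0 := by
  classical
  set codes : Finset (Σ _ : Finset (Fin n), (Fin n → Fin n) × Finset (Edge n)) :=
    (((Finset.univ.erase r).powerset).filter (fun V => V.card ≤ D)).sigma
      (fun V => (Fintype.piFinset fun v => if v ∈ V then insert r V else {r}) ×ˢ
        (edgesWithin (insert r V)).powerset) with hcodes
  set code : Finset (Edge n) → Σ _ : Finset (Fin n), (Fin n → Fin n) × Finset (Edge n) :=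
    fun F => ⟨(verts r F).erase r, parent r F,
      F \ parentEdges ((verts r F).erase r) (parent r F)⟩ with hcode
  have hcard : ∀ F ∈ rootedSets r D, F.card = ((verts r F).erase r).card +
      (F \ parentEdges ((verts r F).erase r) (parent r F)).card := by
    intro F hF
    have hF := (mem_rootedSets.1 hF).1
    rw [← card_parentEdges hF, add_comm,
      Finset.card_sdiff_add_card_eq_card (parentEdges_subset hF)]
  calc ∑ F ∈ rootedSets r D, β ^ F.card * γ ^ (verts r F).card
      = ∑ F ∈ rootedSets r D, (fun c : Σ _ : Finset (Fin n), (Fin n → Fin n) × Finset (Edge n) =>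
          β ^ (c.1.card + c.2.2.card) * γ ^ (c.1.card + 1)) (code F) := by
        refine Finset.sum_congr rfl fun F hF => ?_
        simp only [hcode]
        rw [hcard F hF, card_verts]
    _ = ∑ c ∈ (rootedSets r D).image code, β ^ (c.1.card + c.2.2.card) * γ ^ (c.1.card + 1) := by
        rw [Finset.sum_image]
        intro F hF G hG h
        have hF := (mem_rootedSets.1 hF).1
        have hG := (mem_rootedSets.1 hG).1
        simp only [hcode, Sigma.mk.injEq, heq_eq_eq, Prod.mk.injEq] at h
        obtain ⟨h1, h2, h3⟩ := h
        rw [← Finset.sdiff_union_of_subset (parentEdges_subset hF), h3, h1, h2,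
          Finset.sdiff_union_of_subset (parentEdges_subset hG)]
    _ ≤ ∑ c ∈ codes, β ^ (c.1.card + c.2.2.card) * γ ^ (c.1.card + 1) := by
        refine Finset.sum_le_sum_of_subset_of_nonneg ?_ fun _ _ _ => by positivity
        intro c hc
        obtain ⟨F, hF, rfl⟩ := Finset.mem_image.1 hc
        have hF1 := (mem_rootedSets.1 hF).1
        have hF2 := (mem_rootedSets.1 hF).2
        simp only [hcode, hcodes, Finset.mem_sigma, Finset.mem_filter, Finset.mem_powerset,
          Finset.mem_product, Fintype.mem_piFinset, insert_erase_verts]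
        refine ⟨⟨Finset.erase_subset_erase _ (Finset.subset_univ _), ?_⟩, fun v => ?_, ?_⟩
        · have := hcard F hF; omega
        · split_ifs with hv
          · exact parent_mem hF1 (Finset.mem_erase.1 hv).2
          · rw [parent_of_notMem hv]; exact Finset.mem_singleton_self _
        · intro e he
          have he := (Finset.mem_sdiff.1 he).1
          exact Finset.mem_filter.2 ⟨Finset.mem_univ _,
            Finset.mem_insert_of_mem (mem_ends.2 ⟨e, he, Or.inl rfl⟩),
            Finset.mem_insert_of_mem (mem_ends.2 ⟨e, he, Or.inr rfl⟩)⟩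
    _ = _ := by
        rw [hcodes, Finset.sum_sigma, Finset.sum_filter]
        refine Finset.sum_congr rfl fun V hV => ?_
        split_ifs with hD
        · have hr : r ∉ V := fun h =>
            (Finset.mem_erase.1 (Finset.mem_powerset.1 hV h)).1 rfl
          rw [Finset.sum_product]
          dsimp only
          rw [Finset.sum_const, Fintype.card_piFinset]
          have h1 : ∏ v, (if v ∈ V then insert r V else {r} : Finset (Fin n)).card =
              (V.card + 1) ^ V.card := by
            have : ∀ v, (if v ∈ V then insert r V else {r} : Finset (Fin n)).card =
                if v ∈ V then V.card + 1 else 1 := by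
              intro v
              split_ifs
              · exact Finset.card_insert_of_notMem hr
              · simp
            simp only [this]
            rw [Finset.prod_ite_mem, Finset.univ_inter, Finset.prod_const]
          have h2 : ∑ X ∈ (edgesWithin (insert r V)).powerset, β ^ X.card =
              (1 + β) ^ (edgesWithin (insert r V)).card := by
            have := Finset.sum_pow_mul_eq_add_pow β 1 (edgesWithin (insert r V))
            simp only [one_pow, mul_one] at this
            rw [this, add_comm]
          rw [h1, ← Finset.sum_mul]
          simp only [pow_add]
          rw [← Finset.mul_sum, h2, nsmul_eq_mul]
          push_cast
          ring
        · rfl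

/-- The weighted number of connected edge sets containing the vertex `r`: the weights of trees form
a geometric series, and the remaining edges cost a bounded factor per vertex. -/
lemma sum_rootedSets_le {n D : ℕ} (r : Fin n) {β γ κ x : ℝ} (hβ : 0 ≤ β) (hγ : 0 ≤ γ)
    (hD : β * D ≤ κ) (hx : n * (β * γ) * Real.exp (1 + 2 * κ) ≤ x) (hx1 : x < 1) :
    ∑ F ∈ rootedSets r D, β ^ F.card * γ ^ (verts r F).card ≤
      Real.exp 1 * γ / (1 - x) := by
  refine (sum_rootedSets_le_codes r hβ hγ).trans ?_
  have hx0 : 0 ≤ x := le_trans (by positivity) hx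
  set φ : ℕ → ℝ := fun v => if v ≤ D then
    β ^ v * γ ^ (v + 1) * (((v : ℝ) + 1) ^ v * (1 + β) ^ (v * (v + 1))) else 0 with hφ
  have h1 : ∀ V ∈ (Finset.univ.erase r).powerset, (if V.card ≤ D then
        β ^ V.card * γ ^ (V.card + 1) *
          (((V.card : ℝ) + 1) ^ V.card * (1 + β) ^ (edgesWithin (insert r V)).card) else 0) ≤
      φ V.card := by
    intro V hV
    have hr : r ∉ V := fun h => (Finset.mem_erase.1 (Finset.mem_powerset.1 hV h)).1 rfl
    simp only [hφ]
    split_ifs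
    · gcongr
      · linarith
      · exact card_edgesWithin_le hr
    · exact le_rfl
  refine (Finset.sum_le_sum h1).trans ?_
  rw [Finset.sum_powerset_apply_card φ]
  have h2 : ∀ v, ((Finset.univ.erase r).card.choose v) • φ v ≤ Real.exp 1 * γ * x ^ v := by
    intro v
    rw [nsmul_eq_mul]
    simp only [hφ]
    split_ifs with hv
    · have hc : (((Finset.univ.erase r).card.choose v : ℕ) : ℝ) ≤ (n : ℝ) ^ v / v.factorial := by
        refine (Nat.choose_le_pow_div _ _).trans ?_
        gcongr
        simp
      have hv' : (v : ℝ) ≤ D := by exact_mod_cast hv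
      -- here the bound on the degree is used
      have he : (1 + β) ^ (v * (v + 1)) ≤ Real.exp (2 * κ) ^ v := by
        calc (1 + β) ^ (v * (v + 1)) ≤ (Real.exp β) ^ (v * (v + 1)) := by
              gcongr
              linarith [Real.add_one_le_exp β]
          _ = Real.exp (β * (v * (v + 1))) := by
              rw [← Real.exp_nat_mul]; push_cast; ring_nf
          _ ≤ Real.exp (v * (2 * κ)) := by
              apply Real.exp_le_exp.2
              rcases Nat.eq_zero_or_pos v with rfl | hv1
              · simp
              · have : (1 : ℝ) ≤ v := by exact_mod_cast hv1
                have h3 : β * v ≤ κ := (mul_le_mul_of_nonneg_left hv' hβ).trans hD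
                have h4 : 0 ≤ β * v := by positivity
                nlinarith
          _ = Real.exp (2 * κ) ^ v := by rw [← Real.exp_nat_mul]
      have hf : ((v : ℝ) + 1) ^ v / v.factorial ≤ Real.exp (v + 1) :=
        Real.pow_div_factorial_le_exp _ (by positivity) v
      calc _ ≤ (n : ℝ) ^ v / v.factorial * (β ^ v * γ ^ (v + 1) *
            (((v : ℝ) + 1) ^ v * Real.exp (2 * κ) ^ v)) := by gcongr
        _ = (((v : ℝ) + 1) ^ v / v.factorial) *
            ((n : ℝ) ^ v * β ^ v * γ ^ (v + 1) * Real.exp (2 * κ) ^ v) := by ring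
        _ ≤ Real.exp (v + 1) *
            ((n : ℝ) ^ v * β ^ v * γ ^ (v + 1) * Real.exp (2 * κ) ^ v) := by gcongr
        _ = Real.exp 1 * γ * (n * (β * γ) * Real.exp (1 + 2 * κ)) ^ v := by
            rw [Real.exp_add, Real.exp_add 1, mul_pow, mul_pow, mul_pow, mul_pow,
              ← Real.exp_nat_mul 1]
            ring_nf
        _ ≤ Real.exp 1 * γ * x ^ v := by gcongr
    · rw [mul_zero]; positivity
  refine (Finset.sum_le_sum fun v _ => h2 v).trans ?_
  rw [← Finset.mul_sum, div_eq_mul_inv, ← tsum_geometric_of_lt_one hx0 hx1]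
  gcongr
  exact (summable_geometric_of_lt_one hx0 hx1).sum_le_tsum _ fun _ _ => by positivity

/-- Below the threshold, polynomials of degree at most a constant times `λ⁻²` are uncorrelated with
the target, up to the correlation of order `√ρ` that constants achieve. -/
theorem corr_le_of_snr_le {ε : ℝ} (hε : 0 < ε) :
    ∃ C : ℝ, 0 < C ∧ ∀ (n D : ℕ) (ρ p₀ p₁ : ℝ), 1 ≤ n → 0 < ρ → ρ < 1 → 0 < p₀ → p₀ < 1 →
      p₀ ≤ p₁ → p₁ ≤ 1 →
      snr p₀ p₁ ≤ (1 - ε) * (ρ * Real.sqrt (Real.exp 1 * n))⁻¹ * Real.sqrt (1 - ρ) →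
      (snr p₀ p₁ = 0 ∨ (D : ℝ) ≤ (snr p₀ p₁ ^ 2)⁻¹ / C) →
      corr n D ρ p₀ p₁ ≤ C * Real.sqrt (ρ / (1 - ρ)) := by
  -- `x` bounds the ratio of the geometric series of tree weights
  set x : ℝ := max (1 - ε) 0 with hx
  have hx0 : 0 ≤ x := le_max_right _ _
  have hx1 : x < 1 := max_lt (by linarith) one_pos
  -- `2 / ε ≤ C` makes `exp (2 / C) ≤ (1 - ε)⁻¹`, which costs one of the two factors `1 - ε` in `λ²`
  set C : ℝ := max (2 / ε) (Real.exp 1 / (1 - x)) with hC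
  have hC1 : Real.exp 1 / (1 - x) ≤ C := le_max_right _ _
  have hC2 : 2 / ε ≤ C := le_max_left _ _
  have hC0 : 0 < C := lt_of_lt_of_le (by positivity) hC2
  have hCone : 1 ≤ C := by
    refine le_trans ?_ hC1
    rw [le_div_iff₀ (by linarith)]
    have := Real.add_one_le_exp (1 : ℝ)
    linarith
  refine ⟨C, hC0, fun n D ρ p₀ p₁ hn hρ0 hρ1 h0 h1 h01 hp1 hsnr hD => ?_⟩
  have hn' : (0 : ℝ) < n := by exact_mod_cast hn
  have hq : 0 < 1 - ρ := by linarith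
  have hs0 : 0 ≤ snr p₀ p₁ := div_nonneg (by linarith) (Real.sqrt_nonneg _)
  refine (corr_sq_le hn hρ0 hρ1 h0 h1 h01 hp1).trans ?_
  have hγ : 0 ≤ ρ ^ 2 / (1 - ρ) := by positivity
  have hsum : ∑ F ∈ rootedSets (⟨0, hn⟩ : Fin n) D, (snr p₀ p₁ ^ 2) ^ F.card *
      (ρ ^ 2 / (1 - ρ)) ^ (verts ⟨0, hn⟩ F).card ≤
        Real.exp 1 * (ρ ^ 2 / (1 - ρ)) / (1 - x) := by
    rcases eq_or_lt_of_le hs0 with hz | hpos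
    · rw [← hz]
      refine sum_rootedSets_le (κ := 0) _ (by norm_num) hγ (by norm_num) (by simpa using hx0) hx1
    · -- if `ε ≥ 1`, then the hypothesis forces `λ = 0`
      have hε1 : 0 < 1 - ε := by
        by_contra h
        have : (1 - ε) * (ρ * Real.sqrt (Real.exp 1 * n))⁻¹ * Real.sqrt (1 - ρ) ≤ 0 := by
          rw [mul_assoc]
          exact mul_nonpos_of_nonpos_of_nonneg (not_lt.1 h) (by positivity)
        linarith
      have hxe : x = 1 - ε := max_eq_left hε1.le
      have hD' : snr p₀ p₁ ^ 2 * D ≤ 1 / C := by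
        rcases hD with h | h
        · exact absurd h hpos.ne'
        · calc snr p₀ p₁ ^ 2 * D ≤ snr p₀ p₁ ^ 2 * ((snr p₀ p₁ ^ 2)⁻¹ / C) := by gcongr
            _ = 1 / C := by field_simp
      have hκ : 2 * (1 / C) ≤ ε := by
        rw [mul_one_div, div_le_iff₀ hC0]
        rw [div_le_iff₀ hε] at hC2
        linarith
      refine sum_rootedSets_le (κ := 1 / C) _ (sq_nonneg _) hγ hD' ?_ hx1
      have hsq : snr p₀ p₁ ^ 2 ≤ (1 - ε) ^ 2 * (ρ ^ 2 * (Real.exp 1 * n))⁻¹ * (1 - ρ) := by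
        have := pow_le_pow_left₀ hs0 hsnr 2
        rwa [mul_pow, mul_pow, inv_pow, mul_pow, Real.sq_sqrt (by positivity),
          Real.sq_sqrt hq.le] at this
      have hexp : Real.exp (2 * (1 / C)) ≤ (1 - ε)⁻¹ := by
        rw [← Real.exp_log (inv_pos.2 hε1), Real.exp_le_exp, Real.log_inv]
        have := Real.log_le_sub_one_of_pos hε1
        linarith
      calc (n : ℝ) * (snr p₀ p₁ ^ 2 * (ρ ^ 2 / (1 - ρ))) * Real.exp (1 + 2 * (1 / C))
          ≤ n * (((1 - ε) ^ 2 * (ρ ^ 2 * (Real.exp 1 * n))⁻¹ * (1 - ρ)) * (ρ ^ 2 / (1 - ρ))) *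
              (Real.exp 1 * (1 - ε)⁻¹) := by
            rw [Real.exp_add]
            gcongr
        _ = x := by
            have := Real.exp_pos 1
            rw [hxe]
            field_simp
  have hfin : (∑ F ∈ rootedSets (⟨0, hn⟩ : Fin n) D, (snr p₀ p₁ ^ 2) ^ F.card *
      (ρ ^ 2 / (1 - ρ)) ^ (verts ⟨0, hn⟩ F).card) / ρ ≤ C ^ 2 * (ρ / (1 - ρ)) := by
    rw [div_le_iff₀ hρ0]
    refine hsum.trans ?_
    calc Real.exp 1 * (ρ ^ 2 / (1 - ρ)) / (1 - x)
        = Real.exp 1 / (1 - x) * (ρ ^ 2 / (1 - ρ)) := by ring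
      _ ≤ C ^ 2 * (ρ ^ 2 / (1 - ρ)) := by
          gcongr
          nlinarith
      _ = C ^ 2 * (ρ / (1 - ρ)) * ρ := by ring
  refine (Real.sqrt_le_sqrt hfin).trans (le_of_eq ?_)
  rw [Real.sqrt_mul (by positivity), Real.sqrt_sq hC0.le]

/-! ### Trees along a double chain of blocks -/

/-- The positions of a tree other than its root. The root carries two branches, each of them a chain
of `m` blocks. A block consists of a spine vertex (`none`) and of `h` levels of `s` vertices. -/
abbrev Pos (m h s : ℕ) : Type := Bool × Fin m × Option (Fin h × Fin s)

/-- The shape of a tree: in each block, every vertex of a level is given a parent in the level below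
it. The values at the lowest level play no role, as the vertices there hang from the spine. -/
abbrev Shape (m h s : ℕ) : Type := Bool → Fin m → Fin h → Fin s → Fin s

/-- The parent of a position, where `none` is the root of the tree. -/
def par {m h s : ℕ} (H : Shape m h s) : Pos m h s → Option (Pos m h s)
  | (b, k, none) => if k.1 = 0 then none else some (b, ⟨k.1 - 1, by omega⟩, none)
  | (b, k, some (j, a)) =>
    if j.1 = 0 then some (b, k, none) else some (b, k, some (⟨j.1 - 1, by omega⟩, H b k j a))

/-- A height function that increases from parents to children. It shows that the edges of a tree
are distinct. -/
def height {m h s : ℕ} : Option (Pos m h s) → ℕ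
  | none => 0
  | some (_, k, none) => k.1 * (h + 1) + 1
  | some (_, k, some (j, _)) => k.1 * (h + 1) + j.1 + 2

lemma height_par_lt {m h s : ℕ} (H : Shape m h s) (i : Pos m h s) :
    height (par H i) < height (some i) := by
  obtain ⟨b, k, _ | ⟨j, a⟩⟩ := i
  · simp only [par]
    split_ifs with hk
    · simp [height]
    · simp only [height]
      obtain ⟨k', hk'⟩ := Nat.exists_eq_succ_of_ne_zero hk
      rw [hk', Nat.succ_sub_one, Nat.succ_mul]
      omega
  · simp only [par]
    split_ifs with hj
    · simp only [height]; omega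
    · simp only [height]; omega

lemma par_ne {m h s : ℕ} (H : Shape m h s) (i : Pos m h s) : par H i ≠ some i := fun h => by
  have := height_par_lt H i
  rw [h] at this
  exact lt_irrefl _ this

/-- The extension of a placement of the positions by the vertex `r` at the root. -/
def place {n : ℕ} {P : Type*} (r : Fin n) (τ : P → Fin n) : Option P → Fin n
  | none => r
  | some i => τ i

/-- The edge with ends `u` and `v`. -/
def mkEdge {n : ℕ} (u v : Fin n) (h : u ≠ v) : Edge n :=
  if huv : u < v then ⟨(u, v), huv⟩ else ⟨(v, u), lt_of_le_of_ne (not_lt.1 huv) h.symm⟩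

lemma mkEdge_val {n : ℕ} {u v : Fin n} (h : u ≠ v) :
    (mkEdge u v h).1 = (u, v) ∨ (mkEdge u v h).1 = (v, u) := by
  unfold mkEdge; split_ifs <;> simp

lemma eq_mkEdge {n : ℕ} {u v : Fin n} (h : u ≠ v) {e : Edge n}
    (he : e.1 = (u, v) ∨ e.1 = (v, u)) : e = mkEdge u v h := by
  have h2 := e.2
  unfold mkEdge
  rcases he with he | he
  · rw [he] at h2
    rw [dif_pos h2]; exact Subtype.ext he
  · rw [he] at h2
    rw [dif_neg (not_lt.2 (le_of_lt h2))]; exact Subtype.ext he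

lemma mkEdge_mem_iff {n : ℕ} {u v : Fin n} (h : u ≠ v) {S : Finset (Edge n)} :
    mkEdge u v h ∈ S ↔ (graph S).Adj u v := by
  constructor
  · intro he; exact ⟨_, he, mkEdge_val h⟩
  · rintro ⟨e, he, h2⟩; rwa [← eq_mkEdge h h2]

lemma both_mkEdge {n : ℕ} (θ : Fin n → Bool) {u v : Fin n} (h : u ≠ v) :
    both θ (mkEdge u v h) = bit (θ v) * bit (θ u) := by
  rcases mkEdge_val h with h2 | h2 <;> simp [both, h2, mul_comm]

section

variable {n m h s : ℕ}

/-- The edge from a position to its parent. -/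
def treeEdge {r : Fin n} {τ : Pos m h s → Fin n} (hτ : Function.Injective (place r τ))
    (H : Shape m h s) (i : Pos m h s) : Edge n :=
  mkEdge (place r τ (some i)) (place r τ (par H i)) fun h => par_ne H i (hτ h).symm

lemma treeEdge_injective {r : Fin n} {τ : Pos m h s → Fin n}
    (hτ : Function.Injective (place r τ)) (H : Shape m h s) :
    Function.Injective (treeEdge hτ H) := by
  intro i i' hi
  have h1 := mkEdge_val (u := place r τ (some i)) (v := place r τ (par H i))
    fun h => par_ne H i (hτ h).symm
  have h2 := mkEdge_val (u := place r τ (some i')) (v := place r τ (par H i'))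
    fun h => par_ne H i' (hτ h).symm
  have h3 := height_par_lt H i
  have h4 := height_par_lt H i'
  change (treeEdge hτ H i).1 = _ ∨ (treeEdge hτ H i).1 = _ at h1
  change (treeEdge hτ H i').1 = _ ∨ (treeEdge hτ H i').1 = _ at h2
  rw [hi] at h1
  by_contra hne
  have : some i = par H i' ∧ par H i = some i' := by
    rcases h1 with h1 | h1 <;> rcases h2 with h2 | h2 <;> rw [h1, Prod.mk.injEq] at h2
    · exact absurd (Option.some.inj (hτ h2.1)) hne
    · exact ⟨hτ h2.1, hτ h2.2⟩
    · exact ⟨hτ h2.2, hτ h2.1⟩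
    · exact absurd (Option.some.inj (hτ h2.2)) hne
  rw [this.2] at h3
  rw [← this.1] at h4
  omega

/-- The edge set of the tree of shape `H` placed at `τ`. -/
def treeEdges {r : Fin n} {τ : Pos m h s → Fin n} (hτ : Function.Injective (place r τ))
    (H : Shape m h s) : Finset (Edge n) :=
  Finset.univ.map ⟨treeEdge hτ H, treeEdge_injective hτ H⟩

variable {r : Fin n} {τ : Pos m h s → Fin n} (hτ : Function.Injective (place r τ))
  (H : Shape m h s)

lemma card_treeEdges : (treeEdges hτ H).card = Fintype.card (Pos m h s) := by
  simp [treeEdges]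

lemma prod_treeEdges (g : Edge n → ℝ) :
    ∏ e ∈ treeEdges hτ H, g e = ∏ i, g (treeEdge hτ H i) := by
  simp [treeEdges]

lemma treeEdge_mem (i : Pos m h s) : treeEdge hτ H i ∈ treeEdges hτ H := by
  simp [treeEdges]

lemma adj_treeEdges {u v : Fin n} : (graph (treeEdges hτ H)).Adj u v ↔
    ∃ i, (u = τ i ∧ v = place r τ (par H i)) ∨ (u = place r τ (par H i) ∧ v = τ i) := by
  constructor
  · rintro ⟨e, he, h2⟩
    obtain ⟨i, -, rfl⟩ := Finset.mem_map.1 he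
    refine ⟨i, ?_⟩
    have h1 := mkEdge_val (u := place r τ (some i)) (v := place r τ (par H i))
      fun h => par_ne H i (hτ h).symm
    change (treeEdge hτ H i).1 = _ ∨ (treeEdge hτ H i).1 = _ at h1
    change (treeEdge hτ H i).1 = _ ∨ (treeEdge hτ H i).1 = _ at h2
    rcases h1 with h1 | h1 <;> rcases h2 with h2 | h2 <;> rw [h1, Prod.mk.injEq] at h2
    · exact Or.inl ⟨h2.1.symm, h2.2.symm⟩
    · exact Or.inr ⟨h2.2.symm, h2.1.symm⟩
    · exact Or.inr ⟨h2.1.symm, h2.2.symm⟩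
    · exact Or.inl ⟨h2.2.symm, h2.1.symm⟩
  · rintro ⟨i, ⟨rfl, rfl⟩ | ⟨rfl, rfl⟩⟩
    · exact ⟨_, treeEdge_mem hτ H i, mkEdge_val _⟩
    · exact ⟨_, treeEdge_mem hτ H i, (mkEdge_val _).symm⟩

/-- The neighbours of a vertex of the tree are its parent and its children. -/
lemma adj_treeEdges_place {o : Option (Pos m h s)} {v : Fin n} :
    (graph (treeEdges hτ H)).Adj (place r τ o) v ↔
      (∃ i, o = some i ∧ v = place r τ (par H i)) ∨ ∃ i, par H i = o ∧ v = τ i := by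
  rw [adj_treeEdges]
  constructor
  · rintro ⟨i, ⟨h1, h2⟩ | ⟨h1, h2⟩⟩
    · exact Or.inl ⟨i, hτ (h1 : place r τ o = place r τ (some i)), h2⟩
    · exact Or.inr ⟨i, (hτ h1).symm, h2⟩
  · rintro (⟨i, rfl, h2⟩ | ⟨i, rfl, h2⟩)
    · exact ⟨i, Or.inl ⟨rfl, h2⟩⟩
    · exact ⟨i, Or.inr ⟨rfl, h2⟩⟩

lemma verts_treeEdges : verts r (treeEdges hτ H) = Finset.univ.image (place r τ) := by
  ext v
  rw [verts, Finset.mem_insert, mem_ends, Finset.mem_image]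
  constructor
  · rintro (rfl | ⟨e, he, h2⟩)
    · exact ⟨none, Finset.mem_univ _, rfl⟩
    · obtain ⟨i, h3⟩ := (adj_treeEdges hτ H).1 (graph_adj_of_mem he)
      rcases h3 with h3 | h3 <;> rcases h2 with h2 | h2
      · exact ⟨some i, Finset.mem_univ _, by rw [h2, h3.1]; rfl⟩
      · exact ⟨par H i, Finset.mem_univ _, by rw [h2, h3.2]⟩
      · exact ⟨par H i, Finset.mem_univ _, by rw [h2, h3.1]⟩
      · exact ⟨some i, Finset.mem_univ _, by rw [h2, h3.2]; rfl⟩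
  · rintro ⟨_ | i, -, rfl⟩
    · exact Or.inl rfl
    · refine Or.inr ⟨_, treeEdge_mem hτ H i, ?_⟩
      rcases mkEdge_val (u := place r τ (some i)) (v := place r τ (par H i))
        (fun h => par_ne H i (hτ h).symm) with h2 | h2
      · left; change _ = (mkEdge _ _ _).1.1; rw [h2]
      · right; change _ = (mkEdge _ _ _).1.2; rw [h2]

lemma card_verts_treeEdges :
    (verts r (treeEdges hτ H)).card = Fintype.card (Pos m h s) + 1 := by
  rw [verts_treeEdges, Finset.card_image_of_injective _ hτ, Finset.card_univ, Fintype.card_option]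

/-- The possible children of a position: at most `s + 1` of them for each position but the root,
which has two. -/
lemma card_children_le (hs : 0 < s) (o : Option (Pos m h s)) :
    (Finset.univ.filter fun i => par H i = o).card + (if o = none then 0 else 1) ≤ s + 2 := by
  rcases o with _ | ⟨b, k, _ | ⟨j, a⟩⟩
  · rw [if_pos rfl, add_zero]
    have : (Finset.univ.filter fun i => par H i = none).card ≤
        (Finset.univ : Finset Bool).card := by
      refine Finset.card_le_card_of_injOn (fun i => i.1)
        (fun _ _ => Finset.mem_coe.2 (Finset.mem_univ _)) ?_
      have key : ∀ i : Pos m h s, par H i = none → i.2.1.1 = 0 ∧ i.2.2 = none := by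
        rintro ⟨b, k, _ | ⟨j, a⟩⟩ hi
        · simp only [par] at hi; split_ifs at hi with h0; exact ⟨h0, rfl⟩
        · simp only [par] at hi; split_ifs at hi
      intro i hi i' hi' hb
      have h1 := key i (Finset.mem_filter.1 hi).2
      have h2 := key i' (Finset.mem_filter.1 hi').2
      exact Prod.ext hb (Prod.ext (Fin.ext (h1.1.trans h2.1.symm)) (h1.2.trans h2.2.symm))
    simp at this; omega
  · rw [if_neg (by simp)]
    have : (Finset.univ.filter fun i => par H i = some (b, k, none)).card ≤
        (Finset.univ : Finset (Option (Fin s))).card := by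
      refine Finset.card_le_card_of_injOn (fun i => i.2.2.map Prod.snd)
        (fun _ _ => Finset.mem_coe.2 (Finset.mem_univ _)) ?_
      have key : ∀ i : Pos m h s, par H i = some (b, k, none) → i.1 = b ∧
          ((i.2.2 = none ∧ i.2.1.1 = k.1 + 1) ∨
            (∃ j a, i.2.2 = some (j, a) ∧ j.1 = 0 ∧ i.2.1 = k)) := by
        rintro ⟨b', k', _ | ⟨j, a⟩⟩ hi
        · simp only [par] at hi
          split_ifs at hi with h0
          simp only [Option.some.injEq, Prod.mk.injEq, and_true] at hi
          refine ⟨hi.1, Or.inl ⟨rfl, ?_⟩⟩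
          have := congrArg Fin.val hi.2
          simp only at this
          change k'.1 = _
          omega
        · simp only [par] at hi
          split_ifs at hi with h0
          · simp only [Option.some.injEq, Prod.mk.injEq, and_true] at hi
            exact ⟨hi.1, Or.inr ⟨j, a, rfl, h0, hi.2⟩⟩
          · simp at hi
      intro i hi i' hi' hb
      obtain ⟨h1, h2⟩ := key i (Finset.mem_filter.1 hi).2
      obtain ⟨h3, h4⟩ := key i' (Finset.mem_filter.1 hi').2
      refine Prod.ext (h1.trans h3.symm) ?_
      rcases h2 with h2 | ⟨j, a, h2, h5, h6⟩ <;> rcases h4 with h4 | ⟨j', a', h4, h7, h8⟩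
      · exact Prod.ext (Fin.ext (h2.2.trans h4.2.symm)) (h2.1.trans h4.1.symm)
      · simp [h2.1, h4] at hb
      · simp [h2, h4.1] at hb
      · simp only [h2, h4, Option.map_some, Option.some.injEq] at hb
        refine Prod.ext (h6.trans h8.symm) (h2.trans ?_)
        rw [h4, show j = j' from Fin.ext (h5.trans h7.symm), hb]
    simp at this; omega
  · rw [if_neg (by simp)]
    have : (Finset.univ.filter fun i => par H i = some (b, k, some (j, a))).card ≤
        (Finset.univ : Finset (Fin s)).card := by
      refine Finset.card_le_card_of_injOn (fun i => (i.2.2.map Prod.snd).getD ⟨0, hs⟩)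
        (fun _ _ => Finset.mem_coe.2 (Finset.mem_univ _)) ?_
      have key : ∀ i : Pos m h s, par H i = some (b, k, some (j, a)) → i.1 = b ∧ i.2.1 = k ∧
          ∃ j' a', i.2.2 = some (j', a') ∧ j'.1 = j.1 + 1 := by
        rintro ⟨b', k', _ | ⟨j', a'⟩⟩ hi
        · simp only [par] at hi
          split_ifs at hi with h0
          simp at hi
        · simp only [par] at hi
          split_ifs at hi with h0
          · simp at hi
          · simp only [Option.some.injEq, Prod.mk.injEq] at hi
            refine ⟨hi.1, hi.2.1, j', a', rfl, ?_⟩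
            have := congrArg Fin.val hi.2.2.1
            simp only at this
            omega
      intro i hi i' hi' hb
      obtain ⟨h1, h2, j1, a1, h3, h4⟩ := key i (Finset.mem_filter.1 hi).2
      obtain ⟨h1', h2', j1', a1', h3', h4'⟩ := key i' (Finset.mem_filter.1 hi').2
      refine Prod.ext (h1.trans h1'.symm) (Prod.ext (h2.trans h2'.symm) (h3.trans ?_))
      simp only [h3, h3', Option.map_some, Option.getD_some] at hb
      rw [h3', hb, show j1 = j1' from Fin.ext (h4.trans h4'.symm)]
    simp at this; omega

open Classical in
/-- Every vertex has at most `s + 1` children and one parent. -/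
lemma degree_treeEdges_le (hs : 0 < s) (v : Fin n) :
    (Finset.univ.filter fun w => (graph (treeEdges hτ H)).Adj v w).card ≤ s + 2 := by
  by_cases hv : ∃ o, place r τ o = v
  · obtain ⟨o, rfl⟩ := hv
    refine le_trans ?_ (card_children_le H hs o)
    have h1 : (Finset.univ.filter fun w => (graph (treeEdges hτ H)).Adj (place r τ o) w) ⊆
        ((Finset.univ.filter fun i => par H i = o).image τ) ∪
          (match o with
            | none => ∅
            | some i => {place r τ (par H i)}) := by
      intro w hw
      rcases (adj_treeEdges_place hτ H).1 (Finset.mem_filter.1 hw).2 with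
        ⟨i, rfl, h2⟩ | ⟨i, h2, rfl⟩
      · exact Finset.mem_union_right _ (Finset.mem_singleton.2 h2)
      · exact Finset.mem_union_left _ (Finset.mem_image_of_mem _
          (Finset.mem_filter.2 ⟨Finset.mem_univ _, h2⟩))
    refine (Finset.card_le_card h1).trans ((Finset.card_union_le _ _).trans ?_)
    refine add_le_add Finset.card_image_le ?_
    rcases o with _ | i <;> simp
  · refine le_trans (le_of_eq ?_) (Nat.zero_le _)
    rw [Finset.card_eq_zero, Finset.filter_eq_empty_iff]
    intro w _ hw
    obtain ⟨i, h2 | h2⟩ := (adj_treeEdges hτ H).1 hw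
    · exact hv ⟨some i, h2.1.symm⟩
    · exact hv ⟨par H i, h2.1.symm⟩

end

/-! ### Joint moments of two trees -/

lemma one_add_excess_mul_both_nonneg {n : ℕ} {p₀ p₁ : ℝ} (h0 : 0 < p₀) (h1 : p₀ < 1)
    (hp : 0 ≤ p₁) (hp1 : p₁ ≤ 1) (θ : Fin n → Bool) (e : Edge n) :
    0 ≤ 1 + excess p₀ p₁ * both θ e := by
  have hb : both θ e = 0 ∨ both θ e = 1 := by
    unfold both bit; split_ifs <;> simp
  rcases hb with hb | hb <;> rw [hb]
  · simp
  · rw [← stdBit_sq h0 h1]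
    refine Finset.sum_nonneg fun b _ => mul_nonneg (bern_nonneg ?_ ?_ b) (mul_self_nonneg _) <;>
      linarith

/-- The probability that the labels at the distinct places `f` are `x` and that all of `A`, disjoint
from these places, lies in the community. -/
lemma labelExpect_pattern {n : ℕ} {ι : Type*} [Fintype ι] [DecidableEq ι] (ρ : ℝ) {f : ι → Fin n}
    (hf : Function.Injective f) {A : Finset (Fin n)} (hA : ∀ i, f i ∉ A) (x : ι → Bool) :
    labelExpect n ρ (fun θ => (if θ ∘ f = x then 1 else 0) * ∏ v ∈ A, bit (θ v)) =
      (∏ i, bern ρ (x i)) * ρ ^ A.card := by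
  have h1 : ∀ θ : Fin n → Bool, (if θ ∘ f = x then 1 else 0) * ∏ v ∈ A, bit (θ v) =
      ∏ v, (fun v b => (∏ i ∈ Finset.univ.filter (fun i => f i = v),
        if b = x i then (1 : ℝ) else 0) * if v ∈ A then bit b else 1) v (θ v) := by
    intro θ
    rw [Finset.prod_mul_distrib, Finset.prod_ite_mem, Finset.univ_inter]
    congr 1
    have h2 : ∏ v, ∏ i ∈ Finset.univ.filter (fun i => f i = v),
        (if θ v = x i then (1 : ℝ) else 0) = ∏ i, if θ (f i) = x i then (1 : ℝ) else 0 := by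
      rw [← Finset.prod_fiberwise (g := f)]
      refine Finset.prod_congr rfl fun v _ => Finset.prod_congr rfl fun i hi => ?_
      rw [(Finset.mem_filter.1 hi).2]
    rw [h2, Finset.prod_ite_zero]
    simp [funext_iff]
  refine (congrArg (labelExpect n ρ) (funext h1)).trans ((labelExpect_prod ρ
    (fun v b => (∏ i ∈ Finset.univ.filter (fun i => f i = v),
        if b = x i then (1 : ℝ) else 0) * if v ∈ A then bit b else 1)).trans ?_)
  have h3 : (∏ i, bern ρ (x i)) * ρ ^ A.card =
      ∏ v, (∏ i ∈ Finset.univ.filter (fun i => f i = v), bern ρ (x i)) *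
        if v ∈ A then ρ else 1 := by
    rw [Finset.prod_mul_distrib, Finset.prod_ite_mem, Finset.univ_inter, Finset.prod_const,
      Finset.prod_fiberwise]
  rw [h3]
  refine Finset.prod_congr rfl fun v _ => ?_
  by_cases hv : ∃ i, f i = v
  · obtain ⟨i, rfl⟩ := hv
    have : Finset.univ.filter (fun j => f j = f i) = {i} := by
      ext j; simp [hf.eq_iff]
    rw [this]
    simp only [Finset.prod_singleton, if_neg (hA i), mul_one]
    cases x i <;> simp [bern]
  · have : Finset.univ.filter (fun j => f j = v) = ∅ := by
      rw [Finset.filter_eq_empty_iff]; exact fun i _ h => hv ⟨i, h⟩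
    rw [this]
    by_cases h : v ∈ A <;> simp [h, bern]

open Classical in
/-- The weight of a vertex of a tree given its parent, relative to that of a vertex that is not
shared with the edge set `S`. A state `(v, x)` of a vertex consists of its place `v` and of its
label `x`. -/
def weight {n : ℕ} (ρ l μ : ℝ) (r : Fin n) (S : Finset (Edge n)) (y' y : Fin n × Bool) : ℝ :=
  (n * ρ * l)⁻¹ * ((if y.1 ∈ verts r S then ρ⁻¹ else 1) * bern ρ y.2 *
    if (graph S).Adj y.1 y'.1 then l⁻¹ * (1 + μ * (bit y'.2 * bit y.2))
    else l * (bit y'.2 * bit y.2))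

lemma weight_nonneg {n : ℕ} {ρ l μ : ℝ} (hρ0 : 0 ≤ ρ) (hρ1 : ρ ≤ 1) (hl : 0 ≤ l) (hμ : 0 ≤ μ)
    (r : Fin n) (S : Finset (Edge n)) (y' y : Fin n × Bool) : 0 ≤ weight ρ l μ r S y' y := by
  unfold weight
  have h1 := bern_nonneg hρ0 hρ1 y.2
  have h2 := bit_nonneg y.2
  have h3 := bit_nonneg y'.2
  split_ifs <;> positivity

section

variable {n m h s : ℕ} {r : Fin n} {τ : Pos m h s → Fin n}

open Classical in
/-- At a vertex outside the community all edges of `S` must be edges of the tree: such an edge,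
if it is not in the tree, has conditional mean zero. -/
def covered (hτ : Function.Injective (place r τ)) (H : Shape m h s) (S : Finset (Edge n))
    (x : Option (Pos m h s) → Bool) : Prop :=
  ∀ o, x o = false → ∀ u, (graph S).Adj (place r τ o) u →
    (graph (treeEdges hτ H)).Adj (place r τ o) u

lemma prod_sdiff_both_le (hτ : Function.Injective (place r τ)) (H : Shape m h s)
    (S : Finset (Edge n)) (θ : Fin n → Bool) [Decidable (covered hτ H S (θ ∘ place r τ))] :
    ∏ e ∈ S \ treeEdges hτ H, both θ e ≤
      (if covered hτ H S (θ ∘ place r τ) then 1 else 0) *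
        ∏ v ∈ verts r S \ Finset.univ.image (place r τ), bit (θ v) := by
  rw [prod_both_eq, prod_bit_eq, prod_bit_eq]
  by_cases hall : ∀ v ∈ ends (S \ treeEdges hτ H), θ v = true
  · rw [if_pos hall, if_pos, if_pos]
    · norm_num
    · intro v hv
      obtain ⟨hv1, hv2⟩ := Finset.mem_sdiff.1 hv
      rw [← verts_treeEdges hτ H] at hv2
      refine hall v ?_
      rcases Finset.mem_insert.1 hv1 with rfl | hv1
      · exact absurd (Finset.mem_insert_self _ _) hv2
      obtain ⟨e, he, h2⟩ := mem_ends.1 hv1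
      refine mem_ends.2 ⟨e, Finset.mem_sdiff.2 ⟨he, fun h3 => hv2 ?_⟩, h2⟩
      exact Finset.mem_insert_of_mem (mem_ends.2 ⟨e, h3, h2⟩)
    · intro o ho u hu
      by_contra hne
      obtain ⟨e, he, h2⟩ := hu
      have : θ (place r τ o) = true := by
        refine hall _ (mem_ends.2 ⟨e, Finset.mem_sdiff.2 ⟨he, fun h3 => hne ⟨e, h3, h2⟩⟩, ?_⟩)
        rcases h2 with h2 | h2 <;> simp [h2]
      rw [Function.comp_apply] at ho
      rw [this] at ho
      exact absurd ho (by simp)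
  · rw [if_neg hall]
    split_ifs <;> simp

open Classical in
/-- The joint moment of `chi S`, where `S` is like a tree, and of a placed tree is at most a sum over
the labels `x` on the tree of products along its edges. The prefactor is such that, together with
the number of placements, it matches the squared first moment. -/
lemma expect_chi_mul_chi_le {ρ p₀ p₁ : ℝ} (hρ0 : 0 < ρ) (hρ1 : ρ ≤ 1) (h0 : 0 < p₀) (h1 : p₀ < 1)
    (hp : 0 ≤ p₁) (hp1 : p₁ ≤ 1) (hl : 0 < snr p₀ p₁) (hτ : Function.Injective (place r τ))
    (H : Shape m h s) {S : Finset (Edge n)} (hS : S.card = Fintype.card (Pos m h s))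
    (hSv : (verts r S).card = Fintype.card (Pos m h s) + 1) :
    expect n ρ p₀ p₁ (fun _ Y => chi p₀ S Y * chi p₀ (treeEdges hτ H) Y) ≤
      (ρ ^ (2 * Fintype.card (Pos m h s) + 1) * snr p₀ p₁ ^ (2 * Fintype.card (Pos m h s)) *
          n ^ Fintype.card (Pos m h s)) *
        ∑ x : Option (Pos m h s) → Bool, if covered hτ H S x then bern ρ (x none) / ρ *
          ∏ i, weight ρ (snr p₀ p₁) (max (excess p₀ p₁) 0) r S
            (place r τ (par H i), x (par H i)) (τ i, x (some i)) else 0 := by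
  set l := snr p₀ p₁ with hlam
  set μ := max (excess p₀ p₁) 0 with hμdef
  have hμ : 0 ≤ μ := le_max_right _ _
  set T := treeEdges hτ H with hT
  set K := Fintype.card (Pos m h s) with hK
  have hn : (0 : ℝ) < n := by exact_mod_cast r.pos
  have e1 := expect_mul_chi_mul_chi (ρ := ρ) (p₁ := p₁) h0 h1 (fun _ => 1) S T
  simp only [one_mul] at e1
  rw [e1]
  -- the factor of the tree edges, as a function of the labels on the tree
  set g : (Option (Pos m h s) → Bool) → ℝ := fun x => ∏ i,
    if (graph S).Adj (τ i) (place r τ (par H i)) then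
      1 + μ * (bit (x (par H i)) * bit (x (some i)))
    else l * (bit (x (par H i)) * bit (x (some i))) with hg
  have hg0 : ∀ x, 0 ≤ g x := fun x => Finset.prod_nonneg fun i _ => by
    have := bit_nonneg (x (par H i))
    have := bit_nonneg (x (some i))
    split_ifs <;> positivity
  set A := verts r S \ Finset.univ.image (place r τ) with hAdef
  have hA : ∀ o, place r τ o ∉ A := fun o ho =>
    (Finset.mem_sdiff.1 ho).2 (Finset.mem_image_of_mem _ (Finset.mem_univ _))
  have hpt : ∀ θ : Fin n → Bool, (∏ e ∈ S \ T, l * both θ e) *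
      (∏ e ∈ T, if e ∈ S then 1 + excess p₀ p₁ * both θ e else l * both θ e) ≤
      ∑ x : Option (Pos m h s) → Bool, (l ^ (S \ T).card * (if covered hτ H S x then g x else 0)) *
        ((if θ ∘ place r τ = x then 1 else 0) * ∏ v ∈ A, bit (θ v)) := by
    intro θ
    rw [Finset.sum_eq_single (θ ∘ place r τ) (fun x _ hx => by rw [if_neg (Ne.symm hx)]; ring)
      (fun h => absurd (Finset.mem_univ _) h), if_pos rfl, one_mul,
      Finset.prod_mul_distrib, Finset.prod_const, mul_assoc, mul_assoc]
    refine mul_le_mul_of_nonneg_left ?_ (by positivity)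
    have hnn : ∀ e : Edge n, 0 ≤ if e ∈ S then 1 + excess p₀ p₁ * both θ e else l * both θ e := by
      intro e
      have := both_nonneg θ e
      split_ifs
      · exact one_add_excess_mul_both_nonneg h0 h1 hp hp1 θ e
      · positivity
    have h2 : (∏ e ∈ T, if e ∈ S then 1 + excess p₀ p₁ * both θ e else l * both θ e) ≤
        g (θ ∘ place r τ) := by
      rw [hT, prod_treeEdges, hg]
      refine Finset.prod_le_prod (fun i _ => hnn _) (fun i _ => ?_)
      · have hmem : treeEdge hτ H i ∈ S ↔ (graph S).Adj (τ i) (place r τ (par H i)) :=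
          mkEdge_mem_iff _
        have hbe : both θ (treeEdge hτ H i) =
            bit ((θ ∘ place r τ) (par H i)) * bit ((θ ∘ place r τ) (some i)) :=
          both_mkEdge θ _
        simp only [hmem, hbe]
        split_ifs
        · gcongr
          · exact mul_nonneg (bit_nonneg _) (bit_nonneg _)
          · exact le_max_left _ _
        · exact le_rfl
    calc _ ≤ ((if covered hτ H S (θ ∘ place r τ) then 1 else 0) * ∏ v ∈ A, bit (θ v)) *
          g (θ ∘ place r τ) :=
          mul_le_mul (prod_sdiff_both_le hτ H S θ) h2 (Finset.prod_nonneg fun e _ => hnn e)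
            (mul_nonneg (by split_ifs <;> norm_num)
              (Finset.prod_nonneg fun _ _ => bit_nonneg _))
      _ = _ := by split_ifs <;> ring
  refine (labelExpect_mono hρ0.le hρ1 hpt).trans ?_
  rw [labelExpect_sum, Finset.mul_sum]
  refine Finset.sum_le_sum fun x _ => ?_
  rw [labelExpect_const_mul, labelExpect_pattern ρ hτ hA]
  split_ifs with hc
  swap
  · simp
  refine le_of_eq ?_
  -- a vertex of `S` is either shared with the tree or contributes a factor `ρ`
  have hA2 : ρ ^ A.card * (∏ i : Pos m h s, if τ i ∈ verts r S then ρ else 1) = ρ ^ K := by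
    rw [Finset.prod_ite, Finset.prod_const, Finset.prod_const_one, mul_one, ← pow_add]
    congr 1
    have h2 : (verts r S ∩ Finset.univ.image (place r τ)).card =
        (Finset.univ.filter fun i : Pos m h s => τ i ∈ verts r S).card + 1 := by
      -- the additional vertex is the common root
      have : verts r S ∩ Finset.univ.image (place r τ) =
          (Finset.univ.filter fun o => place r τ o ∈ verts r S).image (place r τ) := by
        ext v
        simp only [Finset.mem_inter, Finset.mem_image, Finset.mem_univ, true_and,
          Finset.mem_filter]
        constructor
        · rintro ⟨h3, o, rfl⟩; exact ⟨o, h3, rfl⟩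
        · rintro ⟨o, h3, rfl⟩; exact ⟨h3, o, rfl⟩
      rw [this, Finset.card_image_of_injective _ hτ]
      have : (Finset.univ.filter fun o => place r τ o ∈ verts r S) =
          insert none ((Finset.univ.filter fun i : Pos m h s => τ i ∈ verts r S).image some) := by
        ext o
        rcases o with _ | i
        · simp only [Finset.mem_filter, Finset.mem_univ, true_and, Finset.mem_insert, true_or,
            iff_true]
          exact Finset.mem_insert_self _ _
        · have : place r τ (some i) = τ i := rfl
          simp [this]
      rw [this, Finset.card_insert_of_notMem (by simp),
        Finset.card_image_of_injective _ (Option.some_injective _)]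
    have h3 := Finset.card_sdiff_add_card_inter (verts r S) (Finset.univ.image (place r τ))
    rw [h2, hSv, ← hAdef] at h3
    omega
  have hS2 : l ^ (S \ T).card * (∏ i : Pos m h s,
      if (graph S).Adj (τ i) (place r τ (par H i)) then l else 1) = l ^ K := by
    rw [Finset.prod_ite, Finset.prod_const, Finset.prod_const_one, mul_one, ← pow_add]
    congr 1
    have h3 := Finset.card_sdiff_add_card_inter S T
    rw [hS] at h3
    rw [← h3]
    congr 1
    have : S ∩ T = (Finset.univ.filter fun i : Pos m h s =>
        (graph S).Adj (τ i) (place r τ (par H i))).map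
          ⟨treeEdge hτ H, treeEdge_injective hτ H⟩ := by
      ext e
      simp only [Finset.mem_inter, Finset.mem_map, Finset.mem_filter, Finset.mem_univ, true_and,
        hT, treeEdges, Function.Embedding.coeFn_mk]
      constructor
      · rintro ⟨h4, i, rfl⟩; exact ⟨i, (mkEdge_mem_iff _).1 h4, rfl⟩
      · rintro ⟨i, h4, rfl⟩; exact ⟨(mkEdge_mem_iff _).2 h4, i, rfl⟩
    rw [this, Finset.card_map]
  have hprod : (∏ i, bern ρ (x (some i))) * g x = (n * ρ * l) ^ K *
      ((∏ i, weight ρ l μ r S (place r τ (par H i), x (par H i)) (τ i, x (some i))) *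
        (∏ i : Pos m h s, if τ i ∈ verts r S then ρ else 1) *
        ∏ i : Pos m h s, if (graph S).Adj (τ i) (place r τ (par H i)) then l else 1) := by
    have : (n * ρ * l) ^ K = ∏ _i : Pos m h s, (n * ρ * l) := by
      rw [Finset.prod_const, Finset.card_univ]
    rw [this, hg]
    simp only [← Finset.prod_mul_distrib]
    refine Finset.prod_congr rfl fun i _ => ?_
    unfold weight
    dsimp only
    split_ifs <;> field_simp
  rw [Fintype.prod_option]
  calc l ^ (S \ T).card * g x * ((bern ρ (x none) * ∏ i, bern ρ (x (some i))) * ρ ^ A.card)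
      = l ^ (S \ T).card * ρ ^ A.card * bern ρ (x none) *
          ((∏ i, bern ρ (x (some i))) * g x) := by ring
    _ = (l ^ (S \ T).card * ∏ i : Pos m h s,
            if (graph S).Adj (τ i) (place r τ (par H i)) then l else 1) *
          (ρ ^ A.card * ∏ i : Pos m h s, if τ i ∈ verts r S then ρ else 1) *
          bern ρ (x none) * (n * ρ * l) ^ K *
          ∏ i, weight ρ l μ r S (place r τ (par H i), x (par H i)) (τ i, x (some i)) := by
        rw [hprod]; ring
    _ = _ := by
        rw [hA2, hS2]
        rw [pow_succ, pow_mul, pow_mul]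
        field_simp
        ring

end

/-! ### Sums over the configurations of a block -/

/-- The entry before position `k` in the sequence `c` that is preceded by `b`. -/
def prev {β : Type*} {m : ℕ} (b : β) (c : Fin m → β) (k : Fin m) : β :=
  if k.1 = 0 then b else c ⟨k.1 - 1, by omega⟩

@[simp] lemma prev_zero {β : Type*} {m : ℕ} (b : β) (c : Fin (m + 1) → β) : prev b c 0 = b := rfl

@[simp] lemma prev_succ {β : Type*} {m : ℕ} (b : β) (c : Fin (m + 1) → β) (k : Fin m) :
    prev b c k.succ = c k.castSucc := rfl

lemma cons_castSucc {β : Type*} {m : ℕ} (d : β) (e : Fin m → β) (k : Fin m) :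
    (Fin.cons d e : Fin (m + 1) → β) k.castSucc = prev d e k := by
  unfold prev
  split_ifs with h
  · have : k.castSucc = 0 := Fin.ext h
    rw [this, Fin.cons_zero]
  · have : k.castSucc = (⟨k.1 - 1, by omega⟩ : Fin m).succ := Fin.ext (by simp; omega)
    rw [this, Fin.cons_succ]

lemma sum_fin_succ_fun {β : Type*} [Fintype β] {m : ℕ} (F : (Fin (m + 1) → β) → ℝ) :
    ∑ c, F c = ∑ d, ∑ e : Fin m → β, F (Fin.cons d e) := by
  rw [← Fintype.sum_prod_type']
  exact (Fintype.sum_equiv (Fin.consEquiv fun _ => β) _ _ fun _ => rfl).symm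

/-- Summing a kernel with row sums at most `a` over the vertices of the levels of a block. -/
lemma sum_levels_le {Y : Type*} [Fintype Y] {s : ℕ} {κ : Y → Y → ℝ} {a : ℝ}
    (hκ : ∀ y y', 0 ≤ κ y y') (ha : ∀ y, ∑ y', κ y y' ≤ a) {h : ℕ} (H : Fin h → Fin s → Fin s)
    (L : Fin s → Y) :
    ∑ y : Fin h → Fin s → Y, ∏ j, ∏ i, κ (prev L y j (H j i)) (y j i) ≤ (a ^ s) ^ h := by
  induction h generalizing L with
  | zero => simp
  | succ h ih =>
    rw [sum_fin_succ_fun, pow_succ']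
    have h1 : ∀ d : Fin s → Y, ∑ e : Fin h → Fin s → Y,
        ∏ j, ∏ i, κ (prev L (Fin.cons d e : Fin (h + 1) → Fin s → Y) j (H j i))
          ((Fin.cons d e : Fin (h + 1) → Fin s → Y) j i) ≤
        (∏ i, κ (L (H 0 i)) (d i)) * (a ^ s) ^ h := by
      intro d
      simp only [Fin.prod_univ_succ, prev_zero, prev_succ, Fin.cons_zero, Fin.cons_succ,
        cons_castSucc]
      rw [← Finset.mul_sum]
      exact mul_le_mul_of_nonneg_left (ih (fun j => H j.succ) d)
        (Finset.prod_nonneg fun _ _ => hκ _ _)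
    refine (Finset.sum_le_sum fun d _ => h1 d).trans ?_
    rw [← Finset.sum_mul, ← Fintype.prod_sum (fun i y => κ (L (H 0 i)) y)]
    have ha0 : 0 ≤ a ^ s := by
      rcases Nat.eq_zero_or_pos s with rfl | hs
      · simp
      · exact pow_nonneg ((Finset.sum_nonneg fun _ _ => hκ (L ⟨0, hs⟩) _).trans (ha _)) _
    refine mul_le_mul_of_nonneg_right ?_ (pow_nonneg ha0 h)
    calc ∏ i, ∑ y, κ (L (H 0 i)) y ≤ ∏ _i : Fin s, a :=
          Finset.prod_le_prod (fun _ _ => Finset.sum_nonneg fun _ _ => hκ _ _) fun _ _ => ha _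
      _ = a ^ s := by simp

/-- A configuration of a block: its shape and the states of its vertices. -/
abbrev Config (Y : Type*) (h s : ℕ) : Type _ :=
  (Fin h → Fin s → Fin s) × (Option (Fin h × Fin s) → Y)

/-- The state of the parent of a vertex of a block, where `y` is the state of the parent of the
spine vertex. -/
def parentState {Y : Type*} {h s : ℕ} (y : Y) (c : Config Y h s) : Option (Fin h × Fin s) → Y
  | none => y
  | some (j, a) =>
    if j.1 = 0 then c.2 none else c.2 (some (⟨j.1 - 1, by omega⟩, c.1 j a))

/-- The product of a kernel over the vertices of a block. -/
def blockProd {Y : Type*} {h s : ℕ} (κ : Y → Y → ℝ) (y : Y) (c : Config Y h s) : ℝ :=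
  ∏ o, κ (parentState y c o) (c.2 o)

lemma parentState_some {Y : Type*} {h s : ℕ} (y : Y) (c : Config Y h s) (j : Fin h) (a : Fin s) :
    parentState y c (some (j, a)) =
      prev (fun _ => c.2 none) (fun j a => c.2 (some (j, a))) j (c.1 j a) := by
  unfold prev
  simp only [parentState]
  split_ifs <;> rfl

lemma blockProd_nonneg {Y : Type*} {h s : ℕ} {κ : Y → Y → ℝ} (hκ : ∀ y y', 0 ≤ κ y y') (y : Y)
    (c : Config Y h s) : 0 ≤ blockProd κ y c :=
  Finset.prod_nonneg fun _ _ => hκ _ _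

/-- Properties of states propagate from the spine vertex to a whole block. -/
lemma block_induction {Y : Type*} {h s : ℕ} (y : Y) {c : Config Y h s} {P : Y → Prop}
    (hnone : P (c.2 none))
    (hstep : ∀ i, P (parentState y c (some i)) → P (c.2 (some i)))
    (o : Option (Fin h × Fin s)) : P (c.2 o) := by
  have key : ∀ (k : ℕ) (j : Fin h), j.1 = k → ∀ a, P (c.2 (some (j, a))) := by
    intro k
    induction k with
    | zero =>
      intro j hj a
      refine hstep _ ?_
      simp only [parentState]
      rw [if_pos hj]; exact hnone
    | succ k ih =>
      intro j hj a
      refine hstep _ ?_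
      simp only [parentState]
      rw [if_neg (by omega)]
      exact ih _ (by simp; omega) _
  rcases o with _ | ⟨j, a⟩
  · exact hnone
  · exact key _ j rfl a

/-- There are `s ^ s` choices of parents per level, and a factor `a` for every vertex. -/
lemma sum_blockProd_le {Y : Type*} [Fintype Y] {h s : ℕ} {κ : Y → Y → ℝ} {a : ℝ}
    (hκ : ∀ y y', 0 ≤ κ y y') (ha : ∀ y, ∑ y', κ y y' ≤ a) (y : Y) :
    ∑ c : Config Y h s, blockProd κ y c ≤ ((s : ℝ) ^ s) ^ h * (a * (a ^ s) ^ h) := by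
  rw [Fintype.sum_prod_type]
  have h1 : ∀ H : Fin h → Fin s → Fin s, ∑ yb : Option (Fin h × Fin s) → Y,
      blockProd κ y (H, yb) ≤ a * (a ^ s) ^ h := by
    intro H
    have e1 : ∑ yb : Option (Fin h × Fin s) → Y, blockProd κ y (H, yb) =
        ∑ y0, κ y y0 * ∑ yl : Fin h → Fin s → Y,
          ∏ j, ∏ i, κ (prev (fun _ => y0) yl j (H j i)) (yl j i) := by
      simp only [Finset.mul_sum]
      rw [← Fintype.sum_prod_type']
      refine Fintype.sum_equiv ((Equiv.piOptionEquivProd (β := fun _ => Y)).trans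
        (Equiv.prodCongr (Equiv.refl _) (Equiv.curry (Fin h) (Fin s) Y))) _ _ fun yb => ?_
      rw [blockProd, Fintype.prod_option, Fintype.prod_prod_type]
      simp only [parentState_some]
      rfl
    rw [e1]
    have ha0 : 0 ≤ a := (Finset.sum_nonneg fun _ _ => hκ y _).trans (ha y)
    calc _ ≤ ∑ y0, κ y y0 * (a ^ s) ^ h :=
          Finset.sum_le_sum fun y0 _ => mul_le_mul_of_nonneg_left
            (sum_levels_le hκ ha H _) (hκ _ _)
      _ = (∑ y0, κ y y0) * (a ^ s) ^ h := by rw [Finset.sum_mul]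
      _ ≤ a * (a ^ s) ^ h := mul_le_mul_of_nonneg_right (ha y) (by positivity)
  refine (Finset.sum_le_sum fun H _ => h1 H).trans (le_of_eq ?_)
  simp

/-- A set of size at most `s` has at most `s!` enumerations by `Fin s`. -/
lemma card_enumerations_le {V : Type*} [Fintype V] [DecidableEq V] {s : ℕ} (P : V → Prop)
    [DecidablePred fun e : Fin s → V => Function.Injective e ∧ ∀ u, (∃ a, e a = u) ↔ P u] :
    (Finset.univ.filter fun e : Fin s → V =>
      Function.Injective e ∧ ∀ u, (∃ a, e a = u) ↔ P u).card ≤ s.factorial := by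
  rcases Finset.eq_empty_or_nonempty (Finset.univ.filter fun e : Fin s → V =>
      Function.Injective e ∧ ∀ u, (∃ a, e a = u) ↔ P u) with h | ⟨e0, he0⟩
  · rw [h]; simp
  obtain ⟨h1, h2⟩ := (Finset.mem_filter.1 he0).2
  have hsub : (Finset.univ.filter fun e : Fin s → V =>
      Function.Injective e ∧ ∀ u, (∃ a, e a = u) ↔ P u) ⊆
      Finset.univ.image fun σ : Equiv.Perm (Fin s) => e0 ∘ σ := by
    intro e he
    obtain ⟨h3, h4⟩ := (Finset.mem_filter.1 he).2
    have hex : ∀ a, ∃ b, e0 b = e a := fun a => (h2 _).2 ((h4 _).1 ⟨a, rfl⟩)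
    choose σ hσ using hex
    have hinj : Function.Injective σ := fun a b hab => h3 (by rw [← hσ a, ← hσ b, hab])
    exact Finset.mem_image.2 ⟨Equiv.ofBijective σ (Finite.injective_iff_bijective.1 hinj),
      Finset.mem_univ _, funext hσ⟩
  refine (Finset.card_le_card hsub).trans (Finset.card_image_le.trans ?_)
  rw [Finset.card_univ, Fintype.card_perm, Fintype.card_fin]

/-- The levels `v` enumerate the successive spheres of `G`: each level enumerates the neighbours of
the level before it that do not belong to the level two steps back. The sequence starts after
`L₀` and `L₁`. -/
def IsSphereSeq {V : Type*} {s t : ℕ} (G : SimpleGraph V) (L₀ L₁ : Fin s → V)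
    (v : Fin t → Fin s → V) : Prop :=
  ∀ j, Function.Injective (v j) ∧
    ∀ u, (∃ a, v j a = u) ↔ (∃ b, G.Adj (prev L₁ v j b) u) ∧ ∀ b, prev L₀ (prev L₁ v) j b ≠ u

lemma isSphereSeq_cons {V : Type*} {s t : ℕ} {G : SimpleGraph V} {L₀ L₁ d : Fin s → V}
    {e : Fin t → Fin s → V} (h : IsSphereSeq G L₀ L₁ (Fin.cons d e : Fin (t + 1) → Fin s → V)) :
    (Function.Injective d ∧ ∀ u, (∃ a, d a = u) ↔ (∃ b, G.Adj (L₁ b) u) ∧ ∀ b, L₀ b ≠ u) ∧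
      IsSphereSeq G L₁ d e := by
  refine ⟨by simpa using h 0, fun j => ?_⟩
  have h1 := h j.succ
  have h2 : prev L₀ (prev L₁ (Fin.cons d e : Fin (t + 1) → Fin s → V)) j.succ =
      prev L₁ (prev d e) j := by
    rw [prev_succ]
    unfold prev
    simp only [Fin.val_castSucc]
    split_ifs with hj hj1
    · rfl
    · have : (⟨j.1 - 1, by omega⟩ : Fin (t + 1)) = 0 := Fin.ext hj1
      rw [this, Fin.cons_zero]
    · have : (⟨j.1 - 1, by omega⟩ : Fin (t + 1)) = (⟨j.1 - 1 - 1, by omega⟩ : Fin t).succ :=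
        Fin.ext (by simp; omega)
      rw [this, Fin.cons_succ]
  rw [h2, prev_succ, Fin.cons_succ, cons_castSucc] at h1
  exact h1

open Classical in
/-- Each level is determined, as a set, by the two levels before it. -/
lemma card_sphereSeq_le {V : Type*} [Fintype V] {s : ℕ} (G : SimpleGraph V) (t : ℕ)
    (L₀ L₁ : Fin s → V) :
    (Finset.univ.filter fun v : Fin t → Fin s → V => IsSphereSeq G L₀ L₁ v).card ≤
      s.factorial ^ t := by
  induction t generalizing L₀ L₁ with
  | zero => exact (Finset.card_filter_le _ _).trans (by simp)
  | succ t ih =>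
    set D := Finset.univ.filter fun d : Fin s → V => Function.Injective d ∧
      ∀ u, (∃ a, d a = u) ↔ (∃ b, G.Adj (L₁ b) u) ∧ ∀ b, L₀ b ≠ u with hD
    have h1 : (Finset.univ.filter fun v : Fin (t + 1) → Fin s → V => IsSphereSeq G L₀ L₁ v) ⊆
        D.biUnion fun d => (Finset.univ.filter fun e : Fin t → Fin s → V =>
          IsSphereSeq G L₁ d e).image fun e => (Fin.cons d e : Fin (t + 1) → Fin s → V) := by
      intro v hv
      have hv := (Finset.mem_filter.1 hv).2
      rw [← Fin.cons_self_tail v] at hv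
      obtain ⟨h2, h3⟩ := isSphereSeq_cons hv
      exact Finset.mem_biUnion.2 ⟨v 0, Finset.mem_filter.2 ⟨Finset.mem_univ _, h2⟩,
        Finset.mem_image.2 ⟨_, Finset.mem_filter.2 ⟨Finset.mem_univ _, h3⟩,
          Fin.cons_self_tail v⟩⟩
    refine (Finset.card_le_card h1).trans (Finset.card_biUnion_le.trans ?_)
    calc _ ≤ ∑ _d ∈ D, s.factorial ^ t :=
          Finset.sum_le_sum fun d _ => Finset.card_image_le.trans (ih L₁ d)
      _ = D.card * s.factorial ^ t := by rw [Finset.sum_const, smul_eq_mul]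
      _ ≤ s.factorial * s.factorial ^ t :=
          Nat.mul_le_mul_right _ (card_enumerations_le _)
      _ = s.factorial ^ (t + 1) := by rw [pow_succ']

/-! ### The recursion over the blocks -/

section

variable {n : ℕ}

/-- If all vertices of a block lie outside the community, then they are distinct and every edge of
`G` at a vertex of one of the levels is an edge of the block. -/
def blockCovered {h s : ℕ} (G : SimpleGraph (Fin n)) (y : Fin n × Bool)
    (c : Config (Fin n × Bool) h s) : Prop :=
  (∀ o, (c.2 o).2 = false) → Function.Injective (fun o => (c.2 o).1) ∧
    ∀ j b v, G.Adj (c.2 (some (j, b))).1 v → v = (parentState y c (some (j, b))).1 ∨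
      ∃ (hj : j.1 + 1 < h) (a : Fin s), c.1 ⟨j.1 + 1, hj⟩ a = b ∧
        v = (c.2 (some (⟨j.1 + 1, hj⟩, a))).1

open Classical in
/-- The configurations of a block that lie outside the community and follow the edges of `G`. -/
def zeroConfigs (h s : ℕ) (G : SimpleGraph (Fin n)) (y : Fin n × Bool) :
    Finset (Config (Fin n × Bool) h s) :=
  Finset.univ.filter fun c => (∀ o, (c.2 o).2 = false) ∧ blockCovered G y c ∧
    ∀ o, G.Adj (parentState y c o).1 (c.2 o).1

open Classical in
/-- The shape of a block outside the community is determined by `G` and by its places, and these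
are determined level by level, up to the order within a level. -/
lemma card_zeroConfigs_le {s t Δ : ℕ} {G : SimpleGraph (Fin n)}
    (hΔ : ∀ v, (Finset.univ.filter fun w => G.Adj v w).card ≤ Δ) (y : Fin n × Bool) :
    (zeroConfigs (t + 1) s G y).card ≤ s ^ s * (Δ * (Δ ^ s * s.factorial ^ t)) := by
  set N : Fin n → Finset (Fin n) := fun v => Finset.univ.filter fun w => G.Adj v w with hN
  set codes : Finset (Σ _ : Fin n, Σ _ : Fin s → Fin n, Fin t → Fin s → Fin n) :=
    (N y.1).sigma fun v0 => (Fintype.piFinset fun _ => N v0).sigma fun L =>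
      Finset.univ.filter fun v => IsSphereSeq G (fun _ => v0) L v with hcodes
  have hcard : codes.card ≤ Δ * (Δ ^ s * s.factorial ^ t) := by
    rw [hcodes, Finset.card_sigma]
    calc _ ≤ ∑ _v ∈ N y.1, Δ ^ s * s.factorial ^ t := by
          refine Finset.sum_le_sum fun v0 _ => ?_
          rw [Finset.card_sigma]
          calc _ ≤ ∑ _L ∈ Fintype.piFinset fun _ : Fin s => N v0, s.factorial ^ t :=
                Finset.sum_le_sum fun L _ => card_sphereSeq_le G t _ _
            _ ≤ _ := by
                rw [Finset.sum_const, smul_eq_mul, Fintype.card_piFinset_const]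
                exact Nat.mul_le_mul_right _ (Nat.pow_le_pow_left (hΔ v0) s)
      _ ≤ _ := by
          rw [Finset.sum_const, smul_eq_mul]
          exact Nat.mul_le_mul_right _ (hΔ _)
  have hprod : ((Finset.univ : Finset (Fin s → Fin s)) ×ˢ codes).card ≤
      s ^ s * (Δ * (Δ ^ s * s.factorial ^ t)) := by
    rw [Finset.card_product, Finset.card_univ, Fintype.card_fun, Fintype.card_fin]
    exact Nat.mul_le_mul_left _ hcard
  refine le_trans ?_ hprod
  -- a block is encoded by the parents of its lowest level, which play no role, and its places
  refine Finset.card_le_card_of_injOn (fun c => (c.1 0, ⟨(c.2 none).1,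
    fun a => (c.2 (some (0, a))).1, fun j a => (c.2 (some (j.succ, a))).1⟩)) ?_ ?_
  · intro c hc
    obtain ⟨hz, hcov, hadj⟩ := (Finset.mem_filter.1 (Finset.mem_coe.1 hc)).2
    obtain ⟨hinj, hclose⟩ := hcov hz
    refine Finset.mem_coe.2 (Finset.mem_product.2 ⟨Finset.mem_univ _, ?_⟩)
    rw [hcodes]
    refine Finset.mem_sigma.2 ⟨Finset.mem_filter.2 ⟨Finset.mem_univ _, hadj none⟩,
      Finset.mem_sigma.2 ⟨Fintype.mem_piFinset.2 fun a =>
        Finset.mem_filter.2 ⟨Finset.mem_univ _, ?_⟩, Finset.mem_filter.2 ⟨Finset.mem_univ _, ?_⟩⟩⟩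
    · exact hadj (some (0, a))
    · intro j
      have hlev : prev (fun a => (c.2 (some (0, a))).1)
          (fun (j : Fin t) a => (c.2 (some (j.succ, a))).1) j =
          fun a => (c.2 (some (j.castSucc, a))).1 := by
        have := cons_castSucc (fun a => (c.2 (some (0, a))).1)
          (fun (j : Fin t) a => (c.2 (some (j.succ, a))).1) j
        rw [← this]
        refine congrFun (?_ : _ = fun (j : Fin (t + 1)) a => (c.2 (some (j, a))).1) j.castSucc
        refine funext fun j => ?_
        refine Fin.cases ?_ (fun j => ?_) j
        · rw [Fin.cons_zero]
        · rw [Fin.cons_succ]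
      have hpar : ∀ b, ∃ o, prev (fun _ => (c.2 none).1) (prev (fun a => (c.2 (some (0, a))).1)
          (fun (j : Fin t) a => (c.2 (some (j.succ, a))).1)) j b = (c.2 o).1 ∧
          (o = none ∨ ∃ j' b', j'.1 < j.1 ∧ o = some (j', b')) := by
        intro b
        unfold prev
        dsimp only
        split_ifs with h1 h2
        · exact ⟨none, rfl, Or.inl rfl⟩
        · exact ⟨some (0, b), rfl, Or.inr ⟨0, b, Nat.pos_of_ne_zero h1, rfl⟩⟩
        · exact ⟨some (_, b), rfl, Or.inr ⟨_, b, by simp; omega, rfl⟩⟩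
      have hpar2 : ∀ b, ∃ b', (parentState y c (some (j.castSucc, b))).1 =
          prev (fun _ => (c.2 none).1) (prev (fun a => (c.2 (some (0, a))).1)
            (fun (j : Fin t) a => (c.2 (some (j.succ, a))).1)) j b' := by
        intro b
        refine ⟨c.1 j.castSucc b, ?_⟩
        unfold prev
        simp only [parentState, Fin.val_castSucc]
        split_ifs with h1 h2
        · rfl
        · have : (⟨j.1 - 1, by omega⟩ : Fin (t + 1)) = 0 := Fin.ext h2
          rw [this]
        · have : (⟨j.1 - 1, by omega⟩ : Fin (t + 1)) = (⟨j.1 - 1 - 1, by omega⟩ : Fin t).succ :=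
            Fin.ext (by simp; omega)
          rw [this]
      refine ⟨fun a a' haa => ?_, fun u => ⟨?_, ?_⟩⟩
      · have := hinj haa
        simp only [Option.some.injEq, Prod.mk.injEq, true_and] at this
        exact this
      · rintro ⟨a, rfl⟩
        refine ⟨⟨c.1 j.succ a, ?_⟩, fun b hb => ?_⟩
        · rw [hlev]
          have := hadj (some (j.succ, a))
          simp only [parentState, Fin.val_succ, Nat.add_one_ne_zero, if_false] at this
          exact this
        · obtain ⟨o, ho, ho2⟩ := hpar b
          rw [ho] at hb
          have := hinj hb
          rcases ho2 with rfl | ⟨j', b', hj', rfl⟩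
          · simp at this
          · simp only [Option.some.injEq, Prod.mk.injEq] at this
            have := congrArg Fin.val this.1
            simp at this
            omega
      · rintro ⟨⟨b, hb⟩, hne⟩
        rw [hlev] at hb
        rcases hclose _ _ _ hb with h1 | ⟨hj, a, -, h2⟩
        · obtain ⟨b', hb'⟩ := hpar2 b
          exact absurd (h1.trans hb').symm (hne b')
        · exact ⟨a, h2.symm⟩
  · intro c hc c' hc' heq
    obtain ⟨hz, hcov, hadj⟩ := (Finset.mem_filter.1 (Finset.mem_coe.1 hc)).2
    obtain ⟨hz', hcov', hadj'⟩ := (Finset.mem_filter.1 (Finset.mem_coe.1 hc')).2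
    obtain ⟨hinj, hclose⟩ := hcov' hz'
    simp only [Prod.mk.injEq, Sigma.mk.injEq, heq_eq_eq] at heq
    obtain ⟨h1, h2, h3, h4⟩ := heq
    have h5 : c.2 = c'.2 := by
      funext o
      refine Prod.ext ?_ ((hz o).trans (hz' o).symm)
      rcases o with _ | ⟨j, a⟩
      · exact h2
      · refine Fin.cases ?_ (fun j => ?_) j
        · exact congrFun h3 a
        · exact congrFun (congrFun h4 j) a
    refine Prod.ext (funext fun j => ?_) h5
    refine Fin.cases h1 (fun j => funext fun a => ?_) j
    have h6 := hadj (some (j.succ, a))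
    simp only [parentState, Fin.val_succ, Nat.add_one_ne_zero, if_false, h5] at h6
    rcases hclose _ _ _ h6.symm with h7 | ⟨hj, b, -, h7⟩
    · simp only [parentState, Fin.val_succ, Nat.add_one_ne_zero, if_false] at h7
      have := hinj h7
      simp only [Option.some.injEq, Prod.mk.injEq, true_and] at this
      exact this
    · have := hinj h7
      simp only [Option.some.injEq, Prod.mk.injEq] at this
      have := congrArg Fin.val this.1
      simp at this
      omega

open Classical in
/-- Row bounds for a kernel on states. States `(v, true)` with `v ∉ A` are those of vertices that
are not shared with `G`; these carry the main weight. Shared vertices inside the community have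
the small weight `δ`, or `η` below a vertex outside the community, and the edges at a vertex
`(v, false)` outside the community are edges of `G`. -/
structure KernelBound (W : Fin n × Bool → Fin n × Bool → ℝ) (G : SimpleGraph (Fin n))
    (A : Finset (Fin n)) (Δ : ℕ) (ν δ η : ℝ) : Prop where
  nonneg : ∀ y y', 0 ≤ W y y'
  degree : ∀ v, (Finset.univ.filter fun w => G.Adj v w).card ≤ Δ
  adj_mem : ∀ v w, G.Adj v w → w ∈ A
  zero_le : ∀ y v, W y (v, false) ≤ ν
  zero_adj : ∀ y v, W y (v, false) ≠ 0 → G.Adj y.1 v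
  from_zero : ∀ v y, W (v, false) y ≠ 0 → G.Adj v y.1
  out_le : ∀ y, ∑ v ∈ Aᶜ, W y (v, true) ≤ 1
  one_le : ∀ v, ∑ w ∈ A, W (v, true) (w, true) ≤ δ
  zero_one_le : ∀ v, ∑ w ∈ A, W (v, false) (w, true) ≤ η
  eta_pos : 0 < η
  eta_le : η ≤ δ
  delta_le : δ ≤ 1
  nu_nonneg : 0 ≤ ν

/-- The part of a kernel that leads to vertices not shared with `G`. -/
def outPart (W : Fin n × Bool → Fin n × Bool → ℝ) (A : Finset (Fin n)) (y' y : Fin n × Bool) : ℝ :=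
  if y.1 ∉ A ∧ y.2 = true then W y' y else 0

/-- A kernel with the small weights scaled up to order one. -/
def boosted (W : Fin n × Bool → Fin n × Bool → ℝ) (A : Finset (Fin n)) (δ η : ℝ)
    (y' y : Fin n × Bool) : ℝ :=
  if y.1 ∈ A ∧ y.2 = true then (if y'.2 = true then δ⁻¹ else η⁻¹) * W y' y else W y' y

lemma sum_state (f : Fin n × Bool → ℝ) (A : Finset (Fin n)) :
    ∑ y, f y = ∑ v ∈ Aᶜ, f (v, true) + ∑ v ∈ A, f (v, true) + ∑ v, f (v, false) := by
  rw [Fintype.sum_prod_type]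
  simp only [Fintype.sum_bool]
  rw [Finset.sum_add_distrib, add_comm (∑ v ∈ Aᶜ, f (v, true)), Finset.sum_add_sum_compl]

section

variable {W : Fin n × Bool → Fin n × Bool → ℝ} {G : SimpleGraph (Fin n)}
  {A : Finset (Fin n)} {Δ : ℕ} {ν δ η : ℝ}

lemma sum_zero_le (hW : KernelBound W G A Δ ν δ η) (y : Fin n × Bool) :
    ∑ v, W y (v, false) ≤ Δ * ν := by
  classical
  have h1 : ∑ v, W y (v, false) =
      ∑ v ∈ Finset.univ.filter (fun w => G.Adj y.1 w), W y (v, false) := by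
    refine (Finset.sum_subset (Finset.subset_univ _) fun v _ hv => ?_).symm
    by_contra h
    exact hv (Finset.mem_filter.2 ⟨Finset.mem_univ _, hW.zero_adj y v h⟩)
  rw [h1]
  refine (Finset.sum_le_card_nsmul _ _ ν fun v _ => hW.zero_le y v).trans ?_
  rw [nsmul_eq_mul]
  exact mul_le_mul_of_nonneg_right (by exact_mod_cast hW.degree y.1) hW.nu_nonneg

lemma outPart_nonneg (hW : KernelBound W G A Δ ν δ η) (y y' : Fin n × Bool) :
    0 ≤ outPart W A y y' := by
  unfold outPart; split_ifs
  · exact hW.nonneg _ _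
  · exact le_rfl

lemma boosted_nonneg (hW : KernelBound W G A Δ ν δ η) (y y' : Fin n × Bool) :
    0 ≤ boosted W A δ η y y' := by
  have h1 := hW.nonneg y y'
  have h2 := hW.eta_pos
  have h3 := h2.trans_le hW.eta_le
  unfold boosted; split_ifs <;> positivity

lemma sum_outPart_le (hW : KernelBound W G A Δ ν δ η) (y : Fin n × Bool) :
    ∑ y', outPart W A y y' ≤ 1 := by
  rw [sum_state _ A]
  have h1 : ∑ v ∈ A, outPart W A y (v, true) = 0 :=
    Finset.sum_eq_zero fun v hv => by simp [outPart, hv]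
  have h2 : ∑ v, outPart W A y (v, false) = 0 :=
    Finset.sum_eq_zero fun v hv => by simp [outPart]
  rw [h1, h2, add_zero, add_zero]
  refine le_trans (le_of_eq (Finset.sum_congr rfl fun v hv => ?_)) (hW.out_le y)
  simp [outPart, Finset.mem_compl.1 hv]

lemma sum_boosted_le (hW : KernelBound W G A Δ ν δ η) (y : Fin n × Bool) :
    ∑ y', boosted W A δ η y y' ≤ 2 + Δ * ν := by
  rw [sum_state _ A]
  have h0 := hW.eta_pos
  have h0' := h0.trans_le hW.eta_le
  have h1 : ∑ v ∈ Aᶜ, boosted W A δ η y (v, true) ≤ 1 := by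
    refine le_trans (le_of_eq (Finset.sum_congr rfl fun v hv => ?_)) (hW.out_le y)
    simp [boosted, Finset.mem_compl.1 hv]
  have h2 : ∑ v ∈ A, boosted W A δ η y (v, true) ≤ 1 := by
    have : ∀ v ∈ A, boosted W A δ η y (v, true) =
        (if y.2 = true then δ⁻¹ else η⁻¹) * W y (v, true) := fun v hv => by simp [boosted, hv]
    rw [Finset.sum_congr rfl this, ← Finset.mul_sum]
    obtain ⟨v, x⟩ := y
    cases x
    · simp only [Bool.false_eq_true, if_false]
      rw [inv_mul_le_iff₀ h0, mul_one]; exact hW.zero_one_le v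
    · simp only [if_true]
      rw [inv_mul_le_iff₀ h0', mul_one]; exact hW.one_le v
  have h3 : ∑ v, boosted W A δ η y (v, false) ≤ Δ * ν := by
    refine le_trans (le_of_eq (Finset.sum_congr rfl fun v hv => ?_)) (sum_zero_le hW y)
    simp [boosted]
  linarith

lemma le_boosted (hW : KernelBound W G A Δ ν δ η) (y y' : Fin n × Bool) :
    W y y' ≤ boosted W A δ η y y' := by
  have h1 := hW.nonneg y y'
  have h2 := hW.eta_pos
  have h3 := h2.trans_le hW.eta_le
  unfold boosted
  split_ifs
  · exact le_mul_of_one_le_left h1 ((one_le_inv₀ h3).2 hW.delta_le)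
  · exact le_mul_of_one_le_left h1 ((one_le_inv₀ h2).2 (hW.eta_le.trans hW.delta_le))
  · exact le_rfl

/-- A block with a shared vertex inside the community gains a small factor. -/
lemma blockProd_le_boosted {h s : ℕ} (hW : KernelBound W G A Δ ν δ η) {y : Fin n × Bool}
    {c : Config (Fin n × Bool) h s} (hne : ∀ o, W (parentState y c o) (c.2 o) ≠ 0)
    (hone : ∃ o, (c.2 o).1 ∈ A ∧ (c.2 o).2 = true) :
    blockProd W y c ≤ (if y.2 = true then δ else η) * blockProd (boosted W A δ η) y c := by
  have h2 := hW.eta_pos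
  have h3 := h2.trans_le hW.eta_le
  -- if the block hangs from a vertex outside the community, then the shared vertex is chosen
  -- such that its parent is outside as well
  obtain ⟨o, ho, ho2⟩ : ∃ o, ((c.2 o).1 ∈ A ∧ (c.2 o).2 = true) ∧
      (y.2 = false → (parentState y c o).2 = false) := by
    by_cases hy : y.2 = true
    · obtain ⟨o, ho⟩ := hone
      exact ⟨o, ho, fun h => absurd (hy.symm.trans h) (by simp)⟩
    · have hy' : y.2 = false := by simpa using hy
      by_contra hcon
      push Not at hcon
      have hall : ∀ o, (parentState y c o).2 = false → (c.2 o).2 = false := by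
        intro o hpo
        by_contra hx
        have hx : (c.2 o).2 = true := by simpa using hx
        have h4 : W ((parentState y c o).1, false) (c.2 o) ≠ 0 := by
          have := hne o
          rwa [← Prod.mk.eta (p := parentState y c o), hpo] at this
        exact (hcon o ⟨hW.adj_mem _ _ (hW.from_zero _ _ h4), hx⟩).2 hpo
      obtain ⟨o, ho⟩ := hone
      have := block_induction (P := fun y => y.2 = false) y (hall none hy') (fun i => hall _) o
      rw [ho.2] at this
      exact absurd this (by simp)
  set d := if y.2 = true then δ else η with hd
  have hkey : W (parentState y c o) (c.2 o) ≤
      d * boosted W A δ η (parentState y c o) (c.2 o) := by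
    have h1 := hW.nonneg (parentState y c o) (c.2 o)
    unfold boosted
    rw [if_pos ho, ← mul_assoc]
    refine le_mul_of_one_le_left h1 ?_
    rw [hd]
    by_cases hy : y.2 = true
    · rw [if_pos hy]
      split_ifs
      · rw [mul_inv_cancel₀ h3.ne']
      · rw [← div_eq_mul_inv, one_le_div h2]; exact hW.eta_le
    · have hy' : y.2 = false := by simpa using hy
      rw [if_neg hy, if_neg (by simp [ho2 hy']), mul_inv_cancel₀ h2.ne']
  unfold blockProd
  rw [← Finset.mul_prod_erase _ _ (Finset.mem_univ o),
    ← Finset.mul_prod_erase _ (fun o => boosted W A δ η (parentState y c o) (c.2 o))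
      (Finset.mem_univ o), ← mul_assoc]
  refine mul_le_mul hkey (Finset.prod_le_prod (fun _ _ => hW.nonneg _ _)
    fun _ _ => le_boosted hW _ _) (Finset.prod_nonneg fun _ _ => hW.nonneg _ _) ?_
  have := boosted_nonneg hW (parentState y c o) (c.2 o)
  rw [hd]; split_ifs <;> positivity

open Classical in
/-- The weight of a block, restricted to covered configurations. -/
def blockWeight {h s : ℕ} (W : Fin n × Bool → Fin n × Bool → ℝ) (G : SimpleGraph (Fin n))
    (y : Fin n × Bool) (c : Config (Fin n × Bool) h s) : ℝ :=
  if blockCovered G y c then blockProd W y c else 0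

lemma blockWeight_nonneg {h s : ℕ} (hW : KernelBound W G A Δ ν δ η) (y : Fin n × Bool)
    (c : Config (Fin n × Bool) h s) : 0 ≤ blockWeight W G y c := by
  unfold blockWeight
  split_ifs
  · exact blockProd_nonneg hW.nonneg y c
  · exact le_rfl

open Classical in
/-- A block is not shared at all, or it lies outside the community, or it gains a small factor. -/
lemma blockWeight_mul_le {h s : ℕ} (hW : KernelBound W G A Δ ν δ η) {g : Fin n × Bool → ℝ}
    {u z M : ℝ} (hu : 0 ≤ u) (hz : 0 ≤ z) (hM : 0 ≤ M)
    (hgu : ∀ v ∉ A, g (v, true) ≤ u) (hgz : ∀ v, g (v, false) ≤ z)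
    (hgM : ∀ y, g y ≤ M) (y : Fin n × Bool) (c : Config (Fin n × Bool) h s) :
    blockWeight W G y c * g (c.2 none) ≤
      (if y.2 = true then blockProd (outPart W A) y c * u else 0) +
      (if y.1 ∈ A then (if c ∈ zeroConfigs h s G y then blockProd W y c else 0) * z else 0) +
      (if y.2 = true then δ else η) * blockProd (boosted W A δ η) y c * M := by
  have h2 := hW.eta_pos
  have h3 := h2.trans_le hW.eta_le
  have hn1 : 0 ≤ if y.2 = true then blockProd (outPart W A) y c * u else 0 := by
    have := blockProd_nonneg (outPart_nonneg hW) y c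
    split_ifs <;> positivity
  have hn2 : 0 ≤ if y.1 ∈ A then (if c ∈ zeroConfigs h s G y then blockProd W y c else 0) * z
      else 0 := by
    have := blockProd_nonneg hW.nonneg y c
    split_ifs <;> positivity
  have hn3 : 0 ≤ (if y.2 = true then δ else η) * blockProd (boosted W A δ η) y c * M := by
    have := blockProd_nonneg (boosted_nonneg hW) y c
    split_ifs <;> positivity
  by_cases hcov : blockCovered G y c
  swap
  · rw [blockWeight, if_neg hcov, zero_mul]
    linarith
  rw [blockWeight, if_pos hcov]
  by_cases hzero : ∃ o, W (parentState y c o) (c.2 o) = 0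
  · obtain ⟨o, ho⟩ := hzero
    have : blockProd W y c = 0 := Finset.prod_eq_zero (Finset.mem_univ o) ho
    rw [this, zero_mul]
    rw [this] at hn2
    linarith
  push Not at hzero
  have hb := blockProd_nonneg hW.nonneg y c
  -- a shared vertex inside the community
  by_cases hone : ∃ o, (c.2 o).1 ∈ A ∧ (c.2 o).2 = true
  · have h4 := blockProd_le_boosted hW hzero hone
    have : blockProd W y c * g (c.2 none) ≤
        (if y.2 = true then δ else η) * blockProd (boosted W A δ η) y c * M :=
      (mul_le_mul_of_nonneg_left (hgM _) hb).trans (mul_le_mul_of_nonneg_right h4 hM)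
    linarith
  push Not at hone
  -- otherwise the label of the spine vertex propagates to the block
  by_cases hlab : (c.2 none).2 = true
  · have hall : ∀ o, (c.2 o).1 ∉ A ∧ (c.2 o).2 = true := by
      refine block_induction (P := fun y => y.1 ∉ A ∧ y.2 = true) y
        ⟨fun h => hone none h hlab, hlab⟩ fun i hi => ?_
      have hx : (c.2 (some i)).2 = true := by
        by_contra hx
        have hx : (c.2 (some i)).2 = false := by simpa using hx
        have h4 : W (parentState y c (some i)) ((c.2 (some i)).1, false) ≠ 0 := by
          have := hzero (some i)
          rwa [← Prod.mk.eta (p := c.2 (some i)), hx] at this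
        exact hi.1 (hW.adj_mem _ _ (hW.zero_adj _ _ h4).symm)
      exact ⟨fun h => hone _ h hx, hx⟩
    have hy : y.2 = true := by
      by_contra hx
      have hx : y.2 = false := by simpa using hx
      have h4 : W (y.1, false) (c.2 none) ≠ 0 := by
        have := hzero none
        rwa [parentState, ← Prod.mk.eta (p := y), hx] at this
      exact (hall none).1 (hW.adj_mem _ _ (hW.from_zero _ _ h4))
    have h5 : blockProd (outPart W A) y c = blockProd W y c :=
      Finset.prod_congr rfl fun o _ => if_pos (hall o)
    have h6 : g (c.2 none) ≤ u := by
      have := hgu _ (hall none).1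
      rwa [← (hall none).2] at this
    rw [if_pos hy, h5]
    have := mul_le_mul_of_nonneg_left h6 hb
    linarith
  · have hlab : (c.2 none).2 = false := by simpa using hlab
    have hall : ∀ o, (c.2 o).2 = false := by
      refine block_induction (P := fun y => y.2 = false) y hlab fun i hi => ?_
      by_contra hx
      have hx : (c.2 (some i)).2 = true := by simpa using hx
      have h4 : W ((parentState y c (some i)).1, false) (c.2 (some i)) ≠ 0 := by
        have := hzero (some i)
        rwa [← Prod.mk.eta (p := parentState y c (some i)), hi] at this
      exact hone _ (hW.adj_mem _ _ (hW.from_zero _ _ h4)) hx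
    have hadj : ∀ o, G.Adj (parentState y c o).1 (c.2 o).1 := by
      intro o
      refine hW.zero_adj _ _ ?_
      have := hzero o
      rwa [← Prod.mk.eta (p := c.2 o), hall o] at this
    have hmem : c ∈ zeroConfigs h s G y :=
      Finset.mem_filter.2 ⟨Finset.mem_univ _, hall, hcov, hadj⟩
    have hyA : y.1 ∈ A := hW.adj_mem _ _ (hadj none).symm
    have h6 : g (c.2 none) ≤ z := by
      have := hgz (c.2 none).1
      rwa [← hlab] at this
    rw [if_pos hyA, if_pos hmem]
    have := mul_le_mul_of_nonneg_left h6 hb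
    linarith

/-- A bound on the total weight of the blocks outside the community, divided by the number of shapes
of a block. -/
def zeroBlockBound (s t Δ : ℕ) (ν : ℝ) : ℝ :=
  (Δ : ℝ) ^ (s + 1) * ν ^ ((t + 1) * s + 1) * ((s.factorial : ℝ) / (s : ℝ) ^ s) ^ t

open Classical in
lemma sum_zeroConfigs_le {s t : ℕ} (hs : 0 < s) (hW : KernelBound W G A Δ ν δ η)
    (y : Fin n × Bool) :
    ∑ c : Config (Fin n × Bool) (t + 1) s,
      (if c ∈ zeroConfigs (t + 1) s G y then blockProd W y c else 0) ≤
      ((s : ℝ) ^ s) ^ (t + 1) * zeroBlockBound s t Δ ν := by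
  have h0 : ∑ c : Config (Fin n × Bool) (t + 1) s,
      (if c ∈ zeroConfigs (t + 1) s G y then blockProd W y c else 0) =
        ∑ c ∈ zeroConfigs (t + 1) s G y, blockProd W y c := by
    refine (Finset.sum_subset (Finset.subset_univ _) fun c _ hc => if_neg hc).symm.trans ?_
    exact Finset.sum_congr rfl fun c hc => if_pos hc
  rw [h0]
  have h1 : ∀ c ∈ zeroConfigs (t + 1) s G y, blockProd W y c ≤ ν ^ ((t + 1) * s + 1) := by
    intro c hc
    have hz := (Finset.mem_filter.1 hc).2.1
    calc blockProd W y c ≤ ∏ _o : Option (Fin (t + 1) × Fin s), ν := by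
          refine Finset.prod_le_prod (fun _ _ => hW.nonneg _ _) fun o _ => ?_
          have := hW.zero_le (parentState y c o) (c.2 o).1
          rwa [← hz o] at this
      _ = _ := by
          rw [Finset.prod_const, Finset.card_univ, Fintype.card_option, Fintype.card_prod,
            Fintype.card_fin, Fintype.card_fin]
  refine (Finset.sum_le_card_nsmul _ _ _ h1).trans ?_
  rw [nsmul_eq_mul]
  have h2 : ((zeroConfigs (t + 1) s G y).card : ℝ) ≤
      (s : ℝ) ^ s * (Δ * ((Δ : ℝ) ^ s * (s.factorial : ℝ) ^ t)) := by
    exact_mod_cast card_zeroConfigs_le hW.degree y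
  refine (mul_le_mul_of_nonneg_right h2 (pow_nonneg hW.nu_nonneg _)).trans (le_of_eq ?_)
  have : (s : ℝ) ≠ 0 := by positivity
  unfold zeroBlockBound
  rw [div_pow]
  field_simp
  ring

/-- The constant in the bound on the blocks with a shared vertex inside the community. -/
def blockConst (s t Δ : ℕ) (ν : ℝ) : ℝ := (2 + Δ * ν) * ((2 + Δ * ν) ^ s) ^ (t + 1)

/-- One step of the recursion over the blocks, where `u`, `z` and `M` bound the weight `g` of the rest
of the chain. -/
lemma sum_blockWeight_mul_le {s t : ℕ} (hs : 0 < s) (hW : KernelBound W G A Δ ν δ η)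
    {g : Fin n × Bool → ℝ} {u z M : ℝ} (hu : 0 ≤ u) (hz : 0 ≤ z) (hM : 0 ≤ M)
    (hgu : ∀ v ∉ A, g (v, true) ≤ u) (hgz : ∀ v, g (v, false) ≤ z)
    (hgM : ∀ y, g y ≤ M) (y : Fin n × Bool) :
    ∑ c : Config (Fin n × Bool) (t + 1) s, blockWeight W G y c * g (c.2 none) ≤
      ((s : ℝ) ^ s) ^ (t + 1) * ((if y.2 = true then u else 0) +
        (if y.1 ∈ A then zeroBlockBound s t Δ ν * z else 0) +
        (if y.2 = true then δ else η) * blockConst s t Δ ν * M) := by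
  classical
  refine (Finset.sum_le_sum fun c _ => blockWeight_mul_le hW hu hz hM hgu hgz hgM y c).trans ?_
  rw [Finset.sum_add_distrib, Finset.sum_add_distrib, mul_add, mul_add]
  refine add_le_add (add_le_add ?_ ?_) ?_
  · split_ifs
    · rw [← Finset.sum_mul]
      refine mul_le_mul_of_nonneg_right ?_ hu
      exact (sum_blockProd_le (outPart_nonneg hW) (sum_outPart_le hW) y).trans (by simp)
    · simp
  · split_ifs
    · rw [← Finset.sum_mul, ← mul_assoc]
      exact mul_le_mul_of_nonneg_right (sum_zeroConfigs_le hs hW y) hz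
    · simp
  · rw [← Finset.sum_mul, ← Finset.mul_sum]
    have h1 := sum_blockProd_le (h := t + 1) (s := s) (boosted_nonneg hW) (sum_boosted_le hW) y
    have h2 : 0 ≤ (if y.2 = true then δ else η) := by
      have h2 := hW.eta_pos
      have h3 := h2.trans_le hW.eta_le
      split_ifs <;> positivity
    calc _ ≤ (if y.2 = true then δ else η) *
          (((s : ℝ) ^ s) ^ (t + 1) * blockConst s t Δ ν) * M :=
          mul_le_mul_of_nonneg_right (mul_le_mul_of_nonneg_left h1 h2) hM
      _ = _ := by ring

/-- The total weight of a chain of `m` blocks that hangs from a vertex of state `y`. -/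
def chainSum (s t : ℕ) (W : Fin n × Bool → Fin n × Bool → ℝ) (G : SimpleGraph (Fin n)) (m : ℕ)
    (y : Fin n × Bool) : ℝ :=
  ∑ c : Fin m → Config (Fin n × Bool) (t + 1) s,
    ∏ k, blockWeight W G (prev y (fun k => (c k).2 none) k) (c k)

lemma chainSum_succ (s t : ℕ) (W : Fin n × Bool → Fin n × Bool → ℝ) (G : SimpleGraph (Fin n))
    (m : ℕ) (y : Fin n × Bool) :
    chainSum s t W G (m + 1) y = ∑ c : Config (Fin n × Bool) (t + 1) s,
      blockWeight W G y c * chainSum s t W G m (c.2 none) := by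
  unfold chainSum
  rw [sum_fin_succ_fun]
  refine Finset.sum_congr rfl fun d _ => ?_
  rw [Finset.mul_sum]
  refine Finset.sum_congr rfl fun e _ => ?_
  rw [Fin.prod_univ_succ]
  congr 1
  refine Finset.prod_congr rfl fun k _ => ?_
  rw [Fin.cons_succ, prev_succ]
  congr 1
  have h1 : (fun k : Fin (m + 1) => ((Fin.cons d e : Fin (m + 1) →
      Config (Fin n × Bool) (t + 1) s) k).2 none) = Fin.cons (d.2 none) fun k => (e k).2 none := by
    funext k
    refine Fin.cases ?_ (fun k => ?_) k
    · simp
    · simp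
  exact (congrFun h1 k.castSucc).trans (cons_castSucc _ _ k)

/-- The recursion over the blocks of a chain, for a chain that hangs from a vertex that is not
shared, from one outside the community, or from an arbitrary one inside. The three bounds are proved
together, since each block may lead from any of these cases to any other; the values are
normalized by the number of shapes. -/
lemma chainSum_le {s t : ℕ} (hs : 0 < s) (hW : KernelBound W G A Δ ν δ η)
    (hq : zeroBlockBound s t Δ ν ≤ 1 / 2) (hη : 6 * η * blockConst s t Δ ν ≤ 1 / 2) (m : ℕ)
    (hδ : 3 * δ * blockConst s t Δ ν * m ≤ 1 / 2) :
    (∀ v ∉ A, chainSum s t W G m (v, true) ≤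
      (((s : ℝ) ^ s) ^ (t + 1)) ^ m * (1 + 3 * δ * blockConst s t Δ ν * m)) ∧
    (∀ v, chainSum s t W G m (v, false) ≤
      (((s : ℝ) ^ s) ^ (t + 1)) ^ m *
        (zeroBlockBound s t Δ ν ^ m + 6 * η * blockConst s t Δ ν)) ∧
    (∀ v, chainSum s t W G m (v, true) ≤
      (((s : ℝ) ^ s) ^ (t + 1)) ^ m * (1 + 3 * δ * blockConst s t Δ ν * m +
        zeroBlockBound s t Δ ν ^ m + 6 * η * blockConst s t Δ ν)) := by
  set N := ((s : ℝ) ^ s) ^ (t + 1) with hN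
  set q := zeroBlockBound s t Δ ν with hqdef
  set B := blockConst s t Δ ν with hB
  have h2 := hW.eta_pos
  have h3 := h2.trans_le hW.eta_le
  have hν := hW.nu_nonneg
  have hB0 : 0 ≤ B := by rw [hB]; unfold blockConst; positivity
  have hq0 : 0 ≤ q := by rw [hqdef]; unfold zeroBlockBound; positivity
  have hN0 : 0 < N := by positivity
  induction m with
  | zero =>
    have : 0 ≤ 6 * η * B := by positivity
    simp only [chainSum, Finset.univ_unique, Finset.prod_of_isEmpty,
      Finset.sum_const, Finset.card_singleton, one_smul, pow_zero, Nat.cast_zero, mul_zero, one_mul]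
    refine ⟨fun _ _ => ?_, fun _ => ?_, fun _ => ?_⟩ <;> linarith
  | succ m ih =>
    have hδB : 0 ≤ 3 * δ * B := by positivity
    have hδm : 3 * δ * B * m ≤ 1 / 2 := by
      refine le_trans ?_ hδ
      push_cast; nlinarith
    obtain ⟨ihu, ihz, ihb⟩ := ih hδm
    have hu0 : 0 ≤ 1 + 3 * δ * B * m := by positivity
    have hz0 : 0 ≤ q ^ m + 6 * η * B := by positivity
    -- all normalized weights are at most `3`
    have hqm : q ^ m ≤ 1 := pow_le_one₀ hq0 (by linarith)
    have hNm : 0 < N ^ m := by positivity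
    have hgM : ∀ y, chainSum s t W G m y / N ^ m ≤ 3 := by
      rintro ⟨v, x⟩
      rw [div_le_iff₀ hNm]
      cases x
      · refine (ihz v).trans ?_
        rw [mul_comm]
        exact mul_le_mul_of_nonneg_right (by linarith) hNm.le
      · refine (ihb v).trans ?_
        rw [mul_comm]
        exact mul_le_mul_of_nonneg_right (by linarith) hNm.le
    have key := sum_blockWeight_mul_le (t := t) hs hW (g := fun y => chainSum s t W G m y / N ^ m)
      hu0 hz0 (by norm_num : (0 : ℝ) ≤ 3)
      (fun v hv => by rw [div_le_iff₀ hNm, mul_comm]; exact ihu v hv)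
      (fun v => by rw [div_le_iff₀ hNm, mul_comm]; exact ihz v) hgM
    rw [← hN, ← hqdef, ← hB] at key
    have hstep : ∀ y, chainSum s t W G (m + 1) y = N ^ m *
        ∑ c : Config (Fin n × Bool) (t + 1) s,
          blockWeight W G y c * (chainSum s t W G m (c.2 none) / N ^ m) := by
      intro y
      rw [chainSum_succ, Finset.mul_sum]
      refine Finset.sum_congr rfl fun c _ => ?_
      field_simp
    have hqz : q * (q ^ m + 6 * η * B) + η * B * 3 ≤ q ^ (m + 1) + 6 * η * B := by
      have : 0 ≤ η * B := by positivity
      rw [pow_succ']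
      nlinarith
    have hmul : ∀ {y x}, ∑ c : Config (Fin n × Bool) (t + 1) s,
          blockWeight W G y c * (chainSum s t W G m (c.2 none) / N ^ m) ≤ N * x →
        chainSum s t W G (m + 1) y ≤ N ^ (m + 1) * x := by
      intro y x hx
      rw [hstep, pow_succ, mul_assoc]
      exact mul_le_mul_of_nonneg_left hx hNm.le
    have hqz0 : 0 ≤ q * (q ^ m + 6 * η * B) := by positivity
    refine ⟨fun v hv => hmul ((key _).trans ?_), fun v => hmul ((key _).trans ?_),
      fun v => hmul ((key _).trans ?_)⟩ <;> refine mul_le_mul_of_nonneg_left ?_ hN0.le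
    · simp only [if_true, if_neg hv]
      push_cast; linarith
    · simp only [Bool.false_eq_true, if_false]
      split_ifs <;> linarith
    · have : 0 ≤ η * B := by positivity
      simp only [if_true]
      push_cast
      split_ifs <;> linarith

end

end

/-! ### The second moment of the tree polynomial -/

lemma mem_verts_of_adj {n : ℕ} {r u v : Fin n} {S : Finset (Edge n)} (h : (graph S).Adj u v) :
    v ∈ verts r S := by
  obtain ⟨e, he, h2⟩ := h
  refine Finset.mem_insert_of_mem (mem_ends.2 ⟨e, he, ?_⟩)
  rcases h2 with h2 | h2 <;> simp [h2]

open Classical in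
/-- The weights of the second moment satisfy the row bounds. The weight `δ` of a shared vertex inside
the community consists of the contributions of shared and of unshared edges; the parameter `μ`
bounds the excess variance. -/
lemma kernelBound_weight {n : ℕ} {ρ l μ : ℝ} (hρ0 : 0 < ρ) (hρ1 : ρ ≤ 1) (hl : 0 < l)
    (hμ : 0 ≤ μ) (r : Fin n) {S : Finset (Edge n)} {Δ K : ℕ} (hΔ0 : 0 < Δ)
    (hΔ : ∀ v, (Finset.univ.filter fun w => (graph S).Adj v w).card ≤ Δ)
    (hK : (verts r S).card = K + 1) {ν : ℝ} (hν : ν = (n * ρ ^ 2 * l ^ 2)⁻¹)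
    (hδ : Δ * ν * (ρ * (1 + μ)) + (K + 1) / (n * ρ) ≤ 1) :
    KernelBound (weight ρ l μ r S) (graph S) (verts r S) Δ ν
      (Δ * ν * (ρ * (1 + μ)) + (K + 1) / (n * ρ)) (Δ * ν * ρ) := by
  have hn : (0 : ℝ) < n := by exact_mod_cast r.pos
  have hΔ0' : (0 : ℝ) < Δ := by exact_mod_cast hΔ0
  have hνpos : 0 < ν := by rw [hν]; positivity
  have hνρ : (n * ρ * l)⁻¹ * l⁻¹ = ν * ρ := by rw [hν]; field_simp
  -- the sum of a function supported on the neighbours of `v`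
  have hsum : ∀ (v : Fin n) (A : Finset (Fin n)) (x : ℝ), 0 ≤ x →
      ∑ w ∈ A, (if (graph S).Adj v w then x else 0) ≤ Δ * x := by
    intro v A x hx
    rw [← Finset.sum_filter, Finset.sum_const, nsmul_eq_mul]
    refine mul_le_mul_of_nonneg_right ?_ hx
    exact_mod_cast (Finset.card_le_card (Finset.filter_subset_filter _
      (Finset.subset_univ _))).trans (hΔ v)
  have hzero : ∀ y v, weight ρ l μ r S y (v, false) =
      if (graph S).Adj y.1 v then ν * (1 - ρ) else 0 := by
    intro y v
    unfold weight
    simp only [bit_false, mul_zero, add_zero, mul_one, bern, Bool.false_eq_true, if_false,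
      SimpleGraph.adj_comm (graph S) v y.1]
    split_ifs with h1 h2 h2
    · rw [hν]; field_simp
    · ring
    · exact absurd (mem_verts_of_adj h2) h1
    · ring
  have hone : ∀ y, ∀ w ∈ verts r S, weight ρ l μ r S y (w, true) =
      if (graph S).Adj y.1 w then ν * ρ * (1 + μ * bit y.2) else (n * ρ)⁻¹ * bit y.2 := by
    intro y w hw
    unfold weight
    simp only [bit_true, mul_one, bern, if_true, if_pos hw, SimpleGraph.adj_comm (graph S) w y.1]
    split_ifs
    · rw [← hνρ]; field_simp
    · field_simp
  refine ⟨weight_nonneg hρ0.le hρ1 hl.le hμ r S, hΔ, fun v w => mem_verts_of_adj, ?_, ?_, ?_, ?_,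
    ?_, ?_, by positivity, ?_, hδ, hνpos.le⟩
  · intro y v
    rw [hzero]
    split_ifs
    · nlinarith
    · exact hνpos.le
  · intro y v h
    rw [hzero] at h
    by_contra h2
    exact h (if_neg h2)
  · intro v y h
    by_contra h2
    refine h ?_
    unfold weight
    rw [if_neg (fun h3 : (graph S).Adj y.1 v => h2 h3.symm)]
    simp
  · intro y
    have h1 : ∀ v ∈ (verts r S)ᶜ, weight ρ l μ r S y (v, true) ≤ (n : ℝ)⁻¹ := by
      intro v hv
      have hv := Finset.mem_compl.1 hv
      unfold weight
      rw [if_neg hv, if_neg fun h2 => hv (mem_verts_of_adj h2.symm)]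
      have := bit_le_one y.2
      simp only [bern, if_true, bit_true, mul_one, one_mul]
      rw [show (n * ρ * l)⁻¹ * (ρ * (l * bit y.2)) = (n : ℝ)⁻¹ * bit y.2 by field_simp]
      exact mul_le_of_le_one_right (by positivity) this
    refine (Finset.sum_le_card_nsmul _ _ _ h1).trans ?_
    rw [nsmul_eq_mul, ← div_eq_mul_inv, div_le_one hn]
    exact_mod_cast (Finset.card_le_univ _).trans (by simp)
  · intro v
    have h1 : ∀ w ∈ verts r S, weight ρ l μ r S (v, true) (w, true) ≤
        (if (graph S).Adj v w then ν * (ρ * (1 + μ)) else 0) + (n * ρ)⁻¹ := by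
      intro w hw
      rw [hone _ w hw]
      simp only [bit_true, mul_one]
      have : 0 < (n * ρ)⁻¹ := by positivity
      split_ifs <;> linarith
    refine (Finset.sum_le_sum h1).trans ?_
    rw [Finset.sum_add_distrib, Finset.sum_const, hK, nsmul_eq_mul]
    refine add_le_add ((hsum v _ _ (by positivity)).trans (le_of_eq (by ring))) (le_of_eq ?_)
    push_cast
    rw [div_eq_mul_inv]
  · intro v
    have h1 : ∀ w ∈ verts r S, weight ρ l μ r S (v, false) (w, true) =
        (if (graph S).Adj v w then ν * ρ else 0) := by
      intro w hw
      rw [hone _ w hw]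
      simp
    rw [Finset.sum_congr rfl h1]
    exact (hsum v _ _ (by positivity)).trans (le_of_eq (by ring))
  · have h1 : 0 ≤ ((K : ℝ) + 1) / (n * ρ) := by positivity
    have h2 : 0 ≤ Δ * ν * ρ * μ := by positivity
    nlinarith

section

variable {n m s t : ℕ}

/-- The configurations of the blocks of a tree. -/
def treeConfig (H : Shape m (t + 1) s) (y : Pos m (t + 1) s → Fin n × Bool) (b : Bool) (k : Fin m) :
    Config (Fin n × Bool) (t + 1) s :=
  (H b k, fun o => y (b, k, o))

/-- The parent of a vertex of a tree, computed within its block. -/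
lemma state_par {r : Fin n} (τ : Pos m (t + 1) s → Fin n) (H : Shape m (t + 1) s)
    (x : Option (Pos m (t + 1) s) → Bool) (b : Bool) (k : Fin m)
    (o : Option (Fin (t + 1) × Fin s)) :
    (place r τ (par H (b, k, o)), x (par H (b, k, o))) =
      parentState (prev (r, x none)
        (fun k => (treeConfig H (fun i => (τ i, x (some i))) b k).2 none) k)
        (treeConfig H (fun i => (τ i, x (some i))) b k) o := by
  rcases o with _ | ⟨j, a⟩
  · simp only [par, parentState, prev, treeConfig]
    split_ifs <;> rfl
  · simp only [par, parentState, treeConfig]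
    split_ifs <;> rfl

lemma blockCovered_of_covered {r : Fin n} {τ : Pos m (t + 1) s → Fin n}
    (hτ : Function.Injective (place r τ)) {H : Shape m (t + 1) s} {S : Finset (Edge n)}
    {x : Option (Pos m (t + 1) s) → Bool} (hc : covered hτ H S x) (b : Bool) (k : Fin m) :
    blockCovered (graph S) (prev (r, x none)
        (fun k => (treeConfig H (fun i => (τ i, x (some i))) b k).2 none) k)
      (treeConfig H (fun i => (τ i, x (some i))) b k) := by
  intro hz
  refine ⟨fun o o' h => ?_, fun j a v hv => ?_⟩
  · have : (some (b, k, o) : Option (Pos m (t + 1) s)) = some (b, k, o') := hτ h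
    simpa using this
  · have h1 := hc (some (b, k, some (j, a))) (hz (some (j, a))) v hv
    rcases (adj_treeEdges_place hτ H).1 h1 with ⟨i, hi, h2⟩ | ⟨⟨b', k', o⟩, hi, h2⟩
    · left
      rw [h2, ← Option.some.inj hi]
      exact congrArg Prod.fst (state_par τ H x b k (some (j, a)))
    · right
      rcases o with _ | ⟨j', a'⟩
      · simp only [par] at hi
        split_ifs at hi with h0
        simp at hi
      · simp only [par] at hi
        split_ifs at hi with h0
        · simp at hi
        · simp only [Option.some.injEq, Prod.mk.injEq] at hi
          obtain ⟨rfl, rfl, h3, h4⟩ := hi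
          have h5 : j'.1 = j.1 + 1 := by
            have := congrArg Fin.val h3
            simp only at this
            omega
          have hj : j.1 + 1 < t + 1 := h5 ▸ j'.2
          have h6 : j' = ⟨j.1 + 1, hj⟩ := Fin.ext h5
          subst h6
          exact ⟨hj, a', h4, h2⟩

/-- A tree with labelled vertices amounts to the label of the root and the configurations of the
blocks. -/
def treeEquiv (n m t s : ℕ) :
    (Shape m (t + 1) s × (Pos m (t + 1) s → Fin n) × (Option (Pos m (t + 1) s) → Bool)) ≃
      (Bool × (Bool → Fin m → Config (Fin n × Bool) (t + 1) s)) where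
  toFun q := (q.2.2 none, treeConfig q.1 fun i => (q.2.1 i, q.2.2 (some i)))
  invFun q := (fun b k => (q.2 b k).1, fun i => ((q.2 i.1 i.2.1).2 i.2.2).1, fun o =>
    match o with
    | none => q.1
    | some i => ((q.2 i.1 i.2.1).2 i.2.2).2)
  left_inv q := by
    refine Prod.ext rfl (Prod.ext rfl (funext fun o => ?_))
    rcases o with _ | i <;> rfl
  right_inv q := rfl

lemma treeEquiv_apply (H : Shape m (t + 1) s) (τ : Pos m (t + 1) s → Fin n)
    (x : Option (Pos m (t + 1) s) → Bool) : treeEquiv n m t s (H, τ, x) =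
      (x none, treeConfig H fun i => (τ i, x (some i))) := rfl

set_option synthInstance.maxHeartbeats 400000 in
set_option synthInstance.maxSize 2000 in
open Classical in
/-- The second moment with a fixed tree `S`, summed over all trees. -/
lemma sum_expect_chi_le {ρ p₀ p₁ : ℝ} (hρ0 : 0 < ρ) (hρ1 : ρ ≤ 1) (h0 : 0 < p₀) (h1 : p₀ < 1)
    (hp : 0 ≤ p₁) (hp1 : p₁ ≤ 1) (hl : 0 < snr p₀ p₁) (r : Fin n) {S : Finset (Edge n)}
    (hS : S.card = Fintype.card (Pos m (t + 1) s))
    (hSv : (verts r S).card = Fintype.card (Pos m (t + 1) s) + 1) :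
    ∑ H : Shape m (t + 1) s, ∑ τ : Pos m (t + 1) s → Fin n,
      (if hτ : Function.Injective (place r τ) then
        expect n ρ p₀ p₁ (fun _ Y => chi p₀ S Y * chi p₀ (treeEdges hτ H) Y) else 0) ≤
      (ρ ^ (2 * Fintype.card (Pos m (t + 1) s) + 1) *
        snr p₀ p₁ ^ (2 * Fintype.card (Pos m (t + 1) s)) * n ^ Fintype.card (Pos m (t + 1) s)) *
        ∑ x : Bool, bern ρ x / ρ *
          chainSum s t (weight ρ (snr p₀ p₁) (max (excess p₀ p₁) 0) r S) (graph S) m (r, x) ^ 2 := by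
  set W := weight ρ (snr p₀ p₁) (max (excess p₀ p₁) 0) r S with hW
  have hW0 : ∀ y y', 0 ≤ W y y' := weight_nonneg hρ0.le hρ1 hl.le (le_max_right _ _) r S
  have hbw : ∀ (y : Fin n × Bool) (c : Config (Fin n × Bool) (t + 1) s),
      0 ≤ blockWeight W (graph S) y c := fun y c => by
    unfold blockWeight; split_ifs
    · exact blockProd_nonneg hW0 y c
    · exact le_rfl
  set base := ρ ^ (2 * Fintype.card (Pos m (t + 1) s) + 1) *
        snr p₀ p₁ ^ (2 * Fintype.card (Pos m (t + 1) s)) * n ^ Fintype.card (Pos m (t + 1) s)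
    with hbase
  have hbase0 : 0 ≤ base := by positivity
  set Φ : Bool × (Bool → Fin m → Config (Fin n × Bool) (t + 1) s) → ℝ := fun q =>
    bern ρ q.1 / ρ * ∏ b, ∏ k, blockWeight W (graph S)
      (prev (r, q.1) (fun k => (q.2 b k).2 none) k) (q.2 b k) with hΦ
  have hΦ0 : ∀ q, 0 ≤ Φ q := fun q => mul_nonneg (div_nonneg (bern_nonneg hρ0.le hρ1 _) hρ0.le)
    (Finset.prod_nonneg fun _ _ => Finset.prod_nonneg fun _ _ => hbw _ _)
  have hterm : ∀ (H : Shape m (t + 1) s) (τ : Pos m (t + 1) s → Fin n),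
      (if hτ : Function.Injective (place r τ) then
        expect n ρ p₀ p₁ (fun _ Y => chi p₀ S Y * chi p₀ (treeEdges hτ H) Y) else 0) ≤
      base * ∑ x : Option (Pos m (t + 1) s) → Bool, Φ (treeEquiv n m t s (H, τ, x)) := by
    intro H τ
    split_ifs with hτ
    · refine (expect_chi_mul_chi_le hρ0 hρ1 h0 h1 hp hp1 hl hτ H hS hSv).trans ?_
      refine mul_le_mul_of_nonneg_left (Finset.sum_le_sum fun x _ => ?_) hbase0
      split_ifs with hc
      · refine le_of_eq ?_
        rw [treeEquiv_apply, hΦ]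
        dsimp only
        congr 1
        rw [Fintype.prod_prod_type]
        refine Finset.prod_congr rfl fun b _ => ?_
        rw [Fintype.prod_prod_type]
        refine Finset.prod_congr rfl fun k _ => ?_
        rw [blockWeight, if_pos (blockCovered_of_covered hτ hc b k), blockProd]
        refine Finset.prod_congr rfl fun o _ => ?_
        rw [← state_par τ H x b k o]
        rfl
      · exact hΦ0 _
    · exact mul_nonneg hbase0 (Finset.sum_nonneg fun _ _ => hΦ0 _)
  refine (Finset.sum_le_sum fun H _ => Finset.sum_le_sum fun τ _ => hterm H τ).trans ?_
  simp only [← Finset.mul_sum]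
  refine mul_le_mul_of_nonneg_left (le_of_eq ?_) hbase0
  have e1 : ∑ H : Shape m (t + 1) s, ∑ τ : Pos m (t + 1) s → Fin n,
      ∑ x : Option (Pos m (t + 1) s) → Bool, Φ (treeEquiv n m t s (H, τ, x)) =
      ∑ q, Φ q := by
    rw [← Equiv.sum_comp (treeEquiv n m t s) Φ, Fintype.sum_prod_type]
    refine Finset.sum_congr rfl fun H _ => ?_
    rw [Fintype.sum_prod_type]
  rw [e1, Fintype.sum_prod_type]
  refine Finset.sum_congr rfl fun x _ => ?_
  rw [hΦ]
  simp only
  rw [← Finset.mul_sum]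
  congr 1
  rw [← Fintype.prod_sum (fun (_ : Bool) (c : Fin m → Config (Fin n × Bool) (t + 1) s) =>
    ∏ k, blockWeight W (graph S) (prev (r, x) (fun k => (c k).2 none) k) (c k))]
  rw [Finset.prod_const, Finset.card_univ, Fintype.card_bool, chainSum]

open Classical in
/-- The polynomial that sums the standardized edge variables over all placed trees. -/
def treePoly (n m t s : ℕ) (p₀ : ℝ) (r : Fin n) : MvPolynomial (Edge n) ℝ :=
  ∑ H : Shape m (t + 1) s, ∑ τ : Pos m (t + 1) s → Fin n,
    if hτ : Function.Injective (place r τ) then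
      ∏ e ∈ treeEdges hτ H, (MvPolynomial.C (Real.sqrt (p₀ * (1 - p₀)))⁻¹ *
        (MvPolynomial.X e - MvPolynomial.C p₀)) else 0

open Classical in
lemma evalAt_treePoly (p₀ : ℝ) (r : Fin n) (Y : Edge n → Bool) :
    evalAt (treePoly n m t s p₀ r) Y = ∑ H : Shape m (t + 1) s, ∑ τ : Pos m (t + 1) s → Fin n,
      if hτ : Function.Injective (place r τ) then chi p₀ (treeEdges hτ H) Y else 0 := by
  unfold evalAt treePoly
  rw [map_sum]
  refine Finset.sum_congr rfl fun H _ => ?_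
  rw [map_sum]
  refine Finset.sum_congr rfl fun τ _ => ?_
  split_ifs
  · rw [map_prod, chi]
    refine Finset.prod_congr rfl fun e _ => ?_
    simp only [map_mul, map_sub, MvPolynomial.eval_C, MvPolynomial.eval_X, stdBit]
    rw [div_eq_inv_mul]
  · simp

lemma totalDegree_treePoly_le (p₀ : ℝ) (r : Fin n) :
    (treePoly n m t s p₀ r).totalDegree ≤ Fintype.card (Pos m (t + 1) s) := by
  unfold treePoly
  refine MvPolynomial.totalDegree_finsetSum_le fun H _ =>
    MvPolynomial.totalDegree_finsetSum_le fun τ _ => ?_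
  split_ifs with hτ
  · refine (MvPolynomial.totalDegree_finsetProd _ _).trans ?_
    rw [← card_treeEdges hτ H, Finset.card_eq_sum_ones]
    refine Finset.sum_le_sum fun e _ => ?_
    refine (MvPolynomial.totalDegree_mul _ _).trans ?_
    rw [MvPolynomial.totalDegree_C, zero_add]
    refine (MvPolynomial.totalDegree_sub _ _).trans ?_
    simp [MvPolynomial.totalDegree_X]
  · simp

open Classical in
/-- Almost all placements of the positions are injective, if their number is small compared to
`√n`. -/
lemma card_placements_ge (m t s : ℕ) (r : Fin n) :
    (n : ℝ) ^ Fintype.card (Pos m (t + 1) s) *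
      (1 - (Fintype.card (Pos m (t + 1) s) : ℝ) ^ 2 / n) ≤
      ((Finset.univ.filter fun τ : Pos m (t + 1) s → Fin n =>
        Function.Injective (place r τ)).card : ℝ) := by
  set K := Fintype.card (Pos m (t + 1) s) with hK
  have hn : (0 : ℝ) < n := by exact_mod_cast r.pos
  have h1 : (n - K) ^ K ≤ (Finset.univ.filter fun τ : Pos m (t + 1) s → Fin n =>
        Function.Injective (place r τ)).card := by
    have h2 : Fintype.card (Pos m (t + 1) s ↪ {v : Fin n // v ≠ r}) = (n - 1).descFactorial K := by
      rw [Fintype.card_embedding_eq, ← hK, Fintype.card_subtype_compl, Fintype.card_fin,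
        Fintype.card_subtype_eq]
    have h3 := Nat.pow_sub_le_descFactorial (n - 1) K
    rw [Nat.sub_add_cancel r.pos, ← h2] at h3
    refine h3.trans ?_
    rw [← Finset.card_univ]
    refine Finset.card_le_card_of_injOn (fun f i => (f i).1) (fun f _ => ?_) ?_
    · refine Finset.mem_coe.2 (Finset.mem_filter.2 ⟨Finset.mem_univ _, ?_⟩)
      rintro (_ | i) (_ | i') h
      · rfl
      · exact absurd h.symm (f i').2
      · exact absurd h (f i).2
      · exact congrArg some (f.injective (Subtype.ext h))
    · intro f _ g _ h
      exact DFunLike.ext _ _ fun i => Subtype.ext (congrFun h i)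
  rcases le_or_gt n K with hle | hlt
  · have h4 : (n : ℝ) ≤ K := by exact_mod_cast hle
    have : 1 - (K : ℝ) ^ 2 / n ≤ 0 := by
      rw [sub_nonpos, one_le_div hn]
      have : (1 : ℝ) ≤ n := by exact_mod_cast r.pos
      nlinarith
    exact (mul_nonpos_of_nonneg_of_nonpos (by positivity) this).trans (Nat.cast_nonneg _)
  · have h4 : (K : ℝ) ≤ n := by exact_mod_cast hlt.le
    refine le_trans ?_ (Nat.cast_le.2 h1)
    rw [Nat.cast_pow, Nat.cast_sub hlt.le]
    have h5 : ((n : ℝ) - K) ^ K = (n : ℝ) ^ K * (1 + -(K / n)) ^ K := by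
      rw [← mul_pow]
      congr 1
      field_simp
      ring
    rw [h5]
    refine mul_le_mul_of_nonneg_left ?_ (by positivity)
    have h6 : (K : ℝ) / n ≤ 1 := (div_le_one hn).2 h4
    refine le_trans (le_of_eq ?_) (one_add_mul_le_pow (a := -((K : ℝ) / n)) (by linarith) K)
    field_simp
    ring

/-- The exponents are for the `t + 1` levels, the `m` blocks and the two branches. -/
lemma card_shape : (Fintype.card (Shape m (t + 1) s) : ℝ) =
    ((((s : ℝ) ^ s) ^ (t + 1)) ^ m) ^ 2 := by
  simp [Shape]

/-- The correlation of the tree polynomial with the target is bounded below by the second moment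
method: the denominator is the bound on the second moment in units of the squared first moment, with
one term for the root inside and one for the root outside the community. -/
lemma corr_ge {ρ p₀ p₁ : ℝ} {D : ℕ} (hn : 0 < n) (hs : 0 < s) (hρ0 : 0 < ρ) (hρ1 : ρ ≤ 1)
    (h0 : 0 < p₀) (h1 : p₀ < 1) (h01 : p₀ ≤ p₁) (hp1 : p₁ ≤ 1) (hl : 0 < snr p₀ p₁)
    (hD : Fintype.card (Pos m (t + 1) s) ≤ D) {ν δ B q : ℝ}
    (hν : ν = (n * ρ ^ 2 * snr p₀ p₁ ^ 2)⁻¹)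
    (hδ : δ = (s + 2 : ℕ) * ν * (ρ * (1 + max (excess p₀ p₁) 0)) +
      (Fintype.card (Pos m (t + 1) s) + 1) / (n * ρ)) (hδ1 : δ ≤ 1)
    (hB : B = blockConst s t (s + 2) ν) (hqdef : q = zeroBlockBound s t (s + 2) ν)
    (hq : q ≤ 1 / 2)
    (hη : 6 * ((s + 2 : ℕ) * ν * ρ) * B ≤ 1 / 2)
    (hδm : 3 * δ * B * m ≤ 1 / 2)
    (hK : (Fintype.card (Pos m (t + 1) s) : ℝ) ^ 2 / n < 1) :
    Real.sqrt ((1 - (Fintype.card (Pos m (t + 1) s) : ℝ) ^ 2 / n) /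
      ((1 + 3 * δ * B * m + q ^ m + 6 * ((s + 2 : ℕ) * ν * ρ) * B) ^ 2 +
        (q ^ m + 6 * ((s + 2 : ℕ) * ν * ρ) * B) ^ 2 / ρ)) ≤ corr n D ρ p₀ p₁ := by
  classical
  set r : Fin n := ⟨0, hn⟩ with hr
  set K := Fintype.card (Pos m (t + 1) s) with hKdef
  set l := snr p₀ p₁ with hldef
  set η : ℝ := (s + 2 : ℕ) * ν * ρ with hηdef
  set Q : ℝ := (1 + 3 * δ * B * m + q ^ m + 6 * η * B) ^ 2 + (q ^ m + 6 * η * B) ^ 2 / ρ with hQ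
  set Sh : ℝ := ((Fintype.card (Shape m (t + 1) s) : ℕ) : ℝ) with hSh
  set P : ℝ := ((Finset.univ.filter fun τ : Pos m (t + 1) s → Fin n =>
        Function.Injective (place r τ)).card : ℝ) with hP
  have hn' : (0 : ℝ) < n := by exact_mod_cast hn
  have hs' : (0 : ℝ) < s := by exact_mod_cast hs
  have hνpos : 0 < ν := by rw [hν]; positivity
  have hB0 : 0 ≤ B := by rw [hB]; unfold blockConst; positivity
  have hq0 : 0 ≤ q := by rw [hqdef]; unfold zeroBlockBound; positivity
  have hη0 : 0 < η := by rw [hηdef]; positivity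
  have hδ0 : 0 ≤ δ := by
    have : 0 ≤ max (excess p₀ p₁) 0 := le_max_right _ _
    rw [hδ]; positivity
  have hQ0 : 0 < Q := by rw [hQ]; positivity
  have hSh0 : 0 < Sh := by rw [hSh, card_shape]; positivity
  have hPge := card_placements_ge m t s r
  rw [← hKdef, ← hP] at hPge
  have hP0 : 0 < P := lt_of_lt_of_le (by have := sub_pos.2 hK; positivity) hPge
  set f := treePoly n m t s p₀ r with hf
  -- the first moment
  have hmean : expect n ρ p₀ p₁ (fun θ Y => evalAt f Y * target n θ) =
      Sh * P * (l ^ K * ρ ^ (K + 1)) := by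
    have e1 : ∀ (θ : Fin n → Bool) (Y : Edge n → Bool), evalAt f Y * target n θ =
        ∑ H : Shape m (t + 1) s, ∑ τ : Pos m (t + 1) s → Fin n,
          (if hτ : Function.Injective (place r τ) then bit (θ r) * chi p₀ (treeEdges hτ H) Y
            else 0) := by
      intro θ Y
      rw [hf, evalAt_treePoly, target, dif_pos hn, Finset.sum_mul]
      refine Finset.sum_congr rfl fun H _ => ?_
      rw [Finset.sum_mul]
      refine Finset.sum_congr rfl fun τ _ => ?_
      split_ifs
      · rw [mul_comm]
      · ring
    rw [funext fun θ => funext fun Y => e1 θ Y, expect_sum]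
    have e2 : ∀ H : Shape m (t + 1) s, expect n ρ p₀ p₁ (fun θ Y =>
        ∑ τ : Pos m (t + 1) s → Fin n,
          (if hτ : Function.Injective (place r τ) then bit (θ r) * chi p₀ (treeEdges hτ H) Y
            else 0)) = P * (l ^ K * ρ ^ (K + 1)) := by
      intro H
      rw [expect_sum]
      have e3 : ∀ τ : Pos m (t + 1) s → Fin n, expect n ρ p₀ p₁ (fun θ Y =>
          (if hτ : Function.Injective (place r τ) then bit (θ r) * chi p₀ (treeEdges hτ H) Y
            else 0)) = if Function.Injective (place r τ) then l ^ K * ρ ^ (K + 1) else 0 := by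
        intro τ
        by_cases hτ : Function.Injective (place r τ)
        · simp only [dif_pos hτ, if_pos hτ]
          rw [expect_target_mul_chi h0 h1, card_treeEdges, card_verts_treeEdges]
        · simp [hτ, expect]
      rw [Finset.sum_congr rfl fun τ _ => e3 τ, ← Finset.sum_filter, Finset.sum_const,
        nsmul_eq_mul]
    rw [Finset.sum_congr rfl fun H _ => e2 H, Finset.sum_const, nsmul_eq_mul, Finset.card_univ,
      mul_assoc]
  -- the second moment
  have hsecond : expect n ρ p₀ p₁ (fun _ Y => evalAt f Y ^ 2) ≤
      Sh * P * (ρ ^ (2 * K + 1) * l ^ (2 * K) * n ^ K * (Sh * Q)) := by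
    have hfix : ∀ (H' : Shape m (t + 1) s) (τ' : Pos m (t + 1) s → Fin n)
        (hτ' : Function.Injective (place r τ')),
        expect n ρ p₀ p₁ (fun _ Y => chi p₀ (treeEdges hτ' H') Y * evalAt f Y) ≤
          ρ ^ (2 * K + 1) * l ^ (2 * K) * n ^ K * (Sh * Q) := by
      intro H' τ' hτ'
      set S := treeEdges hτ' H' with hS
      have hSc : S.card = K := card_treeEdges hτ' H'
      have hSv : (verts r S).card = K + 1 := card_verts_treeEdges hτ' H'
      have e1 : expect n ρ p₀ p₁ (fun _ Y => chi p₀ S Y * evalAt f Y) =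
          ∑ H : Shape m (t + 1) s, ∑ τ : Pos m (t + 1) s → Fin n,
            (if hτ : Function.Injective (place r τ) then
              expect n ρ p₀ p₁ (fun _ Y => chi p₀ S Y * chi p₀ (treeEdges hτ H) Y) else 0) := by
        have e2 : ∀ Y : Edge n → Bool, chi p₀ S Y * evalAt f Y =
            ∑ H : Shape m (t + 1) s, ∑ τ : Pos m (t + 1) s → Fin n,
              (if hτ : Function.Injective (place r τ) then
                chi p₀ S Y * chi p₀ (treeEdges hτ H) Y else 0) := by
          intro Y
          rw [hf, evalAt_treePoly, Finset.mul_sum]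
          refine Finset.sum_congr rfl fun H _ => ?_
          rw [Finset.mul_sum]
          refine Finset.sum_congr rfl fun τ _ => ?_
          split_ifs
          · rfl
          · ring
        rw [funext fun _ => funext fun Y => e2 Y, expect_sum]
        refine Finset.sum_congr rfl fun H _ => ?_
        rw [expect_sum]
        refine Finset.sum_congr rfl fun τ _ => ?_
        split_ifs with hτ
        · rfl
        · simp [expect]
      rw [e1]
      refine (sum_expect_chi_le hρ0 hρ1 h0 h1 (h0.le.trans h01) hp1 hl r hSc hSv).trans ?_
      refine mul_le_mul_of_nonneg_left ?_ (by positivity)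
      have hW := kernelBound_weight hρ0 hρ1 hl (le_max_right (excess p₀ p₁) 0) r
        (Nat.succ_pos (s + 1)) (degree_treeEdges_le hτ' H' hs) hSv hν (by rw [← hδ]; exact hδ1)
      rw [← hδ] at hW
      have hch := chainSum_le (t := t) hs hW (by rw [← hqdef]; exact hq)
        (by rw [← hB]; exact hη) m (by rw [← hB]; exact hδm)
      rw [← hqdef, ← hB] at hch
      have hc0 : ∀ y, 0 ≤ chainSum s t
          (weight ρ l (max (excess p₀ p₁) 0) r S) (graph S) m y := fun y =>
        Finset.sum_nonneg fun _ _ => Finset.prod_nonneg fun _ _ => blockWeight_nonneg hW _ _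
      have hNN : 0 ≤ (((s : ℝ) ^ s) ^ (t + 1)) ^ m := by positivity
      rw [Fintype.sum_bool, hSh, card_shape, hQ]
      have ht := pow_le_pow_left₀ (hc0 _) (hch.2.2 r) 2
      have hf := pow_le_pow_left₀ (hc0 _) (hch.2.1 r) 2
      rw [mul_pow] at ht hf
      have hbt : bern ρ true / ρ = 1 := div_self hρ0.ne'
      have hbf : bern ρ false / ρ ≤ 1 / ρ := by
        simp only [bern, Bool.false_eq_true, if_false]
        gcongr
        linarith
      rw [hbt, one_mul, mul_add]
      refine add_le_add ht ?_
      calc _ ≤ 1 / ρ * (((((s : ℝ) ^ s) ^ (t + 1)) ^ m) ^ 2 * (q ^ m + 6 * η * B) ^ 2) :=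
            mul_le_mul hbf hf (sq_nonneg _) (by positivity)
        _ = _ := by ring
    have e1 : ∀ Y : Edge n → Bool, evalAt f Y ^ 2 =
        ∑ H : Shape m (t + 1) s, ∑ τ : Pos m (t + 1) s → Fin n,
          (if hτ : Function.Injective (place r τ) then
            chi p₀ (treeEdges hτ H) Y * evalAt f Y else 0) := by
      intro Y
      rw [pow_two]
      nth_rewrite 1 [hf]
      rw [evalAt_treePoly, Finset.sum_mul]
      refine Finset.sum_congr rfl fun H _ => ?_
      rw [Finset.sum_mul]
      refine Finset.sum_congr rfl fun τ _ => ?_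
      split_ifs
      · rfl
      · ring
    rw [funext fun _ => funext fun Y => e1 Y, expect_sum]
    set R := ρ ^ (2 * K + 1) * l ^ (2 * K) * n ^ K * (Sh * Q) with hR
    have e2 : ∀ H : Shape m (t + 1) s, expect n ρ p₀ p₁ (fun _ Y =>
        ∑ τ : Pos m (t + 1) s → Fin n, (if hτ : Function.Injective (place r τ) then
            chi p₀ (treeEdges hτ H) Y * evalAt f Y else 0)) ≤ P * R := by
      intro H
      rw [expect_sum]
      have e3 : ∀ τ : Pos m (t + 1) s → Fin n, expect n ρ p₀ p₁ (fun _ Y =>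
          (if hτ : Function.Injective (place r τ) then
            chi p₀ (treeEdges hτ H) Y * evalAt f Y else 0)) ≤
          if Function.Injective (place r τ) then R else 0 := by
        intro τ
        by_cases hτ : Function.Injective (place r τ)
        · simp only [dif_pos hτ, if_pos hτ]
          exact hfix H τ hτ
        · simp [hτ, expect]
      refine (Finset.sum_le_sum fun τ _ => e3 τ).trans (le_of_eq ?_)
      rw [← Finset.sum_filter, Finset.sum_const, nsmul_eq_mul]
    refine (Finset.sum_le_sum fun H _ => e2 H).trans (le_of_eq ?_)
    rw [Finset.sum_const, nsmul_eq_mul, Finset.card_univ, mul_assoc]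
  have htarget := expect_target_sq (ρ := ρ) (p₁ := p₁) h0 h1 hn
  have hmean0 : 0 < Sh * P * (l ^ K * ρ ^ (K + 1)) := by positivity
  have hpos : 0 < expect n ρ p₀ p₁ (fun _ Y => evalAt f Y ^ 2) := by
    have hcs := expect_mul_sq_le hρ0.le hρ1 h0.le h01 hp1 (fun _ Y => evalAt f Y)
      (fun θ _ => target n θ)
    rw [hmean, htarget] at hcs
    have h5 : 0 < (Sh * P * (l ^ K * ρ ^ (K + 1))) ^ 2 := by positivity
    by_contra hcon
    have := mul_nonpos_of_nonpos_of_nonneg (not_lt.1 hcon) hρ0.le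
    linarith
  refine le_trans ?_ ((isLUB_corr hρ0.le hρ1 h0.le h01 hp1).1
    ⟨f, (totalDegree_treePoly_le p₀ r).trans hD, hpos, rfl⟩)
  rw [hmean, htarget, Real.sqrt_le_iff]
  refine ⟨div_nonneg hmean0.le (Real.sqrt_nonneg _), ?_⟩
  rw [div_pow, Real.sq_sqrt (mul_pos hpos hρ0).le, div_le_div_iff₀ hQ0 (mul_pos hpos hρ0)]
  have hK0 : 0 ≤ 1 - (K : ℝ) ^ 2 / n := (sub_pos.2 hK).le
  calc (1 - (K : ℝ) ^ 2 / n) * (expect n ρ p₀ p₁ (fun _ Y => evalAt f Y ^ 2) * ρ)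
      ≤ (1 - (K : ℝ) ^ 2 / n) *
        ((Sh * P * (ρ ^ (2 * K + 1) * l ^ (2 * K) * n ^ K * (Sh * Q))) * ρ) := by gcongr
    _ = (n ^ K * (1 - (K : ℝ) ^ 2 / n)) * (Sh ^ 2 * P * (ρ ^ (K + 1) * l ^ K) ^ 2 * Q) := by
        ring
    _ ≤ P * (Sh ^ 2 * P * (ρ ^ (K + 1) * l ^ K) ^ 2 * Q) := by gcongr
    _ = _ := by ring

end

/-! ### Success above the threshold -/

/-- By Stirling's formula `s! / s ^ s` decays like `e ^ (-s)`, up to a power of `s`. -/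
lemma tendsto_pow_mul_factorial_div {ν : ℝ} (h0 : 0 < ν) (h1 : ν < Real.exp 1) :
    Tendsto (fun s : ℕ => ν ^ s * (s.factorial / (s : ℝ) ^ s)) atTop (𝓝 0) := by
  refine (summable_of_ratio_test_tendsto_lt_one (l := ν / Real.exp 1)
    ((div_lt_one (Real.exp_pos 1)).2 h1) ?_ ?_).tendsto_atTop_zero
  · filter_upwards [eventually_gt_atTop 0] with s hs
    have : (0 : ℝ) < s := by exact_mod_cast hs
    positivity
  · have h2 := (tendsto_const_nhds (x := ν)).div (Real.tendsto_one_add_div_pow_exp 1)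
      (Real.exp_pos 1).ne'
    refine h2.congr' ?_
    filter_upwards [eventually_gt_atTop 0] with s hs
    have hs' : (0 : ℝ) < s := by exact_mod_cast hs
    rw [Real.norm_of_nonneg (by positivity), Real.norm_of_nonneg (by positivity),
      Nat.factorial_succ, Pi.div_apply, show (1 : ℝ) + 1 / s = (s + 1) / s by field_simp, div_pow]
    push_cast
    field_simp
    ring

/-- For `ν < e` the weight of the blocks outside the community can be made small. -/
lemma exists_zeroBlockBound_le {ν : ℝ} (h0 : 0 < ν) (h1 : ν < Real.exp 1) :
    ∃ s t : ℕ, 0 < s ∧ zeroBlockBound s t (s + 2) ν ≤ Real.exp (-1) := by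
  obtain ⟨s, hs, hs0⟩ := (((tendsto_pow_mul_factorial_div h0 h1).eventually
    (gt_mem_nhds one_half_pos)).and (eventually_gt_atTop 0)).exists
  have h2 : Tendsto (fun t : ℕ => ((s + 2 : ℕ) : ℝ) ^ (s + 1) * ν ^ (s + 1) *
      (ν ^ s * (s.factorial / (s : ℝ) ^ s)) ^ t) atTop (𝓝 0) := by
    simpa using (tendsto_pow_atTop_nhds_zero_of_lt_one (by positivity)
      (hs.trans one_half_lt_one)).const_mul (((s + 2 : ℕ) : ℝ) ^ (s + 1) * ν ^ (s + 1))
  obtain ⟨t, ht⟩ := (h2.eventually (gt_mem_nhds (Real.exp_pos (-1)))).exists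
  refine ⟨s, t, hs0, le_trans (le_of_eq ?_) ht.le⟩
  unfold zeroBlockBound
  rw [mul_pow, ← pow_mul, show (t + 1) * s + 1 = (s + 1) + s * t by ring, pow_add]
  ring

lemma zeroBlockBound_mono {s t Δ : ℕ} {ν ν' : ℝ} (h0 : 0 ≤ ν) (h : ν ≤ ν') :
    zeroBlockBound s t Δ ν ≤ zeroBlockBound s t Δ ν' := by
  unfold zeroBlockBound
  gcongr

lemma blockConst_mono {s t Δ : ℕ} {ν ν' : ℝ} (h0 : 0 ≤ ν) (h : ν ≤ ν') :
    blockConst s t Δ ν ≤ blockConst s t Δ ν' := by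
  have h1 := h0.trans h
  unfold blockConst
  gcongr

lemma corr_le_one {n D : ℕ} {ρ p₀ p₁ : ℝ} (hρ0 : 0 ≤ ρ) (hρ1 : ρ ≤ 1) (h0 : 0 ≤ p₀)
    (h01 : p₀ ≤ p₁) (h1 : p₁ ≤ 1) : corr n D ρ p₀ p₁ ≤ 1 := by
  refine (isLUB_corr hρ0 hρ1 h0 h01 h1).2 ?_
  rintro _ ⟨f, -, -, rfl⟩
  refine div_le_one_of_le₀ (Real.le_sqrt_of_sq_le ?_) (Real.sqrt_nonneg _)
  exact expect_mul_sq_le hρ0 hρ1 h0 h01 h1 (fun _ Y => evalAt f Y) (fun θ _ => target n θ)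

section

variable {n : ℕ} {ε ρ l : ℝ}

lemma snr_pos_of_ge (hn : 0 < n) (hε : 0 < ε) (hρ : 0 < ρ)
    (h : (1 + ε) * (ρ * Real.sqrt (Real.exp 1 * n))⁻¹ ≤ l) : 0 < l := by
  have hn' : (0 : ℝ) < n := by exact_mod_cast hn
  exact lt_of_lt_of_le (by positivity) h

lemma inv_snr_sq_le (hn : 0 < n) (hε : 0 < ε) (hρ : 0 < ρ)
    (h : (1 + ε) * (ρ * Real.sqrt (Real.exp 1 * n))⁻¹ ≤ l) :
    (n * ρ ^ 2 * l ^ 2)⁻¹ ≤ Real.exp 1 / (1 + ε) ^ 2 := by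
  have hn' : (0 : ℝ) < n := by exact_mod_cast hn
  have hl := snr_pos_of_ge hn hε hρ h
  have h2 := pow_le_pow_left₀ (by positivity) h 2
  rw [mul_pow, inv_pow, mul_pow, Real.sq_sqrt (by positivity), ← div_eq_mul_inv,
    div_le_iff₀ (by positivity)] at h2
  rw [inv_le_comm₀ (by positivity) (by positivity), inv_div, div_le_iff₀ (Real.exp_pos 1)]
  linarith

/-- The excess variance is harmless as soon as `n p₀` is large. -/
lemma mul_excess_le {p₀ p₁ L : ℝ} (hn : 0 < n) (hε : 0 < ε) (hρ : 0 < ρ) (h0 : 0 < p₀)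
    (h1 : p₀ < 1) (hL : 0 < L)
    (h : (1 + ε) * (ρ * Real.sqrt (Real.exp 1 * n))⁻¹ ≤ snr p₀ p₁)
    (hp : (n : ℝ)⁻¹ * L ^ 24 ≤ p₀) :
    (n * ρ ^ 2 * snr p₀ p₁ ^ 2)⁻¹ * (ρ * max (excess p₀ p₁) 0) ≤ 3 / L ^ 12 := by
  have hn' : (0 : ℝ) < n := by exact_mod_cast hn
  have hl := snr_pos_of_ge hn hε hρ h
  have hw : 0 < p₀ * (1 - p₀) := mul_pos h0 (sub_pos.2 h1)
  have hsw := Real.sqrt_pos.2 hw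
  have hex : excess p₀ p₁ = snr p₀ p₁ * (1 - 2 * p₀) / Real.sqrt (p₀ * (1 - p₀)) := by
    unfold excess snr
    rw [div_mul_eq_mul_div, div_div, Real.mul_self_sqrt hw.le]
  rcases le_or_gt (1 / 2) p₀ with h2 | h2
  · -- for `p₀ ≥ 1 / 2` the variance is smaller inside the community
    have : excess p₀ p₁ ≤ 0 := by
      rw [hex]
      exact div_nonpos_of_nonpos_of_nonneg
        (mul_nonpos_of_nonneg_of_nonpos hl.le (by linarith)) hsw.le
    rw [max_eq_right this]
    simp only [mul_zero]
    positivity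
  · set l := snr p₀ p₁
    set w := p₀ * (1 - p₀)
    have h3 : max (excess p₀ p₁) 0 ≤ l / Real.sqrt w := by
      refine max_le ?_ (by positivity)
      rw [hex]
      gcongr
      exact mul_le_of_le_one_right hl.le (by linarith)
    have h4 : 1 ≤ ρ * l * Real.sqrt (Real.exp 1 * n) := by
      rw [← div_eq_mul_inv, div_le_iff₀ (by positivity)] at h
      linarith
    have h5 : L ^ 24 ≤ 2 * (n * w) := by
      rw [inv_mul_le_iff₀ hn'] at hp
      have : p₀ ≤ 2 * w := by simp only [w]; nlinarith
      calc L ^ 24 ≤ n * p₀ := hp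
        _ ≤ n * (2 * w) := by gcongr
        _ = _ := by ring
    have h6 : L ^ 12 * Real.sqrt (Real.exp 1 * n) ≤ 3 * n * Real.sqrt w := by
      rw [← pow_le_pow_iff_left₀ (by positivity) (by positivity) two_ne_zero, mul_pow, mul_pow,
        Real.sq_sqrt (by positivity), Real.sq_sqrt hw.le]
      have he : Real.exp 1 ≤ 3 := by linarith [Real.exp_one_lt_d9]
      calc (L ^ 12) ^ 2 * (Real.exp 1 * n) = L ^ 24 * (Real.exp 1 * n) := by ring
        _ ≤ 2 * (n * w) * (3 * n) := by gcongr
        _ ≤ _ := by nlinarith [mul_pos (mul_pos hn' hn') hw]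
    calc (n * ρ ^ 2 * l ^ 2)⁻¹ * (ρ * max (excess p₀ p₁) 0)
        ≤ (n * ρ ^ 2 * l ^ 2)⁻¹ * (ρ * (l / Real.sqrt w)) := by gcongr
      _ = (n * (ρ * l) * Real.sqrt w)⁻¹ := by field_simp
      _ ≤ 3 / L ^ 12 := by
          rw [inv_le_iff_one_le_mul₀ (by positivity), div_mul_eq_mul_div,
            le_div_iff₀ (by positivity), one_mul]
          calc L ^ 12 ≤ L ^ 12 * (ρ * l * Real.sqrt (Real.exp 1 * n)) :=
                le_mul_of_one_le_right (by positivity) h4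
            _ = L ^ 12 * Real.sqrt (Real.exp 1 * n) * (ρ * l) := by ring
            _ ≤ 3 * n * Real.sqrt w * (ρ * l) := by gcongr
            _ = _ := by ring

end

lemma tendsto_log_natCast_atTop : Tendsto (fun n : ℕ => Real.log n) atTop atTop :=
  Real.tendsto_log_atTop.comp tendsto_natCast_atTop_atTop

/-- Above the threshold, polynomials of logarithmic degree estimate the target perfectly. -/
theorem exists_corr_tendsto_one {ε : ℝ} (hε : 0 < ε) :
    ∃ C₀ : ℝ, ∀ C, C₀ ≤ C → ∀ ρ p₀ p₁ : ℕ → ℝ,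
      (∀ n, 0 ≤ ρ n ∧ ρ n ≤ 1) →
      (∀ n, 0 < p₀ n ∧ p₀ n < 1 ∧ p₀ n ≤ p₁ n ∧ p₁ n ≤ 1) →
      (∀ᶠ n : ℕ in atTop,
        (1 + ε) * (ρ n * Real.sqrt (Real.exp 1 * n))⁻¹ ≤ snr (p₀ n) (p₁ n)) →
      (fun n : ℕ => (n : ℝ)⁻¹ * Real.log n ^ 12) =o[atTop] ρ →
      ρ =o[atTop] (fun n : ℕ => (Real.log n ^ 12)⁻¹) →
      (fun n : ℕ => (n : ℝ)⁻¹ * Real.log n ^ 24) =o[atTop] p₀ →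
      Tendsto (fun n : ℕ => corr n ⌊C * Real.log n⌋₊ (ρ n) (p₀ n) (p₁ n)) atTop (𝓝 1) := by
  set N : ℝ := Real.exp 1 / (1 + ε) ^ 2 with hN
  have hN0 : 0 < N := by positivity
  have hN1 : N < Real.exp 1 := div_lt_self (Real.exp_pos 1) (one_lt_pow₀ (by linarith) two_ne_zero)
  obtain ⟨s, t, hs, hst⟩ := exists_zeroBlockBound_le hN0 hN1
  set κ : ℕ := (t + 1) * s + 1 with hκ
  refine ⟨4 * κ, fun C hC ρ p₀ p₁ hρ hp hsnr hρlow hρup hplow => ?_⟩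
  -- the parameters of the tree and the quantities in the bound on its correlation
  set m : ℕ → ℕ := fun n => ⌈Real.log n⌉₊ with hm
  set K : ℕ → ℕ := fun n => Fintype.card (Pos (m n) (t + 1) s) with hK
  have hKm : ∀ n, (K n : ℝ) = 2 * (m n * κ) := by
    intro n
    simp [hK, Pos, hκ]
  set ν : ℕ → ℝ := fun n => (n * ρ n ^ 2 * snr (p₀ n) (p₁ n) ^ 2)⁻¹ with hν
  set Δ : ℝ := ((s + 2 : ℕ) : ℝ) with hΔ
  set δ : ℕ → ℝ := fun n => Δ * ν n * (ρ n * (1 + max (excess (p₀ n) (p₁ n)) 0)) +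
    (K n + 1) / (n * ρ n) with hδ
  set B : ℕ → ℝ := fun n => blockConst s t (s + 2) (ν n) with hB
  set q : ℕ → ℝ := fun n => zeroBlockBound s t (s + 2) (ν n) with hq
  set M : ℝ := blockConst s t (s + 2) N with hM
  have hM0 : 0 ≤ M := by rw [hM]; unfold blockConst; positivity
  have hΔ0 : 0 < Δ := by rw [hΔ]; positivity
  -- the assumptions, for large `n`
  have hev : ∀ᶠ n : ℕ in atTop, 0 < n ∧ 1 ≤ Real.log n ∧ 0 < ρ n ∧
      (n * ρ n)⁻¹ ≤ (Real.log n ^ 12)⁻¹ ∧ ρ n ≤ (Real.log n ^ 12)⁻¹ ∧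
      (n : ℝ)⁻¹ * Real.log n ^ 24 ≤ p₀ n ∧
      (1 + ε) * (ρ n * Real.sqrt (Real.exp 1 * n))⁻¹ ≤ snr (p₀ n) (p₁ n) := by
    filter_upwards [eventually_gt_atTop 0, tendsto_log_natCast_atTop.eventually_ge_atTop 1, hsnr,
      hρlow.bound one_pos, hρup.bound one_pos, hplow.bound one_pos] with n hn hL h1 h2 h3 h4
    have hn' : (0 : ℝ) < n := by exact_mod_cast hn
    have hL0 : 0 < Real.log n := by linarith
    rw [Real.norm_of_nonneg (by positivity), Real.norm_of_nonneg (hρ n).1, one_mul] at h2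
    rw [Real.norm_of_nonneg (hρ n).1, Real.norm_of_nonneg (by positivity), one_mul] at h3
    rw [Real.norm_of_nonneg (by positivity), Real.norm_of_nonneg (hp n).1.le, one_mul] at h4
    have hρ0 : 0 < ρ n := lt_of_lt_of_le (by positivity) h2
    refine ⟨hn, hL, hρ0, ?_, h3, h4, h1⟩
    rw [inv_le_inv₀ (by positivity) (by positivity)]
    rwa [inv_mul_le_iff₀ hn'] at h2
  -- bounds in terms of `n` and `log n` on all quantities
  have hbd : ∀ᶠ n : ℕ in atTop, 0 < n ∧ 1 ≤ Real.log n ∧ 0 < ρ n ∧ 0 < snr (p₀ n) (p₁ n) ∧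
      0 < ν n ∧ ν n ≤ N ∧ ρ n ≤ (Real.log n)⁻¹ ∧ (m n : ℝ) ≤ 2 * Real.log n ∧ 0 ≤ δ n ∧
      δ n ≤ (Δ * (N + 3) + (4 * κ + 1)) * (Real.log n ^ 11)⁻¹ ∧ 0 ≤ B n ∧ B n ≤ M ∧ 0 ≤ q n ∧
      q n ≤ Real.exp (-1) ∧ q n ^ m n ≤ (n : ℝ)⁻¹ ∧ (n * ρ n)⁻¹ ≤ 1 := by
    filter_upwards [hev] with n ⟨hn, hL, hρ0, h1, h2, h3, h4⟩
    have hn' : (0 : ℝ) < n := by exact_mod_cast hn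
    have hL0 : 0 < Real.log n := by linarith
    have hl := snr_pos_of_ge hn hε hρ0 h4
    have hν0 : 0 < ν n := by simp only [hν]; positivity
    have hνN : ν n ≤ N := inv_snr_sq_le hn hε hρ0 h4
    have hmL : (m n : ℝ) ≤ 2 * Real.log n := by
      have := (Nat.ceil_lt_add_one hL0.le).le
      simp only [hm]; linarith
    have hq0 : 0 ≤ q n := by simp only [hq, zeroBlockBound]; positivity
    have hqe : q n ≤ Real.exp (-1) := (zeroBlockBound_mono hν0.le hνN).trans hst
    have hpow : (Real.log n ^ 12)⁻¹ ≤ (Real.log n)⁻¹ := by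
      rw [inv_le_inv₀ (by positivity) hL0]
      exact le_self_pow₀ hL (by norm_num)
    refine ⟨hn, hL, hρ0, hl, hν0, hνN, h2.trans hpow, hmL, ?_, ?_, ?_,
      blockConst_mono hν0.le hνN, hq0, hqe, ?_, h1.trans ?_⟩
    · have : 0 ≤ max (excess (p₀ n) (p₁ n)) 0 := le_max_right _ _
      simp only [hδ]; positivity
    · have h5 := mul_excess_le hn hε hρ0 (hp n).1 (hp n).2.1 hL0 h4 h3
      have h6 : (Real.log n ^ 12)⁻¹ ≤ (Real.log n ^ 11)⁻¹ := by
        rw [inv_le_inv₀ (by positivity) (by positivity)]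
        exact pow_le_pow_right₀ hL (by norm_num)
      have h7 : ν n * ρ n ≤ N * (Real.log n ^ 11)⁻¹ := by
        have := h2.trans h6
        gcongr
      have h8 : ν n * (ρ n * max (excess (p₀ n) (p₁ n)) 0) ≤ 3 * (Real.log n ^ 11)⁻¹ := by
        refine h5.trans ?_
        rw [div_eq_mul_inv]
        gcongr
      have h9 : ((K n : ℝ) + 1) / (n * ρ n) ≤ (4 * κ + 1) * (Real.log n ^ 11)⁻¹ := by
        have h10 : (K n : ℝ) + 1 ≤ (4 * κ + 1) * Real.log n := by
          rw [hKm]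
          nlinarith [mul_le_mul_of_nonneg_right hmL (Nat.cast_nonneg (α := ℝ) κ)]
        rw [div_eq_mul_inv]
        calc ((K n : ℝ) + 1) * (n * ρ n)⁻¹
            ≤ (4 * κ + 1) * Real.log n * (Real.log n ^ 12)⁻¹ := by gcongr
          _ = _ := by field_simp
      calc δ n = Δ * (ν n * ρ n + ν n * (ρ n * max (excess (p₀ n) (p₁ n)) 0)) +
            ((K n : ℝ) + 1) / (n * ρ n) := by simp only [hδ]; ring
        _ ≤ Δ * (N * (Real.log n ^ 11)⁻¹ + 3 * (Real.log n ^ 11)⁻¹) +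
            (4 * κ + 1) * (Real.log n ^ 11)⁻¹ := by gcongr
        _ = _ := by ring
    · simp only [hB, blockConst]; positivity
    · calc q n ^ m n ≤ Real.exp (-1) ^ m n := pow_le_pow_left₀ hq0 hqe _
        _ = Real.exp (-(m n)) := by rw [← Real.exp_nat_mul]; ring_nf
        _ ≤ Real.exp (-Real.log n) := Real.exp_le_exp.2 (neg_le_neg (Nat.le_ceil _))
        _ = (n : ℝ)⁻¹ := by rw [Real.exp_neg, Real.exp_log hn']
    · exact inv_le_one_of_one_le₀ (one_le_pow₀ hL)
  have hLinv : Tendsto (fun n : ℕ => (Real.log n)⁻¹) atTop (𝓝 0) :=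
    tendsto_inv_atTop_zero.comp tendsto_log_natCast_atTop
  have hninv : Tendsto (fun n : ℕ => (n : ℝ)⁻¹) atTop (𝓝 0) := tendsto_inv_atTop_nhds_zero_nat
  have hc : ∀ {f : ℕ → ℝ} (a : ℝ), Tendsto f atTop (𝓝 0) → Tendsto (fun n => a * f n) atTop (𝓝 0) :=
    fun a hf => by simpa using hf.const_mul a
  have hδ0 : Tendsto δ atTop (𝓝 0) := by
    refine squeeze_zero' (hbd.mono fun n h => h.2.2.2.2.2.2.2.2.1) ?_
      (hc (Δ * (N + 3) + (4 * κ + 1)) hLinv)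
    filter_upwards [hbd] with n ⟨_, hL, _, _, _, _, _, _, _, h, _⟩
    refine h.trans ?_
    gcongr
    exact le_self_pow₀ hL (by norm_num)
  have hT1 : Tendsto (fun n => 3 * δ n * B n * m n) atTop (𝓝 0) := by
    refine squeeze_zero' ?_ ?_ (hc (6 * M * (Δ * (N + 3) + (4 * κ + 1))) hLinv)
    · filter_upwards [hbd] with n ⟨_, _, _, _, _, _, _, _, h, _, h', _⟩
      positivity
    · filter_upwards [hbd] with n ⟨_, hL, _, _, _, _, _, hmL, h, h1, h', h2, _⟩
      have hL0 : 0 < Real.log n := by linarith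
      calc 3 * δ n * B n * m n ≤ 3 * ((Δ * (N + 3) + (4 * κ + 1)) * (Real.log n ^ 11)⁻¹) * M *
            (2 * Real.log n) := by gcongr
        _ = 6 * M * (Δ * (N + 3) + (4 * κ + 1)) * (Real.log n ^ 10)⁻¹ := by field_simp; ring
        _ ≤ _ := by
            gcongr
            exact le_self_pow₀ hL (by norm_num)
  have hT2 : Tendsto (fun n => q n ^ m n) atTop (𝓝 0) := by
    refine squeeze_zero' ?_ ?_ hninv
    · filter_upwards [hbd] with n ⟨_, _, _, _, _, _, _, _, _, _, _, _, h, _⟩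
      positivity
    · filter_upwards [hbd] with n ⟨_, _, _, _, _, _, _, _, _, _, _, _, _, _, h, _⟩
      exact h
  have hηB : ∀ᶠ n in atTop, 6 * (Δ * ν n * ρ n) * B n ≤ 6 * Δ * N * M * ρ n := by
    filter_upwards [hbd] with n ⟨_, _, hρ0, _, hν0, hνN, _, _, _, _, hB0, hBM, _⟩
    calc 6 * (Δ * ν n * ρ n) * B n ≤ 6 * (Δ * N * ρ n) * M := by gcongr
      _ = _ := by ring
  have hηB0 : ∀ᶠ n in atTop, 0 ≤ 6 * (Δ * ν n * ρ n) * B n := by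
    filter_upwards [hbd] with n ⟨_, _, hρ0, _, hν0, hνN, _, _, _, _, hB0, hBM, _⟩
    positivity
  have hρ0 : Tendsto ρ atTop (𝓝 0) := by
    refine squeeze_zero' (Eventually.of_forall fun n => (hρ n).1) ?_ hLinv
    filter_upwards [hbd] with n ⟨_, _, _, _, _, _, h, _⟩
    exact h
  have hT3 : Tendsto (fun n => 6 * (Δ * ν n * ρ n) * B n) atTop (𝓝 0) :=
    squeeze_zero' hηB0 hηB (hc _ hρ0)
  have hT4 : Tendsto (fun n => (q n ^ m n + 6 * (Δ * ν n * ρ n) * B n) ^ 2 / ρ n) atTop (𝓝 0) := by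
    have h1 : Tendsto (fun n : ℕ => 2 * (n : ℝ)⁻¹ + 2 * (6 * Δ * N * M) ^ 2 * ρ n) atTop (𝓝 0) := by
      simpa using (hc 2 hninv).add (hc (2 * (6 * Δ * N * M) ^ 2) hρ0)
    refine squeeze_zero' ?_ ?_ h1
    · filter_upwards [hbd] with n ⟨_, _, h, _⟩
      positivity
    · filter_upwards [hbd, hηB, hηB0] with n
        ⟨hn, _, h, _, _, _, _, _, _, _, _, _, hq0, _, hqn, h1⟩ h2 h3
      have hn' : (0 : ℝ) < n := by exact_mod_cast hn
      have h4 := pow_le_pow_left₀ (by positivity) hqn 2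
      have h5 := pow_le_pow_left₀ h3 h2 2
      have h6 : (q n ^ m n + 6 * (Δ * ν n * ρ n) * B n) ^ 2 ≤
          2 * ((n : ℝ)⁻¹) ^ 2 + 2 * (6 * Δ * N * M * ρ n) ^ 2 := by
        refine add_sq_le.trans ?_
        linarith
      calc _ ≤ (2 * ((n : ℝ)⁻¹) ^ 2 + 2 * (6 * Δ * N * M * ρ n) ^ 2) / ρ n := by gcongr
        _ = 2 * (n : ℝ)⁻¹ * (n * ρ n)⁻¹ + 2 * (6 * Δ * N * M) ^ 2 * ρ n := by field_simp
        _ ≤ _ := by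
            refine add_le_add_left (mul_le_of_le_one_right (by positivity) h1) _
  have hT5 : Tendsto (fun n => (K n : ℝ) ^ 2 / n) atTop (𝓝 0) := by
    have h1 : Tendsto (fun n : ℕ => Real.log n ^ 2 / n) atTop (𝓝 0) :=
      (Real.isLittleO_pow_log_id_atTop (n := 2)).tendsto_div_nhds_zero.comp
        tendsto_natCast_atTop_atTop
    refine squeeze_zero' (Eventually.of_forall fun n => by positivity) ?_ (hc ((4 * κ) ^ 2) h1)
    filter_upwards [hbd] with n ⟨_, hL, _, _, _, _, _, h, _⟩
    rw [← mul_div_assoc, ← mul_pow, hKm]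
    have : 2 * (m n * (κ : ℝ)) ≤ 4 * κ * Real.log n := by
      nlinarith [mul_le_mul_of_nonneg_right h (Nat.cast_nonneg (α := ℝ) κ)]
    gcongr
  have hlim : Tendsto (fun n => Real.sqrt ((1 - (K n : ℝ) ^ 2 / n) /
      ((1 + 3 * δ n * B n * m n + q n ^ m n + 6 * (Δ * ν n * ρ n) * B n) ^ 2 +
        (q n ^ m n + 6 * (Δ * ν n * ρ n) * B n) ^ 2 / ρ n))) atTop (𝓝 1) := by
    have h1 := ((hT5.const_sub 1).div ((((hT1.const_add 1).add hT2).add hT3).pow 2 |>.add hT4)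
      (by norm_num)).sqrt
    simpa using h1
  refine tendsto_of_tendsto_of_tendsto_of_le_of_le' hlim tendsto_const_nhds ?_
    (Eventually.of_forall fun n => corr_le_one (hρ n).1 (hρ n).2 (hp n).1.le (hp n).2.2.1
      (hp n).2.2.2)
  filter_upwards [hbd, hδ0.eventually (gt_mem_nhds one_pos),
    hT1.eventually (gt_mem_nhds one_half_pos), hT3.eventually (gt_mem_nhds one_half_pos),
    hT5.eventually (gt_mem_nhds one_pos)] with n
    ⟨hn, hL, hρ0, hl, _, _, _, hmL, _, _, _, _, _, hqe, _⟩ h1 h2 h3 h4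
  refine corr_ge hn hs hρ0 (hρ n).2 (hp n).1 (hp n).2.1 (hp n).2.2.1 (hp n).2.2.2 hl ?_ rfl rfl
    h1.le rfl rfl (hqe.trans ?_) h3.le h2.le h4
  · refine Nat.le_floor ?_
    refine (hKm n).le.trans ?_
    calc 2 * (m n * (κ : ℝ)) ≤ 2 * (2 * Real.log n * κ) := by gcongr
      _ = 4 * κ * Real.log n := by ring
      _ ≤ C * Real.log n := by gcongr
  · rw [Real.exp_neg, inv_le_comm₀ (Real.exp_pos 1) (by norm_num)]
    have := Real.add_one_le_exp 1
    norm_num at this ⊢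
    linarith

end PDS

theorem theorem2p2 (ε : ℝ) (hε : 0 < ε) :
    ∃ C : ℝ, 0 < C ∧
      -- (a) lower bound, for every `n`; for `λ = 0` the bound `λ⁻² / C` on `D` is `+∞`
      (∀ (n D : ℕ) (ρ p₀ p₁ : ℝ), 1 ≤ n → 0 < ρ → ρ < 1 → 0 < p₀ → p₀ < 1 → p₀ ≤ p₁ → p₁ ≤ 1 →
        PDS.snr p₀ p₁ ≤ (1 - ε) * (ρ * Real.sqrt (Real.exp 1 * n))⁻¹ * Real.sqrt (1 - ρ) →
        (PDS.snr p₀ p₁ = 0 ∨ (D : ℝ) ≤ (PDS.snr p₀ p₁ ^ 2)⁻¹ / C) →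
        PDS.corr n D ρ p₀ p₁ ≤ C * Real.sqrt (ρ / (1 - ρ))) ∧
      -- (b) upper bound, as `n → ∞`, for parameters that may depend on `n`
      (∀ ρ p₀ p₁ : ℕ → ℝ,
        (∀ n, 0 ≤ ρ n ∧ ρ n ≤ 1) →
        (∀ n, 0 < p₀ n ∧ p₀ n < 1 ∧ p₀ n ≤ p₁ n ∧ p₁ n ≤ 1) →
        (∀ᶠ n : ℕ in atTop,
          (1 + ε) * (ρ n * Real.sqrt (Real.exp 1 * n))⁻¹ ≤ PDS.snr (p₀ n) (p₁ n)) →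
        (fun n : ℕ => (n : ℝ)⁻¹ * Real.log n ^ 12) =o[atTop] ρ →
        ρ =o[atTop] (fun n : ℕ => (Real.log n ^ 12)⁻¹) →
        (fun n : ℕ => (n : ℝ)⁻¹ * Real.log n ^ 24) =o[atTop] p₀ →
        Tendsto (fun n : ℕ => PDS.corr n ⌊C * Real.log n⌋₊ (ρ n) (p₀ n) (p₁ n)) atTop (𝓝 1)) := by
  obtain ⟨C₁, h1, ha⟩ := PDS.corr_le_of_snr_le hε
  obtain ⟨C₂, hb⟩ := PDS.exists_corr_tendsto_one hε
  refine ⟨max C₁ C₂, lt_max_of_lt_left h1, ?_, hb _ (le_max_right _ _)⟩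
  intro n D ρ p₀ p₁ hn hρ0 hρ1 h0 hp0 h01 hp1 hsnr hD
  refine (ha n D ρ p₀ p₁ hn hρ0 hρ1 h0 hp0 h01 hp1 hsnr (hD.imp_right fun h => h.trans ?_)).trans ?_
  · gcongr
    exact le_max_left _ _
  · gcongr
    exact le_max_left _ _

end
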